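/- **Setting.** Let $n\ge 1$ and equip $\mathbf{R}^n$ with a Borel measure $\mu$ such that $0<\mu(B)<\infty$ for all balls $B$ and $\mu(2B)\le C_\mu\,\mu(B)$ for all balls $B$; with $C_\mu$ the smallest such constant, let $\nu=\log_2 C_\mu$ be the doubling dimension. Write $|E|=\mu(E)$, $\langle f\rangle_{p,E}=\|f\chi_E\|_{L^p(|E|^{-1}d\mu)}$, $\langle f,g\rangle=\int fg\,d\mu$, and $p'=p/(p-1)$. Functions are real- or complex-valued. For $\alpha\in\{0,\frac13,\frac23\}^n$ let $\mathscr{D}^\alpha=\bigcup_{k\in\mathbf{Z}}\{2^{-k}([0,1)^n+m+(-1)^k\alpha): m\in\mathbf{Z}^n\}$ and $\mathscr{D}=\bigcup_\alpha\mathscr{D}^\alpha$. A collection $\mathscr{S}\subseteq\mathscr{D}$ is $\eta$-sparse ($0<\eta\le1$) if for each $\alpha$ there are pairwise disjoint measurable sets $(E_Q)_{Q\in\mathscr{S}\cap\mathscr{D}^\alpha}$ with $E_Q\subseteq Q$ and $|Q|\le\eta^{-1}|E_Q|$. A weight is a measurable function $w:\mathbf{R}^n\to(0,\infty)$; we also write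 $w$ for the measure $w\,d\mu$. Put $$[w]_{A_1}=\sup_{Q\in\mathscr{D}}\langle w\rangle_{1,Q}\,(\operatorname{ess\,inf}_Q w)^{-1},\qquad [w]_{A_\infty}=\sup_{B\text{ a ball}}\frac1{w(B)}\int_B \mathscr{M}^{\mathscr{B}}(w\chi_B)\,d\mu,$$ where $\mathscr{M}^{\mathscr{B}}$ is the uncentered maximal operator over balls. We say $w\in A_1$ if $[w]_{A_1}<\infty$, and $w\in A_\infty$ if $w$ is finite on balls and $[w]_{A_\infty}<\infty$. The weak norm is $\|h\|_{L^{r,\infty}(w)}=\sup_{t>0}t\,w(\{|h|>t\})^{1/r}$. Let $\mathcal{D}$ be a linear space of functions that is contained and dense in $L^p(w)$ for all $1\le p<\infty$ and all $w\in A_\infty$ (for example $C_c^\infty(\mathbf{R}^n)$). For $1\le p_0<q_0\le\infty$, a linear operator $T$ from $\mathcal{D}$ to measurable functions (modulo equality $\mu$-a.e.) belongs to $S(p_0,q_0)$ if there are $c_T>0$ and $0<\eta\le1$ such that for all $f,g\in\mathcal{D}$ the function $(Tf)g$ is integrable and there is an $\eta$-sparse $\mathscr{S}\subseteq\mathscr{D}$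 with $$|\langle Tf,g\rangle|\le c_T\sum_{Q\in\mathscr{S}}\langle f\rangle_{p_0,Q}\langle g\rangle_{q_0',Q}|Q|.$$ The dual operator $T^\ast$ of such a $T$ on $L^{q_0'}$ is the linear operator from $L^{q_0'}$ to measurable functions (modulo equality $\mu$-a.e.) such that $T^\ast f\in L^{p'}$ for all $f\in\mathcal{D}$ and $p_0<p<q_0$, $\langle T^\ast f,g\rangle=\langle f,Tg\rangle$ for all $f,g\in\mathcal{D}$, and $T^\ast f_k\to T^\ast f$ in measure whenever $f_k\to f$ in $L^{q_0'}$. **Theorem 1.3.** Let $1\le p_0<q_0\le\infty$ and let $T\in S(p_0,q_0)$ be linear. Then the dual operator $T^\ast$ on $L^{q_0'}$ exists and is unique, and there is a constant $c>0$, depending only on $p_0$, $q_0$, $\nu$, $n$ and on the constants $c_T,\eta$ in the sparse domination of $T$, such that for every $w\in A_1$ and every $f\in L^{q_0'}(\mu)$ $$\left\|\frac{T^\ast f}{w^{1/q_0'}}\right\|_{L^{q_0',\infty}(w)}\le c\,\big([w]_{A_\infty}\log(e+[w]_{A_1})\big)^{1/q_0'}\,\|f\|_{L^{q_0'}(\mu)}.$$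 -/

import Mathlib

open MeasureTheory Filter Topology
open scoped ENNReal NNReal

namespace SparseDual

noncomputable section

/-! ### The underlying space: `ℝⁿ` with a doubling measure -/

/-- `μ` is a doubling Borel measure on `ℝⁿ` which is positive and finite on (Euclidean) balls. -/
structure IsDoubling {n : ℕ} (μ : Measure (EuclideanSpace ℝ (Fin n))) : Prop where
  pos : ∀ x r, 0 < r → 0 < μ (Metric.ball x r)
  finite : ∀ x r, 0 < r → μ (Metric.ball x r) < ∞
  doubling : ∃ C : ℝ≥0, ∀ x r, 0 < r →
    μ (Metric.ball x (2 * r)) ≤ C * μ (Metric.ball x r)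

/-- The doubling dimension `ν = log₂ C`, where `C` is the smallest doubling constant of `μ`. -/
def doublingDimension {n : ℕ} (μ : Measure (EuclideanSpace ℝ (Fin n))) : ℝ :=
  Real.logb 2 (sInf {C : ℝ≥0 | ∀ x r, 0 < r →
    μ (Metric.ball x (2 * r)) ≤ C * μ (Metric.ball x r)} : ℝ≥0)

/-- `⟨f⟩_{p,E}`: the `L^p` norm of `f` on `E` with respect to the measure `|E|⁻¹ dμ`. -/
def avg {n : ℕ} (μ : Measure (EuclideanSpace ℝ (Fin n))) {F : Type*} [NormedAddCommGroup F]
    (f : EuclideanSpace ℝ (Fin n) → F) (p : ℝ≥0∞) (E : Set (EuclideanSpace ℝ (Fin n))) : ℝ≥0∞ :=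
  eLpNorm f p ((μ E)⁻¹ • μ.restrict E)

/-! ### Dyadic cubes and sparse collections -/

/-- The cube `2^{-k} ([0,1)ⁿ + m + (-1)^k α/3)`, where `α ∈ {0,1,2}ⁿ`. -/
def dyadicCube {n : ℕ} (α : Fin n → Fin 3) (k : ℤ) (m : Fin n → ℤ) :
    Set (EuclideanSpace ℝ (Fin n)) :=
  {x | ∀ i,
    (2 : ℝ) ^ (-k) * ((m i : ℝ) + (-1 : ℝ) ^ k * (((α i : ℕ) : ℝ) / 3)) ≤ x i ∧
    x i < (2 : ℝ) ^ (-k) * (1 + (m i : ℝ) + (-1 : ℝ) ^ k * (((α i : ℕ) : ℝ) / 3))}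

/-- The translated dyadic system with shift `α/3`. -/
def dyadicGrid {n : ℕ} (α : Fin n → Fin 3) : Set (Set (EuclideanSpace ℝ (Fin n))) :=
  {Q | ∃ (k : ℤ) (m : Fin n → ℤ), Q = dyadicCube α k m}

/-- The union of the `3ⁿ` translated dyadic systems. -/
def dyadicCubes (n : ℕ) : Set (Set (EuclideanSpace ℝ (Fin n))) :=
  ⋃ α : Fin n → Fin 3, dyadicGrid α

/-- `𝒮` is an `η`-sparse collection of dyadic cubes. -/
def IsSparse {n : ℕ} (μ : Measure (EuclideanSpace ℝ (Fin n))) (η : ℝ≥0)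
    (𝒮 : Set (Set (EuclideanSpace ℝ (Fin n)))) : Prop :=
  𝒮 ⊆ dyadicCubes n ∧
  ∀ α : Fin n → Fin 3, ∃ E : Set (EuclideanSpace ℝ (Fin n)) → Set (EuclideanSpace ℝ (Fin n)),
    (𝒮 ∩ dyadicGrid α).PairwiseDisjoint E ∧
    ∀ Q ∈ 𝒮 ∩ dyadicGrid α,
      MeasurableSet (E Q) ∧ E Q ⊆ Q ∧ μ Q ≤ (η : ℝ≥0∞)⁻¹ * μ (E Q)

/-! ### Weights -/

/-- A weight: a measurable function with values in `(0,∞)`. -/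
def IsWeight {n : ℕ} (w : EuclideanSpace ℝ (Fin n) → ℝ) : Prop :=
  Measurable w ∧ ∀ x, 0 < w x

/-- The measure `w dμ`. -/
def weightMeasure {n : ℕ} (μ : Measure (EuclideanSpace ℝ (Fin n)))
    (w : EuclideanSpace ℝ (Fin n) → ℝ) : Measure (EuclideanSpace ℝ (Fin n)) :=
  μ.withDensity fun x => ENNReal.ofReal (w x)

/-- `[w]_{A₁} = sup_Q ⟨w⟩_{1,Q} ⟨w⁻¹⟩_{∞,Q}`, the supremum being over all dyadic cubes. -/
def A1Const {n : ℕ} (μ : Measure (EuclideanSpace ℝ (Fin n)))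
    (w : EuclideanSpace ℝ (Fin n) → ℝ) : ℝ≥0∞ :=
  ⨆ Q ∈ dyadicCubes n, avg μ w 1 Q * avg μ (fun x => (w x)⁻¹) ∞ Q

/-- `w ∈ A₁`. -/
def IsA1 {n : ℕ} (μ : Measure (EuclideanSpace ℝ (Fin n)))
    (w : EuclideanSpace ℝ (Fin n) → ℝ) : Prop :=
  IsWeight w ∧ A1Const μ w < ∞

/-- The uncentered maximal function over balls. -/
def ballMaximal {n : ℕ} (μ : Measure (EuclideanSpace ℝ (Fin n)))
    (f : EuclideanSpace ℝ (Fin n) → ℝ) (x : EuclideanSpace ℝ (Fin n)) : ℝ≥0∞ :=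
  ⨆ (z : EuclideanSpace ℝ (Fin n)) (s : ℝ) (_ : 0 < s) (_ : x ∈ Metric.ball z s),
    avg μ f 1 (Metric.ball z s)

/-- Wilson's constant `[w]_{A_∞} = sup_B w(B)⁻¹ ∫_B M(w χ_B) dμ`, the supremum being over
all balls. -/
def AInftyConst {n : ℕ} (μ : Measure (EuclideanSpace ℝ (Fin n)))
    (w : EuclideanSpace ℝ (Fin n) → ℝ) : ℝ≥0∞ :=
  ⨆ (z : EuclideanSpace ℝ (Fin n)) (s : ℝ) (_ : 0 < s),
    (∫⁻ x in Metric.ball z s, ballMaximal μ ((Metric.ball z s).indicator w) x ∂μ) /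
      weightMeasure μ w (Metric.ball z s)

/-- `w ∈ A_∞`. Finiteness of `w(B)` is asked for explicitly, since the quotient in
`AInftyConst` is meaningless (and `0` in Lean) when `w(B) = ∞`. -/
def IsAInfty {n : ℕ} (μ : Measure (EuclideanSpace ℝ (Fin n)))
    (w : EuclideanSpace ℝ (Fin n) → ℝ) : Prop :=
  IsWeight w ∧ (∀ z s, weightMeasure μ w (Metric.ball z s) < ∞) ∧ AInftyConst μ w < ∞

/-- The quasinorm of the weak Lebesgue space `L^{r,∞}(ρ)`, for `0 < r < ∞`. -/
def weakNorm {n : ℕ} {𝕜 : Type*} [RCLike 𝕜] (f : EuclideanSpace ℝ (Fin n) → 𝕜) (r : ℝ≥0∞)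
    (ρ : Measure (EuclideanSpace ℝ (Fin n))) : ℝ≥0∞ :=
  ⨆ t : ℝ≥0, (t : ℝ≥0∞) * ρ {x | (t : ℝ≥0∞) < ‖f x‖ₑ} ^ (1 / r.toReal)

/-! ### Operators -/

/-- `𝒟` is a space of test functions: a linear space of functions which is contained and dense
in `L^p(w)` for all `1 ≤ p < ∞` and all weights `w ∈ A_∞`. -/
def IsTestSpace {n : ℕ} {𝕜 : Type*} [RCLike 𝕜] (μ : Measure (EuclideanSpace ℝ (Fin n)))
    (𝒟 : Submodule 𝕜 (EuclideanSpace ℝ (Fin n) → 𝕜)) : Prop :=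
  ∀ p : ℝ≥0∞, 1 ≤ p → p < ∞ → ∀ w : EuclideanSpace ℝ (Fin n) → ℝ, IsAInfty μ w →
    (∀ f ∈ 𝒟, MemLp f p (weightMeasure μ w)) ∧
    ∀ F : EuclideanSpace ℝ (Fin n) → 𝕜, MemLp F p (weightMeasure μ w) →
      ∀ ε : ℝ≥0∞, 0 < ε → ∃ f ∈ 𝒟, eLpNorm (F - f) p (weightMeasure μ w) ≤ ε

/-- The linear operator `T`, defined on the test functions, belongs to `S(p₀,q₀)` with constants
`C` and `η` in the sparse domination. The pairing is `⟨Tf,g⟩ = ∫ (Tf) g dμ`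
(no complex conjugation), which is part of the definition to exist. -/
def SparselyDominated {n : ℕ} {𝕜 : Type*} [RCLike 𝕜] (μ : Measure (EuclideanSpace ℝ (Fin n)))
    (p₀ q₀ : ℝ≥0∞) (C η : ℝ≥0) (𝒟 : Submodule 𝕜 (EuclideanSpace ℝ (Fin n) → 𝕜))
    (T : 𝒟 →ₗ[𝕜] (EuclideanSpace ℝ (Fin n) →ₘ[μ] 𝕜)) : Prop :=
  ∀ f g : 𝒟,
    Integrable (fun x => T f x * g.1 x) μ ∧
    ∃ 𝒮 : Set (Set (EuclideanSpace ℝ (Fin n))), IsSparse μ η 𝒮 ∧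
      ‖∫ x, T f x * g.1 x ∂μ‖ₑ ≤
        C * ∑' Q : 𝒮, avg μ f.1 p₀ Q * avg μ g.1 q₀.conjExponent Q * μ Q

/-- `S` is the dual operator `T*` of `T`, acting on `L^{q₀'}`. On test functions it is the
transpose of (the extension to `L^p` of) `T`, `⟨T*f,g⟩ = ⟨f,Tg⟩`, with values in `L^{p'}` for
all `p₀ < p < q₀`; on all of `L^{q₀'}` it is the extension by continuity, where the target
carries convergence in measure. -/
structure IsDual {n : ℕ} {𝕜 : Type*} [RCLike 𝕜] (μ : Measure (EuclideanSpace ℝ (Fin n)))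
    (p₀ q₀ : ℝ≥0∞) (𝒟 : Submodule 𝕜 (EuclideanSpace ℝ (Fin n) → 𝕜))
    (T : 𝒟 →ₗ[𝕜] (EuclideanSpace ℝ (Fin n) →ₘ[μ] 𝕜))
    (S : Lp 𝕜 q₀.conjExponent μ →ₗ[𝕜] (EuclideanSpace ℝ (Fin n) →ₘ[μ] 𝕜)) : Prop where
  memLp : ∀ (f : 𝒟) (hf : MemLp f.1 q₀.conjExponent μ) (p : ℝ≥0∞), p₀ < p → p < q₀ →
    MemLp (S (hf.toLp f.1)) p.conjExponent μ
  pairing : ∀ (f g : 𝒟) (hf : MemLp f.1 q₀.conjExponent μ),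
    ∫ x, S (hf.toLp f.1) x * g.1 x ∂μ = ∫ x, f.1 x * T g x ∂μ
  continuous : ∀ (u : ℕ → Lp 𝕜 q₀.conjExponent μ) (f : Lp 𝕜 q₀.conjExponent μ),
    Tendsto (fun k => eLpNorm (u k - f : Lp 𝕜 q₀.conjExponent μ) q₀.conjExponent μ)
      atTop (𝓝 0) →
    TendstoInMeasure μ (fun k => (S (u k) : EuclideanSpace ℝ (Fin n) → 𝕜)) atTop (S f)

end

end SparseDual

/-! Write s = p₀ and r = q₀'. For a test function f the sparse bound, Hölder's inequality and the
Carleson embedding make g ↦ ⟨f, Tg⟩ bounded on L^p for every p strictly between p₀ and q₀. By the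
Riesz theorem it is integration against some h = T*f, and by density |∫ h g| is at most C times any
common bound for the sparse forms ∑ ⟨g⟩_s ⟨f⟩_r |Q| (`Represents.enorm_integral_le`).

For the weak type bound, scaling reduces to the set U where |h| > w^{1/r}. Let H = |f|^r, let B_Q be
a ball containing Q of comparable size, and W(Q) = w(B_Q). The cubes with W(Q) < ∫_Q H form a bad
set of w-measure at most 3^n ∫ H (`weightMeasure_badSet_le`). Let G be U without the bad set,
truncated to where x and w are bounded, and test h against g = (h̄/|h|) w^{1-1/r} 1_G. Then w(G) ≤ ∫
h g, and the cubes inside the bad set contribute nothing to the sparse forms.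

On the other cubes F(Q) = ∫_Q H ≤ W(Q). With 1/r = 1/q + δ, the average ⟨H⟩^{1/r} splits into a
1/q-th power of ⟨H⟩, the factor (F/W)^δ and the factor (W/|Q|)^δ. By A₁ the last is at most (A w)^δ
on Q with A ≲ [w]_{A₁}, so it raises the exponent of w from 1 - 1/r to 1/p at the price A^δ. After
Hölder with exponents p and q, the p-sum is a Carleson embedding, bounded by a multiple of w(G). The
q-sum is ∑ (F/W)^{δq} F. The numbers W(Q) satisfy a Carleson packing condition with constant
comparable to [w]_{A∞}; sorting the cubes by the dyadic size of F/W gives a geometric series with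
sum about 1/δ. Taking δ comparable to 1/log(e + [w]_{A₁}) keeps A^δ bounded and turns 1/δ into the
logarithm. Absorbing the power of w(G), which is finite, finishes
(`IsSparseFamily.sum_weighted_form_le`, `le_weakTypeConst_mul`).

The case w = 1 says that T* is of weak type (r,r) on test functions, which extends it to L^r by
continuity in measure; the weighted bound passes to the limit along a subsequence converging a.e.
Uniqueness needs functions in different Lebesgue spaces representing the same functional to agree.
For this, test functions must approximate in two norms at once, which density in L^q((1+|x|)^b) for
large b provides. -/

namespace SparseDual

/-! ### Laminar families and the associated maximal function -/

section Laminar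

variable {X : Type*}

/-- Any two members of the family are nested or disjoint. -/
def IsLaminar (𝒬 : Set (Set X)) : Prop :=
  ∀ P ∈ 𝒬, ∀ Q ∈ 𝒬, P ⊆ Q ∨ Q ⊆ P ∨ Disjoint P Q

theorem IsLaminar.mono {ℛ 𝒬 : Set (Set X)} (h : IsLaminar 𝒬) (hs : ℛ ⊆ 𝒬) : IsLaminar ℛ :=
  fun P hP Q hQ => h P (hs hP) Q (hs hQ)

-- Laminarity makes distinct maximal members disjoint, and finiteness puts every member below a
-- maximal one.
open Classical in
theorem IsLaminar.exists_maximal {𝒬 : Finset (Set X)} (h : IsLaminar (𝒬 : Set (Set X))) :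
    ∃ ℛ ⊆ 𝒬, (ℛ : Set (Set X)).PairwiseDisjoint id ∧ ∀ Q ∈ 𝒬, ∃ P ∈ ℛ, Q ⊆ P := by
  refine ⟨𝒬.filter fun P => Maximal (· ∈ 𝒬) P, Finset.filter_subset _ _, ?_, ?_⟩
  · intro P hP Q hQ hne
    simp only [Finset.coe_filter, Set.mem_ofPred_eq] at hP hQ
    rcases h P hP.1 Q hQ.1 with h1 | h1 | h1
    · exact absurd (hP.2.eq_of_le hQ.1 h1) hne
    · exact absurd (hQ.2.eq_of_le hP.1 h1).symm hne
    · exact h1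
  · intro Q hQ
    obtain ⟨P, hQP, hP⟩ := Finset.exists_le_maximal 𝒬 hQ
    exact ⟨P, Finset.mem_filter.2 ⟨hP.prop, hP⟩, hQP⟩

variable [MeasurableSpace X]

/-- The maximal function over a finite family of sets. -/
noncomputable def finMaximal (μ : Measure X) (𝒬 : Finset (Set X)) (φ : X → ℝ≥0∞) (x : X) : ℝ≥0∞ :=
  𝒬.sup fun Q => Q.indicator (fun _ => ⨍⁻ y in Q, φ y ∂μ) x

variable {μ : Measure X} {𝒬 : Finset (Set X)} {φ : X → ℝ≥0∞}

theorem measurable_finMaximal (hm : ∀ Q ∈ 𝒬, MeasurableSet Q) :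
    Measurable (finMaximal μ 𝒬 φ) := by
  unfold finMaximal
  simp_rw [Finset.sup_eq_iSup]
  exact Measurable.biSup _ 𝒬.countable_toSet fun Q hQ => measurable_const.indicator (hm Q hQ)

theorem laverage_le_finMaximal {Q : Set X} (hQ : Q ∈ 𝒬) {x : X} (hx : x ∈ Q) :
    ⨍⁻ y in Q, φ y ∂μ ≤ finMaximal μ 𝒬 φ x := by
  have := Finset.le_sup (f := fun Q : Set X => Q.indicator (fun _ => ⨍⁻ y in Q, φ y ∂μ) x) hQ
  simpa [hx, finMaximal] using this

theorem lt_finMaximal_iff {t : ℝ≥0∞} {x : X} :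
    t < finMaximal μ 𝒬 φ x ↔ ∃ Q ∈ 𝒬, x ∈ Q ∧ t < ⨍⁻ y in Q, φ y ∂μ := by
  rw [finMaximal, Finset.lt_sup_iff]
  refine exists_congr fun Q => and_congr_right fun _ => ?_
  by_cases hx : x ∈ Q <;> simp [hx]

/-- The superlevel set is the disjoint union of the maximal members whose average exceeds t, and on
each of these the inequality is the definition of the average. -/
theorem IsLaminar.mul_measure_lt_finMaximal_le (h : IsLaminar (𝒬 : Set (Set X)))
    (hm : ∀ Q ∈ 𝒬, MeasurableSet Q) (t : ℝ≥0∞) :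
    t * μ {x | t < finMaximal μ 𝒬 φ x} ≤ ∫⁻ x in {x | t < finMaximal μ 𝒬 φ x}, φ x ∂μ := by
  classical
  set 𝒯 := 𝒬.filter fun Q => t < ⨍⁻ y in Q, φ y ∂μ
  have hlam : IsLaminar (𝒯 : Set (Set X)) := h.mono (Finset.coe_subset.2 (Finset.filter_subset _ _))
  obtain ⟨ℛ, hℛ, hdis, hcov⟩ := hlam.exists_maximal
  have hset : {x | t < finMaximal μ 𝒬 φ x} = ⋃ P ∈ ℛ, P := by
    ext x
    simp only [Set.mem_ofPred_eq, lt_finMaximal_iff, Set.mem_iUnion, exists_prop]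
    constructor
    · rintro ⟨Q, hQ, hx, ht⟩
      obtain ⟨P, hP, hQP⟩ := hcov Q (by simp [𝒯, hQ, ht])
      exact ⟨P, hP, hQP hx⟩
    · rintro ⟨P, hP, hx⟩
      have := hℛ hP
      simp only [𝒯, Finset.mem_filter] at this
      exact ⟨P, this.1, hx, this.2⟩
  rw [hset, lintegral_biUnion_finset (t := fun P => P) hdis
    fun P hP => hm P (Finset.filter_subset _ _ (hℛ hP))]
  calc t * μ (⋃ P ∈ ℛ, P) ≤ t * ∑ P ∈ ℛ, μ P := by gcongr; exact measure_biUnion_finset_le _ _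
    _ = ∑ P ∈ ℛ, t * μ P := Finset.mul_sum ..
    _ ≤ ∑ P ∈ ℛ, ∫⁻ x in P, φ x ∂μ := Finset.sum_le_sum fun P hP => by
        have := hℛ hP
        simp only [𝒯, Finset.mem_filter] at this
        rw [setLAverage_eq] at this
        exact ENNReal.mul_le_of_le_div this.2.le

/-- Doob's maximal inequality: integrate the weak type bound over the levels, apply Hölder, and
divide by a power of ∫ M^a. -/
theorem IsLaminar.lintegral_finMaximal_rpow_le (h : IsLaminar (𝒬 : Set (Set X)))
    (hm : ∀ Q ∈ 𝒬, MeasurableSet Q) (hfin : ∀ Q ∈ 𝒬, μ Q ≠ ∞) (h0 : ∀ Q ∈ 𝒬, μ Q ≠ 0)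
    (hφ : AEMeasurable φ μ) {a : ℝ} (ha : 1 < a) :
    ∫⁻ x, finMaximal μ 𝒬 φ x ^ a ∂μ ≤
      ENNReal.ofReal (a / (a - 1)) ^ a * ∫⁻ x, φ x ^ a ∂μ := by
  have ha0 : 0 < a := by linarith
  have ha1 : 0 < a - 1 := by linarith
  have hc : 0 < a / (a - 1) := by positivity
  by_cases htop : ∫⁻ x, φ x ^ a ∂μ = ∞
  · rw [htop, ENNReal.mul_top]
    · exact le_top
    · exact (ENNReal.rpow_pos (ENNReal.ofReal_pos.2 hc) ENNReal.ofReal_ne_top).ne'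
  set M := finMaximal μ 𝒬 φ with hM
  have hMm : Measurable M := measurable_finMaximal hm
  have hconj : a.HolderConjugate (a / (a - 1)) := Real.HolderConjugate.conjExponent ha
  have hav : ∀ Q ∈ 𝒬, ⨍⁻ y in Q, φ y ∂μ ≠ ∞ := by
    intro Q hQ
    rw [setLAverage_eq]
    refine ENNReal.div_ne_top ?_ (h0 Q hQ)
    have hH := ENNReal.lintegral_mul_le_Lp_mul_Lq (μ.restrict Q) hconj (f := φ) (g := fun _ => 1)
      hφ.restrict aemeasurable_const
    simp only [Pi.mul_apply, mul_one, ENNReal.one_rpow, lintegral_const,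
      MeasurableSet.univ, Measure.restrict_apply, Set.univ_inter, one_mul] at hH
    refine ne_top_of_le_ne_top ?_ hH
    refine ENNReal.mul_ne_top (ENNReal.rpow_ne_top_of_nonneg (by positivity) ?_)
      (ENNReal.rpow_ne_top_of_nonneg (by positivity) (hfin Q hQ))
    exact ne_top_of_le_ne_top htop (setLIntegral_le_lintegral _ _)
  have hMfin : ∀ x, M x ≠ ∞ := by
    intro x
    refine ((Finset.sup_lt_iff ENNReal.zero_lt_top).2 fun Q hQ => ?_).ne
    by_cases hx : x ∈ Q <;> simp [hx, lt_top_iff_ne_top, hav Q hQ]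
  -- A priori finiteness, which permits the final division. It comes from the family being finite
  -- with sets of finite measure.
  have hMint : ∫⁻ x, M x ^ a ∂μ ≠ ∞ := by
    have : ∀ x, M x ^ a ≤ ∑ Q ∈ 𝒬, Q.indicator (fun _ => (⨍⁻ y in Q, φ y ∂μ) ^ a) x := by
      intro x
      rcases 𝒬.eq_empty_or_nonempty with rfl | hne
      · simp [hM, finMaximal, ha0]
      obtain ⟨Q, hQ, hQe⟩ := Finset.exists_mem_eq_sup 𝒬 hne
        (fun Q => Q.indicator (fun _ => ⨍⁻ y in Q, φ y ∂μ) x)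
      have : M x = Q.indicator (fun _ => ⨍⁻ y in Q, φ y ∂μ) x := hQe
      rw [this]
      calc _ = Q.indicator (fun _ => (⨍⁻ y in Q, φ y ∂μ) ^ a) x := by
            by_cases hx : x ∈ Q <;> simp [hx, ha0]
        _ ≤ _ := Finset.single_le_sum (f := fun Q : Set X =>
            Q.indicator (fun _ => (⨍⁻ y in Q, φ y ∂μ) ^ a) x) (fun _ _ => zero_le) hQ
    refine ne_top_of_le_ne_top ?_ (lintegral_mono this)
    rw [lintegral_finsetSum _ fun Q hQ => measurable_const.indicator (hm Q hQ)]
    refine (ENNReal.sum_lt_top.2 fun Q hQ => ?_).ne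
    rw [lintegral_indicator (hm Q hQ), setLIntegral_const]
    exact ENNReal.mul_lt_top (ENNReal.rpow_lt_top_of_nonneg ha0.le (hav Q hQ))
      (hfin Q hQ).lt_top
  have hcake : ∀ (ρ : Measure X) (b : ℝ), 0 < b → ∫⁻ x, M x ^ b ∂ρ =
      ENNReal.ofReal b * ∫⁻ t in Set.Ioi (0 : ℝ),
        ρ {x | ENNReal.ofReal t < M x} * ENNReal.ofReal (t ^ (b - 1)) := by
    intro ρ b hb
    have := lintegral_rpow_eq_lintegral_meas_lt_mul ρ (f := fun x => (M x).toReal)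
      (Eventually.of_forall fun x => ENNReal.toReal_nonneg) hMm.ennreal_toReal.aemeasurable hb
    rw [show ∫⁻ x, M x ^ b ∂ρ = ∫⁻ x, ENNReal.ofReal ((M x).toReal ^ b) ∂ρ from
      lintegral_congr fun x => by
        rw [← ENNReal.ofReal_rpow_of_nonneg ENNReal.toReal_nonneg hb.le,
          ENNReal.ofReal_toReal (hMfin x)], this]
    congr 1
    refine setLIntegral_congr_fun measurableSet_Ioi fun t ht => ?_
    congr 2
    ext x
    simp only [Set.mem_ofPred_eq]
    rw [← ENNReal.ofReal_lt_iff_lt_toReal (le_of_lt ht) (hMfin x)]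
  have key : ∫⁻ x, M x ^ a ∂μ ≤
      ENNReal.ofReal (a / (a - 1)) * ∫⁻ x, φ x * M x ^ (a - 1) ∂μ := by
    -- The layer cake formula is used for M^a against μ and for M^{a-1} against φ dμ; the ratio of
    -- its prefactors a and a - 1 is the constant of the inequality.
    have h2 := hcake (μ.withDensity φ) (a - 1) ha1
    rw [lintegral_withDensity_eq_lintegral_mul₀ hφ (hMm.pow_const _).aemeasurable] at h2
    simp only [Pi.mul_apply] at h2
    rw [h2, hcake μ a ha0, ← mul_assoc, ← ENNReal.ofReal_mul hc.le, div_mul_cancel₀ _ ha1.ne']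
    refine mul_le_mul' le_rfl ?_
    refine setLIntegral_mono' measurableSet_Ioi fun t (ht : 0 < t) => ?_
    rw [withDensity_apply _ (measurableSet_lt measurable_const hMm)]
    calc μ {x | ENNReal.ofReal t < M x} * ENNReal.ofReal (t ^ (a - 1))
        = (ENNReal.ofReal t * μ {x | ENNReal.ofReal t < M x}) *
            ENNReal.ofReal (t ^ (a - 1 - 1)) := by
          rw [show t ^ (a - 1) = t * t ^ (a - 1 - 1) by
            rw [Real.rpow_sub_one ht.ne' (a - 1), mul_div_cancel₀ _ ht.ne'], ENNReal.ofReal_mul ht.le]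
          ring
      _ ≤ _ := by gcongr; exact h.mul_measure_lt_finMaximal_le hm _
  have hol := ENNReal.lintegral_mul_le_Lp_mul_Lq μ hconj hφ
    (hMm.pow_const (a - 1)).aemeasurable
  simp only [Pi.mul_apply, ← ENNReal.rpow_mul, mul_div_cancel₀ _ ha1.ne'] at hol
  set I := ∫⁻ x, M x ^ a ∂μ
  by_cases hI : I = 0
  · rw [hI]; exact zero_le
  have h3 : I ≤ ENNReal.ofReal (a / (a - 1)) * (∫⁻ x, φ x ^ a ∂μ) ^ (1 / a) *
      I ^ (1 / (a / (a - 1))) := by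
    rw [mul_assoc]; exact key.trans (by gcongr)
  have h4 : I ^ (1 / a) ≤ ENNReal.ofReal (a / (a - 1)) * (∫⁻ x, φ x ^ a ∂μ) ^ (1 / a) := by
    have hI2 : I = I ^ (1 / a) * I ^ (1 / (a / (a - 1))) := by
      rw [← ENNReal.rpow_add _ _ hI hMint]
      have : 1 / a + 1 / (a / (a - 1)) = 1 := by field_simp; ring
      rw [this, ENNReal.rpow_one]
    have hpos : I ^ (1 / (a / (a - 1))) ≠ 0 :=
      (ENNReal.rpow_pos (pos_iff_ne_zero.2 hI) hMint).ne'
    have hnt : I ^ (1 / (a / (a - 1))) ≠ ∞ :=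
      ENNReal.rpow_ne_top_of_nonneg (by positivity) hMint
    rw [hI2] at h3
    have h5 : I ^ (1 / a) * I ^ (1 / (a / (a - 1))) ≤ ENNReal.ofReal (a / (a - 1)) *
        (∫⁻ x, φ x ^ a ∂μ) ^ (1 / a) * I ^ (1 / (a / (a - 1))) := by
      convert h3 using 2
      rw [← hI2]
    exact (ENNReal.mul_le_mul_iff_left hpos hnt).1 h5
  calc I = (I ^ (1 / a)) ^ a := by rw [← ENNReal.rpow_mul, one_div_mul_cancel ha0.ne',
        ENNReal.rpow_one]
    _ ≤ (ENNReal.ofReal (a / (a - 1)) * (∫⁻ x, φ x ^ a ∂μ) ^ (1 / a)) ^ a := by gcongr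
    _ = _ := by rw [ENNReal.mul_rpow_of_nonneg _ _ ha0.le, ← ENNReal.rpow_mul,
        one_div_mul_cancel ha0.ne', ENNReal.rpow_one]

/-- Carleson embedding for sparse families. -/
theorem IsLaminar.sum_laverage_rpow_mul_le (h : IsLaminar (𝒬 : Set (Set X)))
    (hm : ∀ Q ∈ 𝒬, MeasurableSet Q) (hfin : ∀ Q ∈ 𝒬, μ Q ≠ ∞) (h0 : ∀ Q ∈ 𝒬, μ Q ≠ 0)
    {E : Set X → Set X} (hE : (𝒬 : Set (Set X)).PairwiseDisjoint E)
    (hEm : ∀ Q ∈ 𝒬, MeasurableSet (E Q)) (hEQ : ∀ Q ∈ 𝒬, E Q ⊆ Q) {κ : ℝ≥0∞}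
    (hκ : ∀ Q ∈ 𝒬, μ Q ≤ κ * μ (E Q))
    (hφ : AEMeasurable φ μ) {a : ℝ} (ha : 1 < a) :
    ∑ Q ∈ 𝒬, (⨍⁻ y in Q, φ y ∂μ) ^ a * μ Q ≤
      κ * (ENNReal.ofReal (a / (a - 1)) ^ a * ∫⁻ x, φ x ^ a ∂μ) := by
  calc ∑ Q ∈ 𝒬, (⨍⁻ y in Q, φ y ∂μ) ^ a * μ Q
      ≤ ∑ Q ∈ 𝒬, κ * ∫⁻ x in E Q, finMaximal μ 𝒬 φ x ^ a ∂μ := by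
        refine Finset.sum_le_sum fun Q hQ => ?_
        calc _ ≤ (⨍⁻ y in Q, φ y ∂μ) ^ a * (κ * μ (E Q)) := by gcongr; exact hκ Q hQ
          _ = κ * ∫⁻ x in E Q, (⨍⁻ y in Q, φ y ∂μ) ^ a ∂μ := by rw [setLIntegral_const]; ring
          _ ≤ _ := by
            refine mul_le_mul' le_rfl ?_
            refine setLIntegral_mono' (hEm Q hQ) fun x hx => ?_
            gcongr
            exact laverage_le_finMaximal hQ (hEQ Q hQ hx)
    _ = κ * ∫⁻ x in ⋃ Q ∈ 𝒬, E Q, finMaximal μ 𝒬 φ x ^ a ∂μ := by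
        rw [← Finset.mul_sum, lintegral_biUnion_finset hE hEm]
    _ ≤ κ * ∫⁻ x, finMaximal μ 𝒬 φ x ^ a ∂μ := mul_le_mul' le_rfl (setLIntegral_le_lintegral _ _)
    _ ≤ _ := by gcongr; exact h.lintegral_finMaximal_rpow_le hm hfin h0 hφ ha

end Laminar

/-! ### Estimates for sparse forms over finite laminar families -/

section Forms

variable {X : Type*} [MeasurableSpace X] {μ : Measure X} {𝒬 : Finset (Set X)}

/-- Every member lies below a maximal one, so packing reduces the sum to the maximal members. These
are disjoint, hence their integrals add up to at most the full integral. -/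
theorem IsLaminar.sum_le_of_packing {W : Set X → ℝ≥0∞} {Λ : ℝ≥0∞} {𝒯 : Finset (Set X)}
    (h : IsLaminar (𝒯 : Set (Set X))) (hm : ∀ Q ∈ 𝒯, MeasurableSet Q) (hsub : 𝒯 ⊆ 𝒬)
    (hpack : ∀ R ∈ 𝒬, ∑' Q : {Q // Q ∈ 𝒬 ∧ Q ⊆ R}, W Q ≤ Λ * W R)
    (H : X → ℝ≥0∞) {c : ℝ≥0∞} (hc : ∀ Q ∈ 𝒯, W Q ≤ c * ∫⁻ x in Q, H x ∂μ) :
    ∑ Q ∈ 𝒯, W Q ≤ Λ * (c * ∫⁻ x, H x ∂μ) := by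
  classical
  obtain ⟨ℛ, hℛ, hdis, hcov⟩ := h.exists_maximal
  calc ∑ Q ∈ 𝒯, W Q ≤ ∑ R ∈ ℛ, ∑ Q ∈ 𝒯 with Q ⊆ R, W Q := by
        simp_rw [Finset.sum_filter]
        rw [Finset.sum_comm]
        refine Finset.sum_le_sum fun Q hQ => ?_
        obtain ⟨R, hR, hQR⟩ := hcov Q hQ
        have := Finset.single_le_sum (f := fun R => if Q ⊆ R then W Q else 0)
          (fun _ _ => zero_le) hR
        simpa [hQR] using this
    _ ≤ ∑ R ∈ ℛ, Λ * W R := by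
        refine Finset.sum_le_sum fun R hR => le_trans ?_ (hpack R (hsub (hℛ hR)))
        rw [← Finset.sum_coe_sort]
        have hinj : Function.Injective (fun Q : {Q // Q ∈ 𝒯.filter (· ⊆ R)} =>
            (⟨Q.1, hsub (Finset.mem_filter.1 Q.2).1, (Finset.mem_filter.1 Q.2).2⟩ :
              {Q // Q ∈ 𝒬 ∧ Q ⊆ R})) := by
          intro a b hab
          exact Subtype.ext (congrArg (fun z => z.1) hab)
        rw [← tsum_fintype (L := .unconditional _)]
        exact ENNReal.tsum_comp_le_tsum_of_injective hinj fun Q => W Q.1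
    _ ≤ ∑ R ∈ ℛ, Λ * (c * ∫⁻ x in R, H x ∂μ) := by
        gcongr with R hR
        exact hc R (hℛ hR)
    _ = Λ * (c * ∫⁻ x in ⋃ R ∈ ℛ, R, H x ∂μ) := by
        rw [lintegral_biUnion_finset (t := fun P => P) hdis fun P hP => hm P (hℛ hP),
          Finset.mul_sum, Finset.mul_sum]
    _ ≤ _ := by
        refine mul_le_mul' le_rfl (mul_le_mul' le_rfl (setLIntegral_le_lintegral _ _))

/-- Bernoulli's inequality gives (1/2)^ε ≤ 1 - ε/2. This bounds the sum of the geometric series that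
produces the logarithm. -/
theorem one_sub_half_rpow_inv_le {ε : ℝ} (h0 : 0 < ε) (h1 : ε ≤ 1) :
    (1 - ((2 : ℝ≥0∞)⁻¹) ^ ε)⁻¹ ≤ ENNReal.ofReal (2 / ε) := by
  have h := rpow_one_add_le_one_add_mul_self (s := -(1 / 2)) (by norm_num) h0.le h1
  have h2 : ((2 : ℝ≥0∞)⁻¹) ^ ε = ENNReal.ofReal ((1 / 2 : ℝ) ^ ε) := by
    rw [← ENNReal.ofReal_rpow_of_pos (by norm_num), one_div, ENNReal.ofReal_inv_of_pos (by norm_num)]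
    simp
  rw [h2, ← ENNReal.ofReal_one, ← ENNReal.ofReal_sub _ (by positivity)]
  have h3 : ε / 2 ≤ 1 - (1 / 2 : ℝ) ^ ε := by
    norm_num at h ⊢; linarith
  rw [← ENNReal.ofReal_inv_of_pos (by linarith [half_pos h0])]
  refine ENNReal.ofReal_le_ofReal ?_
  rw [← inv_div ε 2]
  exact inv_anti₀ (by positivity) h3

/-- Sort the sets by the dyadic size of F/W ≤ 1. On the level F/W ~ 2^{-k} packing bounds ∑ F by 2Λ
∫ H independently of k: the 2^{-k} from F ≤ 2^{-k} W cancels the 2^{k+1} from W ≤ 2^{k+1} F. The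
power ε then supplies the factor 2^{-kε} that makes the levels summable. -/
theorem IsLaminar.sum_rpow_mul_le_of_packing (h : IsLaminar (𝒬 : Set (Set X)))
    (hm : ∀ Q ∈ 𝒬, MeasurableSet Q) {W : Set X → ℝ≥0∞} {Λ : ℝ≥0∞} {H : X → ℝ≥0∞}
    (hW0 : ∀ Q ∈ 𝒬, W Q ≠ 0) (hWt : ∀ Q ∈ 𝒬, W Q ≠ ∞)
    (hF : ∀ Q ∈ 𝒬, ∫⁻ x in Q, H x ∂μ ≤ W Q)
    (hpack : ∀ R ∈ 𝒬, ∑' Q : {Q // Q ∈ 𝒬 ∧ Q ⊆ R}, W Q ≤ Λ * W R)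
    {ε : ℝ} (hε0 : 0 < ε) (hε1 : ε ≤ 1) :
    ∑ Q ∈ 𝒬, ((∫⁻ x in Q, H x ∂μ) / W Q) ^ ε * ∫⁻ x in Q, H x ∂μ ≤
      ENNReal.ofReal (4 / ε) * Λ * ∫⁻ x, H x ∂μ := by
  classical
  set F : Set X → ℝ≥0∞ := fun Q => ∫⁻ x in Q, H x ∂μ with hFdef
  set 𝒬' := 𝒬.filter fun Q => F Q ≠ 0
  have hj : ∀ Q, ∃ k : ℕ, Q ∈ 𝒬' → (2 : ℝ≥0∞)⁻¹ ^ (k + 1) < F Q / W Q ∧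
      F Q / W Q ≤ (2 : ℝ≥0∞)⁻¹ ^ k := by
    intro Q
    by_cases hQ : Q ∈ 𝒬'
    swap
    · exact ⟨0, fun h => absurd h hQ⟩
    obtain ⟨hQ1, hQ2⟩ := Finset.mem_filter.1 hQ
    have hle : F Q / W Q ≤ 1 := ENNReal.div_le_of_le_mul (by simpa using hF Q hQ1)
    have hpos : F Q / W Q ≠ 0 := by simp [ENNReal.div_eq_zero_iff, hQ2, hWt Q hQ1]
    have hnt : F Q / W Q ≠ ∞ := ne_top_of_le_ne_top ENNReal.one_ne_top hle
    obtain ⟨k, hk1, hk2⟩ := exists_nat_pow_near_of_lt_one (x := (F Q / W Q).toReal)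
      (y := (2 : ℝ)⁻¹) (ENNReal.toReal_pos hpos hnt)
      (by simpa using ENNReal.toReal_mono ENNReal.one_ne_top hle) (by norm_num) (by norm_num)
    have hc : ∀ m : ℕ, (2 : ℝ≥0∞)⁻¹ ^ m = ENNReal.ofReal ((2 : ℝ)⁻¹ ^ m) := fun m => by
      rw [ENNReal.ofReal_pow (by norm_num), ENNReal.ofReal_inv_of_pos (by norm_num)]; simp
    refine ⟨k, fun _ => ⟨?_, ?_⟩⟩
    · rw [hc]; exact (ENNReal.ofReal_lt_iff_lt_toReal (by positivity) hnt).2 hk1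
    · rw [hc]; exact (ENNReal.le_ofReal_iff_toReal_le hnt (by positivity)).2 hk2
  choose j hj using hj
  have hlevel : ∀ k : ℕ, ∑ Q ∈ 𝒬' with j Q = k, F Q ≤ 2 * Λ * ∫⁻ x, H x ∂μ := by
    intro k
    set 𝒯 := 𝒬'.filter fun Q => j Q = k
    have hsub : 𝒯 ⊆ 𝒬 := (Finset.filter_subset _ _).trans (Finset.filter_subset _ _)
    have hk0 : (2 : ℝ≥0∞)⁻¹ ^ k ≠ 0 := by simp
    have hkt : (2 : ℝ≥0∞)⁻¹ ^ k ≠ ∞ := by simp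
    calc ∑ Q ∈ 𝒯, F Q ≤ ∑ Q ∈ 𝒯, (2 : ℝ≥0∞)⁻¹ ^ k * W Q := by
          refine Finset.sum_le_sum fun Q hQ => ?_
          obtain ⟨hQ1, hQ2⟩ := Finset.mem_filter.1 hQ
          have := (hj Q hQ1).2
          rw [hQ2] at this
          exact (ENNReal.div_le_iff (hW0 Q (hsub hQ)) (hWt Q (hsub hQ))).1 this
      _ = (2 : ℝ≥0∞)⁻¹ ^ k * ∑ Q ∈ 𝒯, W Q := (Finset.mul_sum ..).symm
      _ ≤ (2 : ℝ≥0∞)⁻¹ ^ k * (Λ * (2 ^ (k + 1) * ∫⁻ x, H x ∂μ)) := by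
          gcongr
          refine (h.mono (Finset.coe_subset.2 hsub)).sum_le_of_packing
            (fun Q hQ => hm Q (hsub hQ)) hsub hpack H fun Q hQ => ?_
          obtain ⟨hQ1, hQ2⟩ := Finset.mem_filter.1 hQ
          have := (hj Q hQ1).1.le
          rw [hQ2, ENNReal.le_div_iff_mul_le (Or.inl (hW0 Q (hsub hQ)))
            (Or.inl (hWt Q (hsub hQ)))] at this
          calc W Q = 2 ^ (k + 1) * ((2 : ℝ≥0∞)⁻¹ ^ (k + 1) * W Q) := by
                rw [← mul_assoc, ← mul_pow, ENNReal.mul_inv_cancel (by simp) (by simp)]; simp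
            _ ≤ _ := by gcongr
      _ = ((2 : ℝ≥0∞)⁻¹ ^ k * 2 ^ k) * (2 * Λ * ∫⁻ x, H x ∂μ) := by ring
      _ = _ := by rw [← mul_pow, ENNReal.inv_mul_cancel (by simp) (by simp)]; simp
  calc ∑ Q ∈ 𝒬, (F Q / W Q) ^ ε * F Q = ∑ Q ∈ 𝒬', (F Q / W Q) ^ ε * F Q := by
        refine (Finset.sum_filter_of_ne (p := fun Q => F Q ≠ 0) fun Q _ hne hz => hne ?_).symm
        simp [hz]
    _ = ∑ k ∈ 𝒬'.image j, ∑ Q ∈ 𝒬' with j Q = k, (F Q / W Q) ^ ε * F Q :=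
        (Finset.sum_fiberwise_of_maps_to (fun Q hQ => Finset.mem_image_of_mem j hQ) _).symm
    _ ≤ ∑ k ∈ 𝒬'.image j, ((2 : ℝ≥0∞)⁻¹ ^ ε) ^ k * (2 * Λ * ∫⁻ x, H x ∂μ) := by
        refine Finset.sum_le_sum fun k _ => ?_
        calc _ ≤ ∑ Q ∈ 𝒬' with j Q = k, ((2 : ℝ≥0∞)⁻¹ ^ ε) ^ k * F Q := by
              refine Finset.sum_le_sum fun Q hQ => ?_
              obtain ⟨hQ1, hQ2⟩ := Finset.mem_filter.1 hQ
              have := (hj Q hQ1).2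
              rw [hQ2] at this
              gcongr
              rw [← ENNReal.rpow_natCast, ← ENNReal.rpow_mul, mul_comm, ENNReal.rpow_mul,
                ENNReal.rpow_natCast]
              gcongr
          _ ≤ _ := by rw [← Finset.mul_sum]; gcongr; exact hlevel k
    _ ≤ ∑' k : ℕ, ((2 : ℝ≥0∞)⁻¹ ^ ε) ^ k * (2 * Λ * ∫⁻ x, H x ∂μ) := ENNReal.sum_le_tsum _
    _ = (1 - (2 : ℝ≥0∞)⁻¹ ^ ε)⁻¹ * (2 * Λ * ∫⁻ x, H x ∂μ) := by
        rw [ENNReal.tsum_mul_right, ENNReal.tsum_geometric]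
    _ ≤ ENNReal.ofReal (2 / ε) * (2 * Λ * ∫⁻ x, H x ∂μ) := by
        gcongr; exact one_sub_half_rpow_inv_le hε0 hε1
    _ = _ := by
        rw [show (4 : ℝ) / ε = 2 / ε * 2 by ring, ENNReal.ofReal_mul (by positivity)]
        simp only [ENNReal.ofReal_ofNat]
        ring

/-- A finite laminar family of sets of positive finite measure, which is sparse with constant
`κ⁻¹` as witnessed by the sets `E Q`. -/
structure IsSparseFamily (μ : Measure X) (𝒬 : Finset (Set X)) (E : Set X → Set X) (κ : ℝ≥0∞) :
    Prop where
  laminar : IsLaminar (𝒬 : Set (Set X))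
  measurableSet : ∀ Q ∈ 𝒬, MeasurableSet Q
  ne_top : ∀ Q ∈ 𝒬, μ Q ≠ ∞
  ne_zero : ∀ Q ∈ 𝒬, μ Q ≠ 0
  disjoint : (𝒬 : Set (Set X)).PairwiseDisjoint E
  measurableSet_part : ∀ Q ∈ 𝒬, MeasurableSet (E Q)
  part_subset : ∀ Q ∈ 𝒬, E Q ⊆ Q
  measure_le : ∀ Q ∈ 𝒬, μ Q ≤ κ * μ (E Q)

variable {E : Set X → Set X} {κ : ℝ≥0∞}

/-- The Carleson embedding for φ^s with exponent p/s > 1. The factor |Q|^{1/p} is kept inside the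
p-th power, in the form in which Hölder for sums delivers it. -/
theorem IsSparseFamily.sum_laverage_rpow_le (h : IsSparseFamily μ 𝒬 E κ)
    {φ : X → ℝ≥0∞} (hφ : AEMeasurable φ μ) {s p : ℝ}
    (hs : 0 < s) (hsp : s < p) :
    ∑ Q ∈ 𝒬, ((⨍⁻ y in Q, φ y ^ s ∂μ) ^ (1 / s) * μ Q ^ (1 / p)) ^ p ≤
      κ * (ENNReal.ofReal (p / (p - s)) ^ (p / s) * ∫⁻ x, φ x ^ p ∂μ) := by
  have hp : 0 < p := hs.trans hsp
  have := h.laminar.sum_laverage_rpow_mul_le h.measurableSet h.ne_top h.ne_zero h.disjoint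
    h.measurableSet_part h.part_subset h.measure_le (hφ.pow_const s)
    (a := p / s) ((one_lt_div hs).2 hsp)
  have e1 : p / s / (p / s - 1) = p / (p - s) := by
    have : p - s ≠ 0 := by linarith
    field_simp
  simp only [← ENNReal.rpow_mul, e1, mul_div_cancel₀ _ hs.ne'] at this
  convert this using 2 with Q
  rw [ENNReal.mul_rpow_of_nonneg _ _ hp.le, ← ENNReal.rpow_mul, ← ENNReal.rpow_mul,
    one_div_mul_cancel hp.ne', ENNReal.rpow_one, one_div_mul_eq_div]

/-- Strong type bound for sparse forms. -/
theorem IsSparseFamily.sum_form_le (h : IsSparseFamily μ 𝒬 E κ)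
    {φ ψ : X → ℝ≥0∞} (hφ : AEMeasurable φ μ) (hψ : AEMeasurable ψ μ)
    {s r p q : ℝ} (hs : 0 < s) (hr : 0 < r) (hpq : p.HolderConjugate q) (hsp : s < p)
    (hrq : r < q) :
    ∑ Q ∈ 𝒬, (⨍⁻ y in Q, φ y ^ s ∂μ) ^ (1 / s) * (⨍⁻ y in Q, ψ y ^ r ∂μ) ^ (1 / r) * μ Q ≤
      (κ * (ENNReal.ofReal (p / (p - s)) ^ (p / s) * ∫⁻ x, φ x ^ p ∂μ)) ^ (1 / p) *
      (κ * (ENNReal.ofReal (q / (q - r)) ^ (q / r) * ∫⁻ x, ψ x ^ q ∂μ)) ^ (1 / q) := by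
  have hp := hpq.pos
  have hq := hpq.symm.pos
  calc _ = ∑ Q ∈ 𝒬, ((⨍⁻ y in Q, φ y ^ s ∂μ) ^ (1 / s) * μ Q ^ (1 / p)) *
        ((⨍⁻ y in Q, ψ y ^ r ∂μ) ^ (1 / r) * μ Q ^ (1 / q)) := by
        refine Finset.sum_congr rfl fun Q hQ => ?_
        have : μ Q = μ Q ^ (1 / p) * μ Q ^ (1 / q) := by
          rw [← ENNReal.rpow_add _ _ (h.ne_zero Q hQ) (h.ne_top Q hQ), one_div, one_div,
            hpq.inv_add_inv_eq_one, ENNReal.rpow_one]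
        nth_rw 1 [this]
        ring
    _ ≤ _ := ENNReal.inner_le_Lp_mul_Lq _ _ _ hpq
    _ ≤ _ := by
        gcongr
        · exact h.sum_laverage_rpow_le hφ hs hsp
        · exact h.sum_laverage_rpow_le hψ hr hrq

/-- The bound for sparse forms which is behind the weighted weak type estimate. -/
theorem IsSparseFamily.sum_weighted_form_le (h : IsSparseFamily μ 𝒬 E κ)
    {w H : X → ℝ≥0∞} {G : Set X} (hw : Measurable w)
    (hw0 : ∀ x, w x ≠ 0) (hwt : ∀ x, w x ≠ ∞)
    (hG : MeasurableSet G) {W : Set X → ℝ≥0∞} {Λ A : ℝ≥0∞}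
    (hW0 : ∀ Q ∈ 𝒬, W Q ≠ 0) (hWt : ∀ Q ∈ 𝒬, W Q ≠ ∞)
    (hF : ∀ Q ∈ 𝒬, ∫⁻ x in Q, H x ∂μ ≤ W Q)
    (hpack : ∀ R ∈ 𝒬, ∑' Q : {Q // Q ∈ 𝒬 ∧ Q ⊆ R}, W Q ≤ Λ * W R)
    (hA : ∀ Q ∈ 𝒬, ∀ᵐ x ∂μ.restrict Q, W Q / μ Q ≤ A * w x)
    {s r p q δ : ℝ} (hs : 0 < s) (hpq : p.HolderConjugate q) (hsp : s < p)
    (hδ : 0 < δ) (hrq : 1 / r = 1 / q + δ) (hδq : δ * q ≤ 1) :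
    ∑ Q ∈ 𝒬, (⨍⁻ y in Q, (G.indicator (fun x => w x ^ (1 - 1 / r)) y) ^ s ∂μ) ^ (1 / s) *
        (⨍⁻ y in Q, H y ∂μ) ^ (1 / r) * μ Q ≤
      A ^ δ * ((κ * (ENNReal.ofReal (p / (p - s)) ^ (p / s) * ∫⁻ x in G, w x ∂μ)) ^ (1 / p) *
        (ENNReal.ofReal (4 / (δ * q)) * Λ * ∫⁻ x, H x ∂μ) ^ (1 / q)) := by
  have hp := hpq.pos
  have hq := hpq.symm.pos
  set F : Set X → ℝ≥0∞ := fun Q => ∫⁻ x in Q, H x ∂μ with hFdef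
  set φ : X → ℝ≥0∞ := G.indicator (fun x => w x ^ (1 / p)) with hφdef
  have hφm : Measurable φ := (hw.pow_const _).indicator hG
  have hterm : ∀ Q ∈ 𝒬,
      (⨍⁻ y in Q, (G.indicator (fun x => w x ^ (1 - 1 / r)) y) ^ s ∂μ) ^ (1 / s) *
        (⨍⁻ y in Q, H y ∂μ) ^ (1 / r) * μ Q ≤
      A ^ δ * (((⨍⁻ y in Q, φ y ^ s ∂μ) ^ (1 / s) * μ Q ^ (1 / p)) *
        ((F Q / W Q) ^ δ * F Q ^ (1 / q))) := by
    intro Q hQ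
    have hm0 := h.ne_zero Q hQ
    have hmt := h.ne_top Q hQ
    have hmeas : μ Q = μ Q ^ (1 / p) * μ Q ^ (1 / q) := by
      rw [← ENNReal.rpow_add _ _ hm0 hmt, one_div, one_div,
        hpq.inv_add_inv_eq_one, ENNReal.rpow_one]
    -- Split the exponent as 1/r = 1/q + δ and insert W/W in the δ part.
    have hsplit : (⨍⁻ y in Q, H y ∂μ) ^ (1 / r) * μ Q ^ (1 / q) =
        F Q ^ (1 / q) * ((F Q / W Q) ^ δ * (W Q / μ Q) ^ δ) := by
      rw [setLAverage_eq, hrq, ENNReal.rpow_add_of_nonneg _ _ (by positivity) hδ.le]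
      rw [← ENNReal.mul_rpow_of_nonneg _ _ hδ.le, mul_right_comm,
        ← ENNReal.mul_rpow_of_nonneg _ _ (by positivity : 0 ≤ 1 / q),
        ENNReal.div_mul_cancel hm0 hmt, ← mul_div_assoc,
        ENNReal.div_mul_cancel (hW0 Q hQ) (hWt Q hQ)]
    -- The constant (W/|Q|)^δ is moved inside the average, where it is at most (A w)^δ; since 1/p =
    -- 1 - 1/r + δ this turns w^{1-1/r} into w^{1/p}.
    have hX : (⨍⁻ y in Q, (G.indicator (fun x => w x ^ (1 - 1 / r)) y) ^ s ∂μ) ^ (1 / s) *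
        (W Q / μ Q) ^ δ ≤ A ^ δ * (⨍⁻ y in Q, φ y ^ s ∂μ) ^ (1 / s) := by
      have e : ∀ (a b : ℝ≥0∞), a ^ (1 / s) * b ^ δ = (a * b ^ (δ * s)) ^ (1 / s) := by
        intro a b
        rw [ENNReal.mul_rpow_of_nonneg _ _ (by positivity), ← ENNReal.rpow_mul]
        congr 2
        field_simp
      rw [mul_comm (A ^ δ), e, e]
      refine ENNReal.rpow_le_rpow ?_ (by positivity)
      simp only [setLAverage_eq, ENNReal.div_eq_inv_mul]
      rw [mul_assoc, mul_assoc]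
      refine mul_le_mul' le_rfl ?_
      rw [← lintegral_mul_const'' _ ((hw.pow_const _).indicator hG |>.pow_const _).aemeasurable,
        ← lintegral_mul_const'' _ (hφm.pow_const _).aemeasurable]
      refine lintegral_mono_ae ?_
      filter_upwards [hA Q hQ] with x hx
      by_cases hxG : x ∈ G
      · simp only [hxG, Set.indicator_of_mem, hφdef]
        rw [ENNReal.div_eq_inv_mul] at hx
        calc (w x ^ (1 - 1 / r)) ^ s * ((μ Q)⁻¹ * W Q) ^ (δ * s)
            ≤ (w x ^ (1 - 1 / r)) ^ s * (A * w x) ^ (δ * s) := by gcongr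
          _ = (w x ^ (1 / p)) ^ s * A ^ (δ * s) := by
            have : 1 / p = 1 - 1 / r + δ := by
              have := hpq.inv_add_inv_eq_one
              simp only [one_div] at *
              linarith
            rw [ENNReal.mul_rpow_of_nonneg _ _ (by positivity), this,
              ENNReal.rpow_add _ _ (hw0 x) (hwt x), ENNReal.mul_rpow_of_nonneg _ _ hs.le,
              ENNReal.rpow_mul (w x) δ s]
            ring
      · simp [hxG, hs]
    calc _ = (⨍⁻ y in Q, (G.indicator (fun x => w x ^ (1 - 1 / r)) y) ^ s ∂μ) ^ (1 / s) *
          ((⨍⁻ y in Q, H y ∂μ) ^ (1 / r) * μ Q ^ (1 / q)) * μ Q ^ (1 / p) := by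
            nth_rw 1 [hmeas]; ring
      _ = ((⨍⁻ y in Q, (G.indicator (fun x => w x ^ (1 - 1 / r)) y) ^ s ∂μ) ^ (1 / s) *
          (W Q / μ Q) ^ δ) * μ Q ^ (1 / p) * ((F Q / W Q) ^ δ * F Q ^ (1 / q)) := by
            rw [hsplit]; ring
      _ ≤ (A ^ δ * (⨍⁻ y in Q, φ y ^ s ∂μ) ^ (1 / s)) * μ Q ^ (1 / p) *
          ((F Q / W Q) ^ δ * F Q ^ (1 / q)) := by gcongr
      _ = _ := by ring
  refine (Finset.sum_le_sum hterm).trans ?_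
  rw [← Finset.mul_sum]
  refine mul_le_mul' le_rfl ?_
  -- The p-sum is the Carleson embedding for w^{1/p} 1_G, and the q-sum is the packing estimate with
  -- ε = δq.
  refine (ENNReal.inner_le_Lp_mul_Lq _ _ _ hpq).trans ?_
  refine mul_le_mul' (ENNReal.rpow_le_rpow ?_ (by positivity))
    (ENNReal.rpow_le_rpow ?_ (by positivity))
  · refine (h.sum_laverage_rpow_le hφm.aemeasurable hs hsp).trans
      (mul_le_mul' le_rfl (mul_le_mul' le_rfl ?_))
    rw [← lintegral_indicator hG]
    refine lintegral_mono fun x => ?_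
    by_cases hx : x ∈ G
    · simp [hφdef, hx, ← ENNReal.rpow_mul, hp.ne']
    · simp [hφdef, hx, hp]
  · refine le_trans (le_of_eq (Finset.sum_congr rfl fun Q _ => ?_))
      (h.laminar.sum_rpow_mul_le_of_packing h.measurableSet hW0 hWt hF hpack (mul_pos hδ hq) hδq)
    rw [ENNReal.mul_rpow_of_nonneg _ _ hq.le, ← ENNReal.rpow_mul, ← ENNReal.rpow_mul,
      one_div_mul_cancel hq.ne', ENNReal.rpow_one]

end Forms

/-! ### Geometry of dyadic cubes -/

section Cubes

variable {n : ℕ}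

/-- The index of the cube of generation `k` of the system `α` which contains `x`. -/
noncomputable def cubeIndex (α : Fin n → Fin 3) (k : ℤ) (x : EuclideanSpace ℝ (Fin n)) (i : Fin n) :
    ℤ :=
  ⌊(2 : ℝ) ^ k * x i - (-1 : ℝ) ^ k * (((α i : ℕ) : ℝ) / 3)⌋

theorem mem_dyadicCube_iff {α : Fin n → Fin 3} {k : ℤ} {m : Fin n → ℤ}
    {x : EuclideanSpace ℝ (Fin n)} : x ∈ dyadicCube α k m ↔ cubeIndex α k x = m := by
  have h2 : (0 : ℝ) < 2 ^ k := by positivity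
  rw [funext_iff]
  refine forall_congr' fun i => ?_
  rw [cubeIndex, Int.floor_eq_iff, zpow_neg, inv_mul_le_iff₀ h2, lt_inv_mul_iff₀ h2]
  constructor <;> rintro ⟨h1, h3⟩ <;> constructor <;> linarith

/-- The alternating sign is what makes the shifted grids nested: with z = (-1)^k, 2(2^k x - zα/3) =
(2^{k+1} x + zα/3) - zα, and zα is an integer. So the index at generation k is the integer half of
the next index minus zα. -/
theorem cubeIndex_eq_of_succ {α : Fin n → Fin 3} {k : ℤ} {x y : EuclideanSpace ℝ (Fin n)}
    (h : cubeIndex α (k + 1) x = cubeIndex α (k + 1) y) : cubeIndex α k x = cubeIndex α k y := by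
  obtain ⟨z, hz⟩ : ∃ z : ℤ, (-1 : ℝ) ^ k = z := by
    rcases Int.even_or_odd k with hk | hk
    · exact ⟨1, by simp [hk.neg_one_zpow]⟩
    · exact ⟨-1, by simp [hk.neg_one_zpow]⟩
  have key : ∀ (x : EuclideanSpace ℝ (Fin n)) (i : Fin n),
      cubeIndex α k x i = (cubeIndex α (k + 1) x i - z * (α i : ℕ)) / 2 := by
    intro x i
    obtain ⟨h1, h2⟩ := Int.floor_eq_iff.1 (rfl : cubeIndex α (k + 1) x i = _)
    set N := cubeIndex α (k + 1) x i
    rw [zpow_add_one₀ (by norm_num), zpow_add_one₀ (by norm_num), hz] at h1 h2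
    set M := (N - z * (α i : ℕ)) / 2 with hM
    have h3 : 2 * M ≤ N - z * (α i : ℕ) := by omega
    have h4 : N - z * (α i : ℕ) + 1 ≤ 2 * M + 2 := by omega
    have h3' : (2 : ℝ) * M ≤ N - z * (α i : ℕ) := by exact_mod_cast h3
    have h4' : (N : ℝ) - z * (α i : ℕ) + 1 ≤ 2 * M + 2 := by exact_mod_cast h4
    rw [cubeIndex, Int.floor_eq_iff, hz]
    constructor <;> linarith
  ext i
  rw [key, key, h]

theorem cubeIndex_eq_of_le {α : Fin n → Fin 3} {k l : ℤ} (hkl : k ≤ l)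
    {x y : EuclideanSpace ℝ (Fin n)} (h : cubeIndex α l x = cubeIndex α l y) :
    cubeIndex α k x = cubeIndex α k y := by
  induction l, hkl using Int.leInduction with
  | base => exact h
  | succ l _ ih => exact ih (cubeIndex_eq_of_succ h)

theorem dyadicCube_subset_or_disjoint {α : Fin n → Fin 3} {k l : ℤ} (hkl : k ≤ l)
    (m m' : Fin n → ℤ) :
    dyadicCube α l m' ⊆ dyadicCube α k m ∨ Disjoint (dyadicCube α l m') (dyadicCube α k m) := by
  by_cases h : Disjoint (dyadicCube α l m') (dyadicCube α k m)
  · exact Or.inr h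
  obtain ⟨x, hx, hx'⟩ := Set.not_disjoint_iff.1 h
  refine Or.inl fun y hy => ?_
  rw [mem_dyadicCube_iff] at *
  rw [← hx']
  exact cubeIndex_eq_of_le hkl (hy.trans hx.symm)

theorem isLaminar_dyadicGrid (α : Fin n → Fin 3) : IsLaminar (dyadicGrid α) := by
  rintro _ ⟨k, m, rfl⟩ _ ⟨l, m', rfl⟩
  rcases le_total k l with h | h
  · rcases dyadicCube_subset_or_disjoint h m m' with h | h
    · exact Or.inr (Or.inl h)
    · exact Or.inr (Or.inr h.symm)
  · rcases dyadicCube_subset_or_disjoint h m' m with h | h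
    · exact Or.inl h
    · exact Or.inr (Or.inr h)

theorem countable_dyadicGrid (α : Fin n → Fin 3) : (dyadicGrid α).Countable := by
  have : dyadicGrid α = Set.range fun p : ℤ × (Fin n → ℤ) => dyadicCube α p.1 p.2 := by
    ext Q
    constructor
    · rintro ⟨k, m, rfl⟩; exact ⟨(k, m), rfl⟩
    · rintro ⟨p, rfl⟩; exact ⟨p.1, p.2, rfl⟩
  rw [this]
  exact Set.countable_range _

theorem dyadicGrid_subset (α : Fin n → Fin 3) : dyadicGrid α ⊆ dyadicCubes n :=
  Set.subset_iUnion _ α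

theorem measurableSet_of_mem_dyadicCubes {Q : Set (EuclideanSpace ℝ (Fin n))}
    (hQ : Q ∈ dyadicCubes n) : MeasurableSet Q := by
  obtain ⟨α, k, m, rfl⟩ := Set.mem_iUnion.1 hQ
  have : dyadicCube α k m = ⋂ i, (fun x : EuclideanSpace ℝ (Fin n) => x i) ⁻¹'
      Set.Ico ((2 : ℝ) ^ (-k) * ((m i : ℝ) + (-1 : ℝ) ^ k * (((α i : ℕ) : ℝ) / 3)))
      ((2 : ℝ) ^ (-k) * (1 + (m i : ℝ) + (-1 : ℝ) ^ k * (((α i : ℕ) : ℝ) / 3))) := by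
    ext x; simp [dyadicCube]
  rw [this]
  exact MeasurableSet.iInter fun i => measurableSet_Ico.preimage (by fun_prop)

/-- A half-open axis-parallel cube with given centre and side length. -/
def box (c : EuclideanSpace ℝ (Fin n)) (l : ℝ) : Set (EuclideanSpace ℝ (Fin n)) :=
  {x | ∀ i, c i - l / 2 ≤ x i ∧ x i < c i + l / 2}

theorem exists_eq_box {Q : Set (EuclideanSpace ℝ (Fin n))} (hQ : Q ∈ dyadicCubes n) :
    ∃ (c : EuclideanSpace ℝ (Fin n)) (k : ℤ), Q = box c (2 ^ k) := by
  obtain ⟨α, k, m, rfl⟩ := Set.mem_iUnion.1 hQ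
  refine ⟨WithLp.toLp 2 fun i => (2 : ℝ) ^ (-k) * ((m i : ℝ) +
    (-1 : ℝ) ^ k * (((α i : ℕ) : ℝ) / 3)) + 2 ^ (-k) / 2, -k, ?_⟩
  ext x
  refine forall_congr' fun i => and_congr ?_ ?_ <;> simp only <;> ring_nf

theorem norm_le_of_abs_le {v : EuclideanSpace ℝ (Fin n)} {b : ℝ} (h : ∀ i, |v i| ≤ b) :
    ‖v‖ ≤ n * b := by
  have : v = ∑ i, EuclideanSpace.single i (v i) := by
    ext j; simp [Finset.sum_apply]
  rw [this]
  refine (norm_sum_le _ _).trans ?_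
  calc _ ≤ ∑ _i : Fin n, b := Finset.sum_le_sum fun i _ => by simpa using h i
    _ = n * b := by simp

theorem abs_apply_le_norm (v : EuclideanSpace ℝ (Fin n)) (i : Fin n) : |v i| ≤ ‖v‖ := by
  simpa using PiLp.norm_apply_le v i

theorem ball_subset_box (c : EuclideanSpace ℝ (Fin n)) (l : ℝ) :
    Metric.ball c (l / 2) ⊆ box c l := by
  intro x hx i
  rw [mem_ball_iff_norm] at hx
  have := abs_lt.1 ((abs_apply_le_norm (x - c) i).trans_lt hx)
  simp only [PiLp.sub_apply] at this
  constructor <;> linarith [this.1, this.2]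

theorem box_subset_closedBall (c : EuclideanSpace ℝ (Fin n)) (l : ℝ) :
    box c l ⊆ Metric.closedBall c (n * (l / 2)) := by
  intro x hx
  rw [mem_closedBall_iff_norm]
  refine norm_le_of_abs_le fun i => abs_le.2 ?_
  simp only [PiLp.sub_apply]
  constructor <;> linarith [(hx i).1, (hx i).2]

/-- The radius n 2^k is twice the bound n 2^k/2 on the distance from the centre of the box. Boxes of
equal size coincide; otherwise the inner radius is at most n 2^l/2 and so is the distance between
the centres. -/
theorem ball_subset_ball_of_box_subset (hn : 1 ≤ n) {c c' : EuclideanSpace ℝ (Fin n)} {k l : ℤ}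
    (h : box c (2 ^ k) ⊆ box c' (2 ^ l)) :
    Metric.ball c (n * 2 ^ k) ⊆ Metric.ball c' (n * 2 ^ l) := by
  have hk : (0 : ℝ) < 2 ^ k := by positivity
  have hl : (0 : ℝ) < 2 ^ l := by positivity
  have hn' : (1 : ℝ) ≤ n := by exact_mod_cast hn
  have hupd : ∀ (i : Fin n) (y : ℝ), c i - 2 ^ k / 2 ≤ y → y < c i + 2 ^ k / 2 →
      c' i - 2 ^ l / 2 ≤ y ∧ y < c' i + 2 ^ l / 2 := by
    intro i y h1 h2
    have := h (a := WithLp.toLp 2 (Function.update (fun j => c j) i y)) (by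
      intro j
      by_cases hj : j = i
      · subst hj; simpa using ⟨by linarith, h2⟩
      · simp only [Function.update_of_ne hj]
        constructor <;> linarith) i
    simpa using this
  have hkl : k ≤ l := by
    by_contra! hlt
    have h2 : (2 : ℝ) ^ l * 2 ≤ 2 ^ k := by
      rw [← zpow_add_one₀ (by norm_num)]
      exact zpow_le_zpow_right₀ (by norm_num) hlt
    have a := hupd ⟨0, hn⟩ _ le_rfl (by linarith)
    have b := hupd ⟨0, hn⟩ (c ⟨0, hn⟩) (by linarith) (by linarith)
    linarith [a.1, b.2]
  rcases hkl.eq_or_lt with rfl | hlt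
  · have : c = c' := by
      ext i
      have a := hupd i _ le_rfl (by linarith)
      by_contra hne
      have hgt : c' i < c i := lt_of_le_of_ne (by linarith [a.1]) (Ne.symm hne)
      have b := hupd i (c' i + 2 ^ k / 2) (by linarith [a.2]) (by linarith)
      exact lt_irrefl _ b.2
    rw [this]
  · have h2 : (2 : ℝ) ^ k * 2 ≤ 2 ^ l := by
      rw [← zpow_add_one₀ (by norm_num)]
      exact zpow_le_zpow_right₀ (by norm_num) hlt
    have hc : c ∈ box c' (2 ^ l) := h fun i => ⟨by linarith, by linarith⟩
    have hd : dist c c' ≤ n * (2 ^ l / 2) := box_subset_closedBall _ _ hc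
    refine Metric.ball_subset_ball' ?_
    nlinarith

open Classical in
/-- The centre of a dyadic cube. -/
noncomputable def cubeCenter (Q : Set (EuclideanSpace ℝ (Fin n))) : EuclideanSpace ℝ (Fin n) :=
  if h : Q ∈ dyadicCubes n then (exists_eq_box h).choose else 0

open Classical in
/-- The side length of a dyadic cube is two to this power. -/
noncomputable def cubeExponent (Q : Set (EuclideanSpace ℝ (Fin n))) : ℤ :=
  if h : Q ∈ dyadicCubes n then (exists_eq_box h).choose_spec.choose else 0

theorem eq_box_of_mem_dyadicCubes {Q : Set (EuclideanSpace ℝ (Fin n))} (hQ : Q ∈ dyadicCubes n) :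
    Q = box (cubeCenter Q) (2 ^ cubeExponent Q) := by
  conv_lhs => rw [(exists_eq_box hQ).choose_spec.choose_spec]
  rw [cubeCenter, cubeExponent, dif_pos hQ, dif_pos hQ]

/-- A ball which contains the dyadic cube `Q` and has comparable size. -/
noncomputable def cubeBall (Q : Set (EuclideanSpace ℝ (Fin n))) : Set (EuclideanSpace ℝ (Fin n)) :=
  Metric.ball (cubeCenter Q) (n * 2 ^ cubeExponent Q)

variable {P Q : Set (EuclideanSpace ℝ (Fin n))}

theorem subset_cubeBall (hn : 1 ≤ n) (hQ : Q ∈ dyadicCubes n) : Q ⊆ cubeBall Q := by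
  conv_lhs => rw [eq_box_of_mem_dyadicCubes hQ]
  refine (box_subset_closedBall _ _).trans (Metric.closedBall_subset_ball ?_)
  have hn' : (1 : ℝ) ≤ n := by exact_mod_cast hn
  have : (0 : ℝ) < 2 ^ cubeExponent Q := by positivity
  nlinarith

theorem cubeBall_mono (hn : 1 ≤ n) (hP : P ∈ dyadicCubes n) (hQ : Q ∈ dyadicCubes n)
    (hPQ : P ⊆ Q) : cubeBall P ⊆ cubeBall Q := by
  refine ball_subset_ball_of_box_subset hn ?_
  rwa [← eq_box_of_mem_dyadicCubes hP, ← eq_box_of_mem_dyadicCubes hQ]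

theorem cubeBall_radius_pos (hn : 1 ≤ n) (Q : Set (EuclideanSpace ℝ (Fin n))) :
    (0 : ℝ) < n * 2 ^ cubeExponent Q := by
  have hn' : (1 : ℝ) ≤ n := by exact_mod_cast hn
  positivity

/-- Every ball is contained in a dyadic cube of one of the systems, of comparable size. -/
theorem exists_dyadicCube_superset (c : EuclideanSpace ℝ (Fin n)) {r : ℝ} (hr : 0 < r) :
    ∃ (c' : EuclideanSpace ℝ (Fin n)) (l : ℝ), box c' l ∈ dyadicCubes n ∧
      Metric.ball c r ⊆ box c' l ∧ 0 < l ∧ l ≤ 12 * r := by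
  obtain ⟨j, hj1, hj2⟩ := exists_mem_Ico_zpow (x := 6 * r) (y := (2 : ℝ)) (by positivity)
    (by norm_num)
  set k : ℤ := -(j + 1) with hk
  have hkpos : (0 : ℝ) < 2 ^ (-k) := by positivity
  have hk1 : 6 * r < 2 ^ (-k) := by simpa [hk] using hj2
  have hk2 : (2 : ℝ) ^ (-k) ≤ 12 * r := by
    rw [hk, neg_neg, zpow_add_one₀ (by norm_num)]; linarith
  have hcoord : ∀ i : Fin n, ∃ (a : Fin 3) (m : ℤ),
      (2 : ℝ) ^ (-k) * ((m : ℝ) + (-1 : ℝ) ^ k * (((a : ℕ) : ℝ) / 3)) ≤ c i - r ∧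
      c i + r ≤ (2 : ℝ) ^ (-k) * (1 + (m : ℝ) + (-1 : ℝ) ^ k * (((a : ℕ) : ℝ) / 3)) := by
    intro i
    obtain ⟨u, hu⟩ : ∃ u : ℝ, c i - r = 2 ^ (-k) * u :=
      ⟨(c i - r) / 2 ^ (-k), by field_simp⟩
    -- The choice 6r < 2^{-k} makes the diameter 2r smaller than a third of the side.
    have hstep : c i + r ≤ 2 ^ (-k) * (u + 1 / 3) := by linarith
    suffices h : ∃ (a : Fin 3) (m : ℤ), (m : ℝ) + (-1 : ℝ) ^ k * (((a : ℕ) : ℝ) / 3) ≤ u ∧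
        u + 1 / 3 ≤ 1 + (m : ℝ) + (-1 : ℝ) ^ k * (((a : ℕ) : ℝ) / 3) by
      obtain ⟨a, m, h1, h2⟩ := h
      refine ⟨a, m, ?_, hstep.trans ?_⟩
      · rw [hu]; gcongr
      · gcongr
    obtain ⟨N, hN1, hN2⟩ : ∃ N : ℤ, (N : ℝ) ≤ 3 * u ∧ 3 * u < N + 1 :=
      ⟨⌊3 * u⌋, Int.floor_le _, Int.lt_floor_add_one _⟩
    -- One-third trick: in units of the side, the left endpoints from the three shifts exhaust ℤ/3.
    -- For odd k the shift has a negative sign, so the residues 1 and 2 of N are realised by the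
    -- shifts 2 and 1.
    have key : ∃ (a : Fin 3) (m : ℤ), (3 * m : ℝ) + (-1 : ℝ) ^ k * ((a : ℕ) : ℝ) = N := by
      obtain ⟨M, b, hb, hMb⟩ : ∃ (M : ℤ) (b : ℤ), (b = 0 ∨ b = 1 ∨ b = 2) ∧ 3 * M + b = N :=
        ⟨N / 3, N % 3, by omega, by omega⟩
      have hMb' : (3 * M + b : ℝ) = N := by exact_mod_cast hMb
      rcases Int.even_or_odd k with he | ho
      · rw [he.neg_one_zpow]
        rcases hb with rfl | rfl | rfl
        · exact ⟨0, M, by rw [← hMb']; simp⟩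
        · exact ⟨1, M, by rw [← hMb']; simp⟩
        · exact ⟨2, M, by rw [← hMb']; simp⟩
      · rw [ho.neg_one_zpow]
        rcases hb with rfl | rfl | rfl
        · exact ⟨0, M, by rw [← hMb']; simp⟩
        · exact ⟨2, M + 1, by rw [← hMb']; push_cast; simp; ring⟩
        · exact ⟨1, M + 1, by rw [← hMb']; push_cast; simp; ring⟩
    obtain ⟨a, m, h⟩ := key
    exact ⟨a, m, by linarith, by linarith⟩
  choose a m hlo hhi using hcoord
  have hmem : dyadicCube a k m ∈ dyadicCubes n := Set.mem_iUnion.2 ⟨a, k, m, rfl⟩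
  set c' : EuclideanSpace ℝ (Fin n) := WithLp.toLp 2 fun i => (2 : ℝ) ^ (-k) * ((m i : ℝ) +
    (-1 : ℝ) ^ k * (((a i : ℕ) : ℝ) / 3)) + 2 ^ (-k) / 2 with hc'
  have hbox : dyadicCube a k m = box c' (2 ^ (-k)) := by
    ext x
    refine forall_congr' fun i => and_congr ?_ ?_ <;> simp only [hc'] <;> ring_nf
  refine ⟨c', 2 ^ (-k), hbox ▸ hmem, ?_, hkpos, hk2⟩
  rw [← hbox]
  intro x hx i
  rw [mem_ball_iff_norm] at hx
  have := abs_lt.1 ((abs_apply_le_norm (x - c) i).trans_lt hx)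
  simp only [PiLp.sub_apply] at this
  exact ⟨by linarith [hlo i, this.1], by linarith [hhi i, this.2]⟩

end Cubes

/-! ### Doubling measures -/

section Doubling

variable {n : ℕ} {μ : Measure (EuclideanSpace ℝ (Fin n))}

/-- The doubling property with an explicit constant. -/
def DoublingWith (μ : Measure (EuclideanSpace ℝ (Fin n))) (D : ℝ≥0) : Prop :=
  ∀ x r, 0 < r → μ (Metric.ball x (2 * r)) ≤ D * μ (Metric.ball x r)

/-- Adding 1 avoids showing that the infimum is attained. The infimum is at least 1, so 2^ν really
recovers it; the constant therefore depends on ν alone. -/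
theorem IsDoubling.doublingWith (hμ : IsDoubling μ) :
    DoublingWith μ (Real.toNNReal ((2 : ℝ) ^ doublingDimension μ) + 1) := by
  set S := {C : ℝ≥0 | ∀ x r, 0 < r → μ (Metric.ball x (2 * r)) ≤ C * μ (Metric.ball x r)} with hS
  have hne : S.Nonempty := hμ.doubling
  have hge : ∀ C ∈ S, 1 ≤ C := by
    intro C hC
    have h1 := hC 0 1 one_pos
    have h2 : μ (Metric.ball 0 1) ≤ C * μ (Metric.ball 0 1) :=
      (measure_mono (Metric.ball_subset_ball (by norm_num))).trans h1
    by_contra! hlt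
    have : (C : ℝ≥0∞) * μ (Metric.ball 0 1) < 1 * μ (Metric.ball 0 1) :=
      (ENNReal.mul_lt_mul_iff_left (hμ.pos _ _ one_pos).ne' (hμ.finite _ _ one_pos).ne).2
        (by exact_mod_cast hlt)
    rw [one_mul] at this
    exact absurd h2 (not_le.2 this)
  have hinf : 1 ≤ sInf S := le_csInf hne hge
  have hdim : (2 : ℝ) ^ doublingDimension μ = (sInf S : ℝ≥0) :=
    Real.rpow_logb (by norm_num) (by norm_num) (lt_of_lt_of_le one_pos (by exact_mod_cast hinf))
  rw [hdim, Real.toNNReal_coe]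
  obtain ⟨C, hC, hlt⟩ := exists_lt_of_csInf_lt hne (lt_add_one (sInf S))
  intro x r hr
  exact (hC x r hr).trans (by gcongr)

theorem DoublingWith.measure_ball_two_pow_mul_le {D : ℝ≥0} (h : DoublingWith μ D)
    (x : EuclideanSpace ℝ (Fin n)) {r : ℝ} (hr : 0 < r) (k : ℕ) :
    μ (Metric.ball x (2 ^ k * r)) ≤ (D : ℝ≥0∞) ^ k * μ (Metric.ball x r) := by
  induction k with
  | zero => simp
  | succ k ih =>
    calc μ (Metric.ball x (2 ^ (k + 1) * r)) = μ (Metric.ball x (2 * (2 ^ k * r))) := by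
          rw [pow_succ]; ring_nf
      _ ≤ D * μ (Metric.ball x (2 ^ k * r)) := h _ _ (by positivity)
      _ ≤ D * ((D : ℝ≥0∞) ^ k * μ (Metric.ball x r)) := by gcongr
      _ = _ := by ring

variable {Q : Set (EuclideanSpace ℝ (Fin n))}

/-- The cube contains the ball of radius half its side l, and n l ≤ 2^{n+1} (l/2). -/
theorem DoublingWith.measure_cubeBall_le {D : ℝ≥0} (h : DoublingWith μ D)
    (hQ : Q ∈ dyadicCubes n) : μ (cubeBall Q) ≤ (D : ℝ≥0∞) ^ (n + 1) * μ Q := by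
  have hl : (0 : ℝ) < 2 ^ cubeExponent Q := by positivity
  calc μ (cubeBall Q)
      ≤ μ (Metric.ball (cubeCenter Q) (2 ^ (n + 1) * (2 ^ cubeExponent Q / 2))) := by
        refine measure_mono (Metric.ball_subset_ball ?_)
        have : (n : ℝ) ≤ 2 ^ n := by exact_mod_cast Nat.lt_two_pow_self.le
        rw [pow_succ]
        nlinarith
    _ ≤ (D : ℝ≥0∞) ^ (n + 1) * μ (Metric.ball (cubeCenter Q) (2 ^ cubeExponent Q / 2)) :=
        h.measure_ball_two_pow_mul_le _ (by positivity) _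
    _ ≤ _ := by
        gcongr
        conv_rhs => rw [eq_box_of_mem_dyadicCubes hQ]
        exact ball_subset_box _ _

theorem IsDoubling.measure_cube_pos (hμ : IsDoubling μ) (hQ : Q ∈ dyadicCubes n) : 0 < μ Q := by
  rw [eq_box_of_mem_dyadicCubes hQ]
  exact (hμ.pos _ _ (by positivity)).trans_le (measure_mono (ball_subset_box _ _))

theorem IsDoubling.measure_cube_lt_top (hn : 1 ≤ n) (hμ : IsDoubling μ) (hQ : Q ∈ dyadicCubes n) :
    μ Q < ∞ :=
  (measure_mono (subset_cubeBall hn hQ)).trans_lt (hμ.finite _ _ (cubeBall_radius_pos hn Q))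

/-- Links balls, over which A_∞ is defined, to dyadic cubes, over which A₁ is defined. The exponent
comes from side ≤ 12 r, hence diameter ≤ 12 n r < 2^n · 2^5 r. -/
theorem DoublingWith.exists_cubeBall_subset {D : ℝ≥0} (h : DoublingWith μ D) (hn : 1 ≤ n)
    (Q : Set (EuclideanSpace ℝ (Fin n))) :
    ∃ R ∈ dyadicCubes n, cubeBall Q ⊆ R ∧ μ R ≤ (D : ℝ≥0∞) ^ (n + 5) * μ (cubeBall Q) := by
  have hr := cubeBall_radius_pos hn Q
  set r : ℝ := n * 2 ^ cubeExponent Q with hrdef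
  obtain ⟨c', l, hmem, hsub, hl0, hl⟩ := exists_dyadicCube_superset (cubeCenter Q) hr
  refine ⟨_, hmem, hsub, ?_⟩
  have hc : cubeCenter Q ∈ Metric.closedBall c' (n * (l / 2)) :=
    box_subset_closedBall _ _ (hsub (Metric.mem_ball_self hr))
  have hn' : (1 : ℝ) ≤ n := by exact_mod_cast hn
  calc μ (box c' l) ≤ μ (Metric.ball (cubeCenter Q) (2 ^ (n + 5) * r)) := by
        refine measure_mono ((box_subset_closedBall _ _).trans fun x hx => ?_)
        rw [Metric.mem_ball]
        rw [Metric.mem_closedBall] at hx hc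
        have : (n : ℝ) < 2 ^ n := by exact_mod_cast Nat.lt_two_pow_self
        calc dist x (cubeCenter Q) ≤ dist x c' + dist (cubeCenter Q) c' :=
              dist_triangle_right _ _ _
          _ ≤ n * l := by linarith
          _ ≤ n * (12 * r) := by gcongr
          _ < 2 ^ n * (32 * r) := by nlinarith
          _ = _ := by ring
    _ ≤ _ := h.measure_ball_two_pow_mul_le _ hr _

theorem IsDoubling.isLocallyFiniteMeasure (hμ : IsDoubling μ) : IsLocallyFiniteMeasure μ :=
  ⟨fun x => ⟨Metric.ball x 1, Metric.ball_mem_nhds x one_pos, hμ.finite x 1 one_pos⟩⟩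

end Doubling

/-! ### Weights -/

section Weights

variable {n : ℕ} {μ : Measure (EuclideanSpace ℝ (Fin n))} {w : EuclideanSpace ℝ (Fin n) → ℝ}
  {Q : Set (EuclideanSpace ℝ (Fin n))} {D : ℝ≥0}

theorem IsWeight.enorm_eq (hw : IsWeight w) (x : EuclideanSpace ℝ (Fin n)) :
    ‖w x‖ₑ = ENNReal.ofReal (w x) := Real.enorm_of_nonneg (hw.2 x).le

theorem weightMeasure_apply (hQ : MeasurableSet Q) :
    weightMeasure μ w Q = ∫⁻ x in Q, ENNReal.ofReal (w x) ∂μ :=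
  withDensity_apply _ hQ

theorem IsWeight.avg_one_eq (hw : IsWeight w) (hQ : MeasurableSet Q) :
    avg μ w 1 Q = weightMeasure μ w Q / μ Q := by
  rw [avg, eLpNorm_one_eq_lintegral_enorm, lintegral_smul_measure, weightMeasure_apply hQ,
    ENNReal.div_eq_inv_mul]
  simp_rw [hw.enorm_eq]
  rfl

/-- Normalising the measure does not change essential suprema, so the second factor of the A₁
constant dominates 1/w a.e. on Q. -/
theorem IsWeight.ae_avg_le (hw : IsWeight w) (hQ : Q ∈ dyadicCubes n) (ht : μ Q ≠ ∞) :
    ∀ᵐ x ∂μ.restrict Q,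
      weightMeasure μ w Q / μ Q ≤ A1Const μ w * ENNReal.ofReal (w x) := by
  have h1 : avg μ w 1 Q * avg μ (fun x => (w x)⁻¹) ∞ Q ≤ A1Const μ w :=
    le_iSup₂_of_le (f := fun Q (_ : Q ∈ dyadicCubes n) =>
      avg μ w 1 Q * avg μ (fun x => (w x)⁻¹) ∞ Q) Q hQ le_rfl
  rw [hw.avg_one_eq (measurableSet_of_mem_dyadicCubes hQ)] at h1
  have h2 : avg μ (fun x => (w x)⁻¹) ∞ Q = eLpNormEssSup (fun x => (w x)⁻¹) (μ.restrict Q) := by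
    rw [avg, eLpNorm_exponent_top]
    exact eLpNormEssSup_ennreal_smul_measure (ENNReal.inv_ne_zero.2 ht) _
  filter_upwards [enorm_ae_le_eLpNormEssSup (fun x => (w x)⁻¹) (μ.restrict Q)] with x hx
  have hpos : 0 < ENNReal.ofReal (w x) := ENNReal.ofReal_pos.2 (hw.2 x)
  rw [enorm_inv (hw.2 x).ne', hw.enorm_eq] at hx
  rw [← ENNReal.div_le_iff hpos.ne' ENNReal.ofReal_ne_top, ENNReal.div_eq_inv_mul, mul_comm]
  refine le_trans ?_ h1
  rw [h2]
  gcongr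

theorem IsWeight.weightMeasure_pos (hw : IsWeight w) (hm : MeasurableSet Q) (h : μ Q ≠ 0) :
    weightMeasure μ w Q ≠ 0 := by
  intro h0
  rw [weightMeasure_apply hm, setLIntegral_eq_zero_iff hm hw.1.ennreal_ofReal] at h0
  refine h (measure_mono_null (fun x hx => ?_) h0)
  simp only [Set.mem_compl_iff, Set.mem_ofPred_eq, Classical.not_imp]
  exact ⟨hx, (ENNReal.ofReal_pos.2 (hw.2 x)).ne'⟩

theorem IsDoubling.weightMeasure_ball_pos (hμ : IsDoubling μ) (hw : IsWeight w)
    (x : EuclideanSpace ℝ (Fin n)) {r : ℝ} (hr : 0 < r) :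
    weightMeasure μ w (Metric.ball x r) ≠ 0 :=
  hw.weightMeasure_pos Metric.isOpen_ball.measurableSet (hμ.pos x r hr).ne'

/-- Local integrability is not part of being a weight. It follows from A₁: w is finite at every
point, and the A₁ inequality at a single point of Q bounds the average. -/
theorem IsDoubling.weightMeasure_cube_lt_top (hn : 1 ≤ n) (hμ : IsDoubling μ) (hw : IsA1 μ w)
    (hQ : Q ∈ dyadicCubes n) : weightMeasure μ w Q < ∞ := by
  have ht := (hμ.measure_cube_lt_top hn hQ).ne
  have h0 := (hμ.measure_cube_pos hQ).ne'
  have hne : (ae (μ.restrict Q)).NeBot := by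
    rw [ae_neBot]
    exact fun h => h0 (Measure.restrict_eq_zero.1 h)
  obtain ⟨x, hx⟩ := (hw.1.ae_avg_le hQ ht).exists
  have : weightMeasure μ w Q / μ Q < ∞ :=
    hx.trans_lt (ENNReal.mul_lt_top hw.2 ENNReal.ofReal_lt_top)
  by_contra hcon
  rw [not_lt, top_le_iff] at hcon
  rw [hcon, ENNReal.top_div_of_ne_top ht] at this
  exact lt_irrefl _ this

theorem IsDoubling.weightMeasure_ball_lt_top (hn : 1 ≤ n) (hμ : IsDoubling μ) (hw : IsA1 μ w)
    (x : EuclideanSpace ℝ (Fin n)) (r : ℝ) : weightMeasure μ w (Metric.ball x r) < ∞ := by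
  obtain ⟨c', l, hmem, hsub, -⟩ := exists_dyadicCube_superset x (r := max r 1) (by positivity)
  exact (measure_mono ((Metric.ball_subset_ball (le_max_left _ _)).trans hsub)).trans_lt
    (hμ.weightMeasure_cube_lt_top hn hw hmem)

/-- A₁ applied to a dyadic cube containing the ball of Q. The exponent 2n + 6 is (n + 5) + (n + 1),
for passing from that cube to the ball and from the ball to Q. -/
theorem IsDoubling.ae_cubeBall_avg_le (hn : 1 ≤ n) (hμ : IsDoubling μ) (hD : DoublingWith μ D)
    (hw : IsWeight w) (hQ : Q ∈ dyadicCubes n) :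
    ∀ᵐ x ∂μ.restrict Q, weightMeasure μ w (cubeBall Q) / μ Q ≤
      (D : ℝ≥0∞) ^ (2 * n + 6) * A1Const μ w * ENNReal.ofReal (w x) := by
  obtain ⟨R, hR, hsub, hle⟩ := hD.exists_cubeBall_subset hn Q
  have hRt := (hμ.measure_cube_lt_top hn hR).ne
  have hR0 := (hμ.measure_cube_pos hR).ne'
  have hQt := (hμ.measure_cube_lt_top hn hQ).ne
  have hQ0 := (hμ.measure_cube_pos hQ).ne'
  have hRQ : μ R ≤ (D : ℝ≥0∞) ^ (2 * n + 6) * μ Q := by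
    refine hle.trans ?_
    calc _ ≤ (D : ℝ≥0∞) ^ (n + 5) * ((D : ℝ≥0∞) ^ (n + 1) * μ Q) := by
          gcongr; exact hD.measure_cubeBall_le hQ
      _ = _ := by ring
  filter_upwards [ae_restrict_of_ae_restrict_of_subset ((subset_cubeBall hn hQ).trans hsub)
    (hw.ae_avg_le hR hRt)] with x hx
  rw [ENNReal.div_le_iff hQ0 hQt]
  calc weightMeasure μ w (cubeBall Q) ≤ weightMeasure μ w R := measure_mono hsub
    _ ≤ A1Const μ w * ENNReal.ofReal (w x) * μ R := (ENNReal.div_le_iff hR0 hRt).1 hx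
    _ ≤ A1Const μ w * ENNReal.ofReal (w x) * ((D : ℝ≥0∞) ^ (2 * n + 6) * μ Q) := by gcongr
    _ = _ := by ring

theorem lintegral_ballMaximal_le (z : EuclideanSpace ℝ (Fin n)) {s : ℝ} (hs : 0 < s)
    (h0 : weightMeasure μ w (Metric.ball z s) ≠ 0) (ht : weightMeasure μ w (Metric.ball z s) ≠ ∞) :
    ∫⁻ x in Metric.ball z s, ballMaximal μ ((Metric.ball z s).indicator w) x ∂μ ≤
      AInftyConst μ w * weightMeasure μ w (Metric.ball z s) := by
  rw [← ENNReal.div_le_iff h0 ht, AInftyConst]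
  exact le_iSup_of_le z (le_iSup_of_le s (le_iSup_of_le hs le_rfl))

theorem IsWeight.le_ballMaximal (hw : IsWeight w) {z x : EuclideanSpace ℝ (Fin n)} {s : ℝ}
    (hs : 0 < s) {S : Set (EuclideanSpace ℝ (Fin n))} (hx : x ∈ Metric.ball z s)
    (hsub : Metric.ball z s ⊆ S) :
    weightMeasure μ w (Metric.ball z s) / μ (Metric.ball z s) ≤ ballMaximal μ (S.indicator w) x := by
  rw [← hw.avg_one_eq Metric.isOpen_ball.measurableSet]
  refine le_trans (le_of_eq ?_) (le_iSup_of_le z (le_iSup_of_le s (le_iSup_of_le hs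
    (le_iSup_of_le hx le_rfl))))
  unfold avg
  refine eLpNorm_congr_ae (Measure.ae_smul_measure ?_ _)
  filter_upwards [ae_restrict_mem Metric.isOpen_ball.measurableSet] with y hy
  rw [Set.indicator_of_mem (hsub hy)]

/-- On the unit ball the maximal function is at least the average of w, whose integral is already w
of the ball. -/
theorem IsDoubling.one_le_AInftyConst (hn : 1 ≤ n) (hμ : IsDoubling μ) (hw : IsA1 μ w) :
    1 ≤ AInftyConst μ w := by
  have h0 := hμ.weightMeasure_ball_pos hw.1 0 one_pos
  have ht := (hμ.weightMeasure_ball_lt_top hn hw 0 1).ne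
  have h := lintegral_ballMaximal_le 0 one_pos h0 ht
  by_contra! hlt
  have h2 : weightMeasure μ w (Metric.ball 0 1) ≤ ∫⁻ x in Metric.ball 0 1,
      ballMaximal μ ((Metric.ball 0 1).indicator w) x ∂μ := by
    calc weightMeasure μ w (Metric.ball 0 1)
        = ∫⁻ _ in Metric.ball (0 : EuclideanSpace ℝ (Fin n)) 1,
          weightMeasure μ w (Metric.ball 0 1) / μ (Metric.ball 0 1) ∂μ := by
          rw [setLIntegral_const, ENNReal.div_mul_cancel (hμ.pos _ _ one_pos).ne'
            (hμ.finite _ _ one_pos).ne]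
      _ ≤ _ := setLIntegral_mono' Metric.isOpen_ball.measurableSet
          fun x hx => hw.1.le_ballMaximal one_pos hx subset_rfl
  have h3 := h2.trans h
  have h4 : AInftyConst μ w * weightMeasure μ w (Metric.ball 0 1) <
      1 * weightMeasure μ w (Metric.ball 0 1) := (ENNReal.mul_lt_mul_iff_left h0 ht).2 hlt
  rw [one_mul] at h4
  exact absurd h3 (not_le.2 h4)

/-- The Carleson packing property of `A_∞` weights, in terms of the balls `cubeBall Q`. -/
theorem IsSparseFamily.packing (hn : 1 ≤ n) (hμ : IsDoubling μ) (hD : DoublingWith μ D)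
    (hw : IsA1 μ w) {𝒬 : Finset (Set (EuclideanSpace ℝ (Fin n)))}
    {E : Set (EuclideanSpace ℝ (Fin n)) → Set (EuclideanSpace ℝ (Fin n))} {κ : ℝ≥0∞}
    (h : IsSparseFamily μ 𝒬 E κ) (h𝒬 : ∀ Q ∈ 𝒬, Q ∈ dyadicCubes n) (R)
    (hR : R ∈ 𝒬) :
    ∑' Q : {Q // Q ∈ 𝒬 ∧ Q ⊆ R}, weightMeasure μ w (cubeBall Q.1) ≤
      ((D : ℝ≥0∞) ^ (n + 1) * κ * AInftyConst μ w) * weightMeasure μ w (cubeBall R) := by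
  have hfinite : Finite {Q // Q ∈ 𝒬 ∧ Q ⊆ R} :=
    (𝒬.finite_toSet.subset (fun Q (hQ : Q ∈ 𝒬 ∧ Q ⊆ R) => hQ.1)).to_subtype
  set M := ballMaximal μ ((cubeBall R).indicator w)
  -- The ball of Q is no larger than a multiple of E Q, and it contains E Q and lies in the ball of
  -- R. So on E Q the average of w over it is dominated by the maximal function of w restricted to
  -- the ball of R. Since the sets E Q are disjoint, the terms sum to an integral over the ball of
  -- R.
  have hterm : ∀ Q : {Q // Q ∈ 𝒬 ∧ Q ⊆ R}, weightMeasure μ w (cubeBall Q.1) ≤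
      (D : ℝ≥0∞) ^ (n + 1) * κ * ∫⁻ x in E Q.1, M x ∂μ := by
    rintro ⟨Q, hQ, hQR⟩
    have hr := cubeBall_radius_pos hn Q
    have hB0 : μ (cubeBall Q) ≠ 0 := (hμ.pos _ _ hr).ne'
    have hBt : μ (cubeBall Q) ≠ ∞ := (hμ.finite _ _ hr).ne
    calc weightMeasure μ w (cubeBall Q)
        = weightMeasure μ w (cubeBall Q) / μ (cubeBall Q) * μ (cubeBall Q) :=
          (ENNReal.div_mul_cancel hB0 hBt).symm
      _ ≤ weightMeasure μ w (cubeBall Q) / μ (cubeBall Q) *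
          ((D : ℝ≥0∞) ^ (n + 1) * (κ * μ (E Q))) := by
          gcongr
          exact (hD.measure_cubeBall_le (h𝒬 Q hQ)).trans (by gcongr; exact h.measure_le Q hQ)
      _ = (D : ℝ≥0∞) ^ (n + 1) * κ *
          ∫⁻ _ in E Q, weightMeasure μ w (cubeBall Q) / μ (cubeBall Q) ∂μ := by
          rw [setLIntegral_const]; ring
      _ ≤ _ := by
          refine mul_le_mul' le_rfl (setLIntegral_mono' (h.measurableSet_part Q hQ) fun x hx => ?_)
          exact hw.1.le_ballMaximal hr (subset_cubeBall hn (h𝒬 Q hQ) (h.part_subset Q hQ hx))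
            (cubeBall_mono hn (h𝒬 Q hQ) (h𝒬 R hR) hQR)
  refine (ENNReal.tsum_le_tsum hterm).trans ?_
  rw [ENNReal.tsum_mul_left, ← lintegral_iUnion (fun Q => h.measurableSet_part Q.1 Q.2.1)
    (fun P Q hne => h.disjoint P.2.1 Q.2.1 (fun he => hne (Subtype.ext he))), mul_assoc _ (AInftyConst μ w)]
  refine mul_le_mul' le_rfl (le_trans ?_ (lintegral_ballMaximal_le _ (cubeBall_radius_pos hn R)
    (hμ.weightMeasure_ball_pos hw.1 _ (cubeBall_radius_pos hn R))
    (hμ.weightMeasure_ball_lt_top hn hw _ _).ne))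
  refine lintegral_mono_set (Set.iUnion_subset fun Q => ?_)
  exact (h.part_subset Q.1 Q.2.1).trans
    ((subset_cubeBall hn (h𝒬 Q.1 Q.2.1)).trans (cubeBall_mono hn (h𝒬 Q.1 Q.2.1) (h𝒬 R hR) Q.2.2))

/-- The union of the cubes on which `H` is large compared to the weight. -/
def badSet (μ : Measure (EuclideanSpace ℝ (Fin n))) (w : EuclideanSpace ℝ (Fin n) → ℝ)
    (H : EuclideanSpace ℝ (Fin n) → ℝ≥0∞) : Set (EuclideanSpace ℝ (Fin n)) :=
  ⋃ (α : Fin n → Fin 3), ⋃ Q ∈ {Q ∈ dyadicGrid α |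
    weightMeasure μ w (cubeBall Q) < ∫⁻ x in Q, H x ∂μ}, Q

theorem measurableSet_badSet (H : EuclideanSpace ℝ (Fin n) → ℝ≥0∞) :
    MeasurableSet (badSet μ w H) :=
  MeasurableSet.iUnion fun α => MeasurableSet.biUnion
    ((countable_dyadicGrid α).mono fun _ hQ => hQ.1)
    fun _ hQ => measurableSet_of_mem_dyadicCubes (dyadicGrid_subset α hQ.1)

/-- In each grid the maximal bad cubes are disjoint and w(Q) ≤ w(B_Q) < ∫_Q H on each of them.
Maximal cubes need a finite family, so the union is exhausted by finite subunions. The factor 3^n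
counts the grids. -/
theorem weightMeasure_badSet_le (hn : 1 ≤ n) (H : EuclideanSpace ℝ (Fin n) → ℝ≥0∞) :
    weightMeasure μ w (badSet μ w H) ≤ 3 ^ n * ∫⁻ x, H x ∂μ := by
  have hgrid : ∀ α : Fin n → Fin 3, weightMeasure μ w (⋃ Q ∈ {Q ∈ dyadicGrid α |
      weightMeasure μ w (cubeBall Q) < ∫⁻ x in Q, H x ∂μ}, Q) ≤ ∫⁻ x, H x ∂μ := by
    intro α
    set 𝒞 := {Q ∈ dyadicGrid α | weightMeasure μ w (cubeBall Q) < ∫⁻ x in Q, H x ∂μ}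
    have hcount : 𝒞.Countable := (countable_dyadicGrid α).mono fun _ hQ => hQ.1
    have := hcount.to_subtype
    have hU : ⋃ Q ∈ 𝒞, Q = ⋃ t : Finset 𝒞, ⋃ Q ∈ t, (Q : Set (EuclideanSpace ℝ (Fin n))) := by
      ext x
      simp only [Set.mem_iUnion, exists_prop]
      constructor
      · rintro ⟨Q, hQ, hx⟩; exact ⟨{⟨Q, hQ⟩}, ⟨Q, hQ⟩, by simp, hx⟩
      · rintro ⟨t, Q, -, hx⟩; exact ⟨Q, Q.2, hx⟩
    have hdir : Directed (· ⊆ ·) fun t : Finset 𝒞 =>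
        ⋃ Q ∈ t, (Q : Set (EuclideanSpace ℝ (Fin n))) := by
      classical
      refine directed_of_isDirected_le fun s t hst => ?_
      exact Set.biUnion_subset_biUnion_left fun Q hQ => hst hQ
    rw [hU, hdir.measure_iUnion]
    refine iSup_le fun t => ?_
    classical
    set 𝒬 : Finset (Set (EuclideanSpace ℝ (Fin n))) := t.image Subtype.val
    have h𝒬 : ∀ Q ∈ 𝒬, Q ∈ 𝒞 := by
      intro Q hQ
      obtain ⟨Q', -, rfl⟩ := Finset.mem_image.1 hQ
      exact Q'.2
    have hlam : IsLaminar (𝒬 : Set (Set (EuclideanSpace ℝ (Fin n)))) :=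
      (isLaminar_dyadicGrid α).mono fun Q hQ => (h𝒬 Q hQ).1
    obtain ⟨ℛ, hℛ, hdis, hcov⟩ := hlam.exists_maximal
    have hD : ∀ Q ∈ ℛ, Q ∈ dyadicCubes n := fun Q hQ => dyadicGrid_subset α (h𝒬 Q (hℛ hQ)).1
    calc weightMeasure μ w (⋃ Q ∈ t, (Q : Set (EuclideanSpace ℝ (Fin n))))
        ≤ weightMeasure μ w (⋃ R ∈ ℛ, R) := by
          refine measure_mono (Set.iUnion₂_subset fun Q hQ => ?_)
          obtain ⟨R, hR, hQR⟩ := hcov Q (Finset.mem_image_of_mem _ hQ)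
          exact hQR.trans (Set.subset_biUnion_of_mem (u := fun R => R) hR)
      _ ≤ ∑ R ∈ ℛ, weightMeasure μ w R := measure_biUnion_finset_le _ _
      _ ≤ ∑ R ∈ ℛ, ∫⁻ x in R, H x ∂μ := Finset.sum_le_sum fun R hR =>
          (measure_mono (subset_cubeBall hn (hD R hR))).trans (h𝒬 R (hℛ hR)).2.le
      _ = ∫⁻ x in ⋃ R ∈ ℛ, R, H x ∂μ := (lintegral_biUnion_finset (t := fun P => P) hdis
          (fun R hR => measurableSet_of_mem_dyadicCubes (hD R hR)) _).symm
      _ ≤ _ := setLIntegral_le_lintegral _ _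
  refine (measure_iUnion_fintype_le _ _).trans ?_
  refine (Finset.sum_le_sum fun α _ => hgrid α).trans ?_
  simp

end Weights

/-! ### Constant and polynomial weights -/

section PolynomialWeights

variable {n : ℕ} {μ : Measure (EuclideanSpace ℝ (Fin n))} {D : ℝ≥0}

theorem weightMeasure_one : weightMeasure μ (fun _ => 1) = μ := by
  simp [weightMeasure, withDensity_const]

theorem isWeight_one : IsWeight (fun _ : EuclideanSpace ℝ (Fin n) => (1 : ℝ)) :=
  ⟨measurable_const, fun _ => one_pos⟩

theorem A1Const_one_le (hn : 1 ≤ n) (hμ : IsDoubling μ) : A1Const μ (fun _ => 1) ≤ 1 := by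
  refine iSup₂_le fun Q hQ => ?_
  have h0 := (hμ.measure_cube_pos hQ).ne'
  have ht := (hμ.measure_cube_lt_top hn hQ).ne
  rw [isWeight_one.avg_one_eq (measurableSet_of_mem_dyadicCubes hQ), weightMeasure_one,
    ENNReal.div_self h0 ht, one_mul, avg, eLpNorm_exponent_top]
  refine (eLpNormEssSup_le_of_ae_enorm_bound (C := 1) (Eventually.of_forall fun x => ?_))
  simp

theorem isA1_one (hn : 1 ≤ n) (hμ : IsDoubling μ) : IsA1 μ (fun _ => 1) :=
  ⟨isWeight_one, (A1Const_one_le hn hμ).trans_lt ENNReal.one_lt_top⟩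

theorem IsWeight.ballMaximal_le {w : EuclideanSpace ℝ (Fin n) → ℝ} (hw : IsWeight w)
    (hμ : IsDoubling μ)
    {S : Set (EuclideanSpace ℝ (Fin n))} {b : ℝ≥0∞}
    (h : ∀ y ∈ S, ENNReal.ofReal (w y) ≤ b) (x : EuclideanSpace ℝ (Fin n)) :
    ballMaximal μ (S.indicator w) x ≤ b := by
  refine iSup_le fun z => iSup_le fun s => iSup_le fun hs => iSup_le fun _ => ?_
  have h0 := (hμ.pos z s hs).ne'
  have ht := (hμ.finite z s hs).ne
  rw [avg, eLpNorm_one_eq_lintegral_enorm, lintegral_smul_measure]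
  calc (μ (Metric.ball z s))⁻¹ • ∫⁻ y in Metric.ball z s, ‖S.indicator w y‖ₑ ∂μ
      ≤ (μ (Metric.ball z s))⁻¹ • ∫⁻ _ in Metric.ball z s, b ∂μ := by
        rw [smul_eq_mul, smul_eq_mul]
        refine mul_le_mul' le_rfl (lintegral_mono fun y => ?_)
        by_cases hy : y ∈ S
        · simpa [hy, hw.enorm_eq] using h y hy
        · simp [hy]
    _ = b := by
        rw [setLIntegral_const, smul_eq_mul, mul_comm b, ← mul_assoc,
          ENNReal.inv_mul_cancel h0 ht, one_mul]

/-- A weight whose values on a ball are controlled by its values on a smaller ball of comparable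
size belongs to `A_∞`. -/
theorem IsWeight.isAInfty_of_le (hμ : IsDoubling μ) (hD : DoublingWith μ D)
    {w : EuclideanSpace ℝ (Fin n) → ℝ} (hw : IsWeight w) {K : ℝ} (hK : 0 < K)
    (h : ∀ z s, 0 < s → ∃ z' b, Metric.ball z' (s / 4) ⊆ Metric.ball z s ∧
      (∀ y ∈ Metric.ball z s, w y ≤ b) ∧ ∀ y ∈ Metric.ball z' (s / 4), b ≤ K * w y) :
    IsAInfty μ w := by
  have hbd : ∀ z s, ∃ b : ℝ, ∀ y ∈ Metric.ball z s, w y ≤ b := by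
    intro z s
    obtain ⟨_, b, -, hb, -⟩ := h z (max s 1) (by positivity)
    exact ⟨b, fun y hy => hb y (Metric.ball_subset_ball (le_max_left _ _) hy)⟩
  have hfin : ∀ z s, weightMeasure μ w (Metric.ball z s) < ∞ := by
    intro z s
    obtain ⟨b, hb⟩ := hbd z s
    rw [weightMeasure_apply Metric.isOpen_ball.measurableSet]
    calc _ ≤ ∫⁻ _ in Metric.ball z s, ENNReal.ofReal b ∂μ :=
          setLIntegral_mono' Metric.isOpen_ball.measurableSet
            fun y hy => ENNReal.ofReal_le_ofReal (hb y hy)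
      _ < ∞ := by
          rw [setLIntegral_const]
          refine ENNReal.mul_lt_top ENNReal.ofReal_lt_top ?_
          exact (measure_mono (Metric.ball_subset_ball (le_max_left s 1))).trans_lt
            (hμ.finite z (max s 1) (by positivity))
  refine ⟨hw, hfin, lt_of_le_of_lt (b := ENNReal.ofReal K * (D : ℝ≥0∞) ^ 4) ?_
    (ENNReal.mul_lt_top ENNReal.ofReal_lt_top (by exact_mod_cast ENNReal.coe_lt_top))⟩
  refine iSup_le fun z => iSup_le fun s => iSup_le fun hs => ?_
  obtain ⟨z', b, hsub, hb, hb'⟩ := h z s hs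
  refine ENNReal.div_le_of_le_mul ?_
  have hball : μ (Metric.ball z s) ≤ (D : ℝ≥0∞) ^ 4 * μ (Metric.ball z' (s / 4)) := by
    refine le_trans (measure_mono ?_) (hD.measure_ball_two_pow_mul_le z' (by positivity) 4)
    have : dist z' z < s := hsub (Metric.mem_ball_self (by positivity))
    refine Metric.ball_subset_ball' ?_
    rw [dist_comm]
    linarith
  calc ∫⁻ x in Metric.ball z s, ballMaximal μ ((Metric.ball z s).indicator w) x ∂μ
      ≤ ∫⁻ _ in Metric.ball z s, ENNReal.ofReal b ∂μ :=
        lintegral_mono fun x => hw.ballMaximal_le hμ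
          (fun y hy => ENNReal.ofReal_le_ofReal (hb y hy)) x
    _ = ENNReal.ofReal b * μ (Metric.ball z s) := setLIntegral_const _ _
    _ ≤ ENNReal.ofReal b * ((D : ℝ≥0∞) ^ 4 * μ (Metric.ball z' (s / 4))) := by gcongr
    _ = (D : ℝ≥0∞) ^ 4 * ∫⁻ _ in Metric.ball z' (s / 4), ENNReal.ofReal b ∂μ := by
        rw [setLIntegral_const]; ring
    _ ≤ (D : ℝ≥0∞) ^ 4 * ∫⁻ y in Metric.ball z' (s / 4),
          ENNReal.ofReal K * ENNReal.ofReal (w y) ∂μ := by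
        refine mul_le_mul' le_rfl (setLIntegral_mono' Metric.isOpen_ball.measurableSet
          fun y hy => ?_)
        rw [← ENNReal.ofReal_mul hK.le]
        exact ENNReal.ofReal_le_ofReal (hb' y hy)
    _ = ENNReal.ofReal K * (D : ℝ≥0∞) ^ 4 * weightMeasure μ w (Metric.ball z' (s / 4)) := by
        rw [lintegral_const_mul _ hw.1.ennreal_ofReal,
          weightMeasure_apply Metric.isOpen_ball.measurableSet]
        ring
    _ ≤ _ := by gcongr

theorem isAInfty_one (hμ : IsDoubling μ) : IsAInfty μ (fun _ => 1) := by
  refine isWeight_one.isAInfty_of_le hμ hμ.doublingWith one_pos fun z s hs => ⟨z, 1, ?_, ?_, ?_⟩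
  · exact Metric.ball_subset_ball (by linarith)
  · simp
  · simp

theorem AInftyConst_one_le (hμ : IsDoubling μ) : AInftyConst μ (fun _ => 1) ≤ 1 := by
  refine iSup_le fun z => iSup_le fun s => iSup_le fun hs => ?_
  refine ENNReal.div_le_of_le_mul ?_
  rw [weightMeasure_one]
  calc _ ≤ ∫⁻ _ in Metric.ball z s, 1 ∂μ := lintegral_mono fun x =>
        isWeight_one.ballMaximal_le hμ (fun y _ => by simp) x
    _ = _ := by simp

/-- A step directed away from the origin, used to find the part of a ball where a radially
increasing weight is large. For z = 0 a coordinate direction serves, whence n ≥ 1. -/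
theorem exists_unit_add_norm (hn : 1 ≤ n) (z : EuclideanSpace ℝ (Fin n)) {t : ℝ} (ht : 0 ≤ t) :
    ∃ v : EuclideanSpace ℝ (Fin n), ‖v‖ = t ∧ ‖z + v‖ = ‖z‖ + t := by
  by_cases hz : z = 0
  · refine ⟨EuclideanSpace.single ⟨0, hn⟩ t, ?_, ?_⟩ <;> simp [hz, abs_of_nonneg ht]
  · have hz' : 0 < ‖z‖ := norm_pos_iff.2 hz
    refine ⟨(t / ‖z‖) • z, ?_, ?_⟩
    · rw [norm_smul, Real.norm_of_nonneg (by positivity)]; field_simp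
    · rw [show z + (t / ‖z‖) • z = (1 + t / ‖z‖) • z by rw [add_smul, one_smul], norm_smul,
        Real.norm_of_nonneg (by positivity)]
      field_simp

/-- These weights are what the density of test functions is applied to. On the ball of radius s/4
about z moved outwards by s/2, the norm is at least ‖z‖ + s/4, and 1 + ‖z‖ + s ≤ 4(1 + ‖z‖ + s/4).
-/
theorem isAInfty_one_add_norm_pow (hn : 1 ≤ n) (hμ : IsDoubling μ) (b : ℕ) :
    IsAInfty μ (fun x => (1 + ‖x‖) ^ b) := by
  have hw : IsWeight (fun x : EuclideanSpace ℝ (Fin n) => (1 + ‖x‖) ^ b) :=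
    ⟨by fun_prop, fun x => by positivity⟩
  refine hw.isAInfty_of_le hμ hμ.doublingWith (K := 4 ^ b) (by positivity) fun z s hs => ?_
  obtain ⟨v, hv1, hv2⟩ := exists_unit_add_norm hn z (t := s / 2) (by positivity)
  refine ⟨z + v, (1 + (‖z‖ + s)) ^ b, ?_, ?_, ?_⟩
  · refine Metric.ball_subset_ball' ?_
    rw [dist_eq_norm, add_sub_cancel_left, hv1]
    linarith
  · intro y hy
    rw [mem_ball_iff_norm] at hy
    have : ‖y‖ ≤ ‖z‖ + s := by
      calc ‖y‖ = ‖z + (y - z)‖ := by congr 1; abel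
        _ ≤ ‖z‖ + ‖y - z‖ := norm_add_le _ _
        _ ≤ _ := by linarith
    gcongr
  · intro y hy
    rw [mem_ball_iff_norm] at hy
    have : ‖z‖ + s / 4 ≤ ‖y‖ := by
      have h1 : ‖z + v‖ ≤ ‖y‖ + ‖y - (z + v)‖ := by
        calc ‖z + v‖ = ‖y - (y - (z + v))‖ := by congr 1; abel
          _ ≤ _ := norm_sub_le _ _
      linarith
    rw [← mul_pow]
    gcongr
    linarith [norm_nonneg z]

/-- Doubling implies polynomial growth: the ball of radius 2^k has measure O(D^k). Cutting space
into dyadic shells, 2^b > 2D makes the series geometric. -/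
theorem IsDoubling.exists_lintegral_inv_pow_lt_top (hμ : IsDoubling μ) :
    ∃ b : ℕ, ∫⁻ x, ENNReal.ofReal (((1 + ‖x‖) ^ b)⁻¹) ∂μ < ∞ := by
  set D := Real.toNNReal ((2 : ℝ) ^ doublingDimension μ) + 1
  have hD : DoublingWith μ D := hμ.doublingWith
  obtain ⟨b, hb⟩ := pow_unbounded_of_one_lt (2 * (D : ℝ)) (one_lt_two)
  refine ⟨b, ?_⟩
  have hle : ∀ x : EuclideanSpace ℝ (Fin n), ENNReal.ofReal (((1 + ‖x‖) ^ b)⁻¹) ≤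
      ∑' k : ℕ, (Metric.ball 0 (2 ^ (k + 1) * 1)).indicator
        (fun _ => ENNReal.ofReal (((2 : ℝ) ^ b)⁻¹ ^ k)) x := by
    intro x
    obtain ⟨k, hk1, hk2⟩ := exists_nat_pow_near (x := 1 + ‖x‖) (y := (2 : ℝ)) (by simp)
      one_lt_two
    refine le_trans ?_ (ENNReal.le_tsum k)
    rw [Set.indicator_of_mem (by rw [mem_ball_zero_iff]; linarith)]
    refine ENNReal.ofReal_le_ofReal ?_
    rw [inv_pow, ← pow_mul, mul_comm b, pow_mul]
    gcongr
  calc _ ≤ ∫⁻ x, ∑' k : ℕ, (Metric.ball 0 (2 ^ (k + 1) * 1)).indicator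
        (fun _ => ENNReal.ofReal (((2 : ℝ) ^ b)⁻¹ ^ k)) x ∂μ := lintegral_mono hle
    _ = ∑' k : ℕ, ENNReal.ofReal (((2 : ℝ) ^ b)⁻¹ ^ k) *
        μ (Metric.ball 0 (2 ^ (k + 1) * 1)) := by
        rw [lintegral_tsum fun k =>
          (measurable_const.indicator Metric.isOpen_ball.measurableSet).aemeasurable]
        congr 1
        ext k
        rw [lintegral_indicator Metric.isOpen_ball.measurableSet, setLIntegral_const]
    _ ≤ ∑' k : ℕ, (2⁻¹ : ℝ≥0∞) ^ k * (D * μ (Metric.ball 0 1)) := by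
        refine ENNReal.tsum_le_tsum fun k => ?_
        calc _ ≤ ENNReal.ofReal (((2 : ℝ) ^ b)⁻¹ ^ k) *
              ((D : ℝ≥0∞) ^ (k + 1) * μ (Metric.ball 0 1)) := by
              gcongr; exact hD.measure_ball_two_pow_mul_le 0 one_pos (k + 1)
          _ = (ENNReal.ofReal (((2 : ℝ) ^ b)⁻¹) * D) ^ k * (D * μ (Metric.ball 0 1)) := by
              rw [ENNReal.ofReal_pow (by positivity), mul_pow, pow_succ]; ring
          _ ≤ _ := by
              gcongr
              rw [← ENNReal.ofReal_coe_nnreal, ← ENNReal.ofReal_mul (by positivity)]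
              refine (ENNReal.ofReal_le_ofReal (q := (2 : ℝ)⁻¹) ?_).trans ?_
              · rw [inv_mul_le_iff₀ (by positivity)]; linarith
              · rw [ENNReal.ofReal_inv_of_pos (by norm_num)]; simp
    _ < ∞ := by
        rw [ENNReal.tsum_mul_right]
        refine ENNReal.mul_lt_top ?_ (ENNReal.mul_lt_top ENNReal.coe_lt_top
          (hμ.finite _ _ one_pos))
        rw [ENNReal.tsum_geometric]
        simp

end PolynomialWeights

/-! ### Simultaneous approximation by test functions -/

section Density

variable {n : ℕ} {μ : Measure (EuclideanSpace ℝ (Fin n))} {𝕜 : Type*} [RCLike 𝕜]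
  {𝒟 : Submodule 𝕜 (EuclideanSpace ℝ (Fin n) → 𝕜)}

theorem IsTestSpace.memLp (h𝒟 : IsTestSpace μ 𝒟) (hμ : IsDoubling μ) {p : ℝ≥0∞} (hp : 1 ≤ p)
    (hpt : p < ∞) {f : EuclideanSpace ℝ (Fin n) → 𝕜} (hf : f ∈ 𝒟) : MemLp f p μ := by
  simpa only [weightMeasure_one] using (h𝒟 p hp hpt _ (isAInfty_one hμ)).1 f hf

theorem IsTestSpace.exists_approx (h𝒟 : IsTestSpace μ 𝒟) (hμ : IsDoubling μ) {p : ℝ≥0∞}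
    (hp : 1 ≤ p) (hpt : p < ∞) {F : EuclideanSpace ℝ (Fin n) → 𝕜} (hF : MemLp F p μ) {ε : ℝ≥0∞}
    (hε : 0 < ε) : ∃ f ∈ 𝒟, eLpNorm (F - f) p μ ≤ ε := by
  simpa only [weightMeasure_one, hF, forall_const] using
    (h𝒟 p hp hpt _ (isAInfty_one hμ)).2 F (by rwa [weightMeasure_one]) ε hε

/-- Hölder with exponent q/p: a strong enough polynomial weight makes L^q embed into the smaller
exponent L^p of the whole space. -/
theorem exists_weight_eLpNorm_le (hμ : IsDoubling μ) {p q : ℝ} (hp : 0 < p) (hpq : p < q) :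
    ∃ (b : ℕ) (c : ℝ≥0), ∀ g : EuclideanSpace ℝ (Fin n) → 𝕜, AEStronglyMeasurable g μ →
      eLpNorm g (ENNReal.ofReal p) μ ≤
        c * eLpNorm g (ENNReal.ofReal q) (weightMeasure μ fun x => (1 + ‖x‖) ^ b) := by
  have hq : 0 < q := hp.trans hpq
  obtain ⟨b', hb'⟩ := hμ.exists_lintegral_inv_pow_lt_top
  -- The dual factor of Hölder is (1+‖x‖) to the power -b p/(q-p), which must be at most -b'.
  obtain ⟨b, hb⟩ := exists_nat_ge (b' * (q - p) / p)
  set u : EuclideanSpace ℝ (Fin n) → ℝ≥0∞ := fun x => ENNReal.ofReal ((1 + ‖x‖) ^ b) with hu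
  have hum : Measurable u := by fun_prop
  have hθ : (q / p).HolderConjugate (q / p / (q / p - 1)) :=
    Real.HolderConjugate.conjExponent ((one_lt_div hp).2 hpq)
  set θ' := q / p / (q / p - 1) with hθ'
  have hθ'eq : θ' = q / (q - p) := by
    have : q - p ≠ 0 := by linarith
    rw [hθ']; field_simp
  have hθ'pos : 0 < θ' := hθ.symm.pos
  have hint : ∫⁻ x, (u x ^ (-(p / q))) ^ θ' ∂μ < ∞ := by
    refine lt_of_le_of_lt (lintegral_mono fun x => ?_) hb'
    have h1 : (1 : ℝ) ≤ 1 + ‖x‖ := by simp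
    rw [hu, ← ENNReal.rpow_mul, ENNReal.ofReal_rpow_of_pos (by positivity)]
    refine ENNReal.ofReal_le_ofReal ?_
    rw [← Real.rpow_natCast, ← Real.rpow_natCast, ← Real.rpow_neg (by positivity),
      ← Real.rpow_mul (by positivity)]
    refine Real.rpow_le_rpow_of_exponent_le h1 ?_
    have : p / q * θ' = p / (q - p) := by rw [hθ'eq]; field_simp
    have h2 : (b : ℝ) * (p / (q - p)) ≥ b' := by
      have h3 : 0 < q - p := by linarith
      rw [ge_iff_le, ← mul_div_assoc, le_div_iff₀ h3]
      rwa [div_le_iff₀ hp] at hb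
    nlinarith
  have hpE : ENNReal.ofReal p ≠ 0 := by simpa using hp
  have hqE : ENNReal.ofReal q ≠ 0 := by simpa using hq
  refine ⟨b, (((∫⁻ x, (u x ^ (-(p / q))) ^ θ' ∂μ) ^ (1 / θ')) ^ (1 / p)).toNNReal, fun g hg => ?_⟩
  rw [ENNReal.coe_toNNReal (ENNReal.rpow_ne_top_of_nonneg (by positivity)
    (ENNReal.rpow_ne_top_of_nonneg (by positivity) hint.ne)),
    eLpNorm_eq_lintegral_rpow_enorm_toReal hpE ENNReal.ofReal_ne_top,
    eLpNorm_eq_lintegral_rpow_enorm_toReal hqE ENNReal.ofReal_ne_top,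
    ENNReal.toReal_ofReal hp.le, ENNReal.toReal_ofReal hq.le]
  have hupos : ∀ x, u x ≠ 0 := fun x => (ENNReal.ofReal_pos.2 (by positivity)).ne'
  have hut : ∀ x, u x ≠ ∞ := fun x => ENNReal.ofReal_ne_top
  have hw : ∫⁻ x, ‖g x‖ₑ ^ q ∂(weightMeasure μ fun x => (1 + ‖x‖) ^ b) =
      ∫⁻ x, (‖g x‖ₑ ^ p * u x ^ (p / q)) ^ (q / p) ∂μ := by
    rw [weightMeasure, lintegral_withDensity_eq_lintegral_mul₀ hum.aemeasurable
      (hg.enorm.pow_const q)]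
    refine lintegral_congr fun x => ?_
    simp only [Pi.mul_apply]
    rw [ENNReal.mul_rpow_of_nonneg _ _ (by positivity), ← ENNReal.rpow_mul, ← ENNReal.rpow_mul,
      mul_div_cancel₀ _ hp.ne', div_mul_div_cancel₀ hq.ne', div_self hp.ne', ENNReal.rpow_one,
      mul_comm]
  have hol := ENNReal.lintegral_mul_le_Lp_mul_Lq μ hθ
    (f := fun x => ‖g x‖ₑ ^ p * u x ^ (p / q)) (g := fun x => u x ^ (-(p / q)))
    ((hg.enorm.pow_const p).mul (hum.pow_const _).aemeasurable) (hum.pow_const _).aemeasurable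
  rw [hw]
  calc (∫⁻ x, ‖g x‖ₑ ^ p ∂μ) ^ (1 / p)
      = (∫⁻ x, ((fun x => ‖g x‖ₑ ^ p * u x ^ (p / q)) * fun x => u x ^ (-(p / q))) x ∂μ) ^
        (1 / p) := by
        congr 1
        refine lintegral_congr fun x => ?_
        simp only [Pi.mul_apply]
        rw [mul_assoc, ← ENNReal.rpow_add _ _ (hupos x) (hut x), add_neg_cancel,
          ENNReal.rpow_zero, mul_one]
    _ ≤ _ := ENNReal.rpow_le_rpow hol (by positivity)
    _ = _ := by
        rw [ENNReal.mul_rpow_of_nonneg _ _ (by positivity), mul_comm, ← ENNReal.rpow_mul _ (1 / (q / p))]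
        congr 2
        field_simp

/-- Approximation in L^q with weight (1+‖x‖)^b controls both norms: the L^q norm because the weight
is at least 1, the L^p norm by the weighted embedding. F lies in the weighted space, being bounded
with bounded support. -/
theorem IsTestSpace.exists_approx_two (h𝒟 : IsTestSpace μ 𝒟) (hn : 1 ≤ n) (hμ : IsDoubling μ)
    {p q : ℝ} (hp : 1 ≤ p) (hpq : p < q) {F : EuclideanSpace ℝ (Fin n) → 𝕜}
    (hF : AEStronglyMeasurable F μ) {R C : ℝ} (hR : ∀ x, F x ≠ 0 → ‖x‖ ≤ R)
    (hC : ∀ x, ‖F x‖ ≤ C) {ε : ℝ≥0∞} (hε : 0 < ε) :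
    ∃ f ∈ 𝒟, eLpNorm (F - f) (ENNReal.ofReal p) μ ≤ ε ∧
      eLpNorm (F - f) (ENNReal.ofReal q) μ ≤ ε := by
  obtain ⟨b, c, hc⟩ := exists_weight_eLpNorm_le (𝕜 := 𝕜) hμ (by linarith : 0 < p) hpq
  set u : EuclideanSpace ℝ (Fin n) → ℝ := fun x => (1 + ‖x‖) ^ b with hu
  have hA : IsAInfty μ u := isAInfty_one_add_norm_pow hn hμ b
  have hac : weightMeasure μ u ≪ μ := withDensity_absolutelyContinuous _ _
  have hq1 : 1 ≤ ENNReal.ofReal q := by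
    rw [← ENNReal.ofReal_one]; exact ENNReal.ofReal_le_ofReal (by linarith)
  have hFu : MemLp F (ENNReal.ofReal q) (weightMeasure μ u) := by
    have hsupp : F = (Metric.closedBall 0 R).indicator F := by
      refine (Set.indicator_eq_self.2 fun x hx => ?_).symm
      rw [mem_closedBall_zero_iff]
      exact hR x hx
    rw [hsupp, memLp_indicator_iff_restrict Metric.isClosed_closedBall.measurableSet]
    have hfin : IsFiniteMeasure ((weightMeasure μ u).restrict (Metric.closedBall 0 R)) := by
      refine ⟨?_⟩
      rw [Measure.restrict_apply_univ]
      exact (measure_mono (Metric.closedBall_subset_ball (lt_add_one R))).trans_lt (hA.2.1 _ _)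
    exact MemLp.of_bound (hF.mono_ac hac).restrict C (Eventually.of_forall hC)
  obtain ⟨f, hf, hfε⟩ := (h𝒟 _ hq1 ENNReal.ofReal_lt_top u hA).2 F hFu
    (ε / (c + 1)) (ENNReal.div_pos hε.ne' (by simp))
  have hc1 : (c : ℝ≥0∞) + 1 ≠ 0 := by simp
  have hc2 : (c : ℝ≥0∞) + 1 ≠ ∞ := by simp
  have hfm : AEStronglyMeasurable f μ := (h𝒟.memLp hμ le_rfl ENNReal.one_lt_top hf).1
  refine ⟨f, hf, ?_, ?_⟩
  · refine (hc _ (hF.sub hfm)).trans ?_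
    calc _ ≤ (c + 1) * (ε / (c + 1)) := by gcongr; exact le_self_add
      _ = ε := ENNReal.mul_div_cancel hc1 hc2
  · have hle : μ ≤ weightMeasure μ u := by
      conv_lhs => rw [← weightMeasure_one (μ := μ)]
      refine withDensity_mono (Eventually.of_forall fun x => ?_)
      refine ENNReal.ofReal_le_ofReal (one_le_pow₀ ?_)
      simp
    refine (eLpNorm_mono_measure _ hle).trans (hfε.trans ?_)
    exact ENNReal.div_le_of_le_mul (by rw [mul_add, mul_one]; exact le_add_self)

end Density

/-! ### Duality of Lebesgue spaces -/

section Duality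

variable {X : Type*} [MeasurableSpace X] {μ : Measure X} {𝕜 : Type*} [RCLike 𝕜]

theorem tendsto_eLpNorm_zero_of_dominated {p : ℝ} (hp : 0 < p) {F : ℕ → X → 𝕜} {B : X → 𝕜}
    (hF : ∀ k, AEStronglyMeasurable (F k) μ) (hB : MemLp B (ENNReal.ofReal p) μ)
    (hle : ∀ k x, ‖F k x‖ ≤ ‖B x‖) (hlim : ∀ x, Tendsto (fun k => F k x) atTop (𝓝 0)) :
    Tendsto (fun k => eLpNorm (F k) (ENNReal.ofReal p) μ) atTop (𝓝 0) := by
  have hpE : ENNReal.ofReal p ≠ 0 := by simpa using hp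
  simp_rw [eLpNorm_eq_lintegral_rpow_enorm_toReal hpE ENNReal.ofReal_ne_top,
    ENNReal.toReal_ofReal hp.le]
  have h1 : Tendsto (fun k => ∫⁻ x, ‖F k x‖ₑ ^ p ∂μ) atTop (𝓝 (∫⁻ _, 0 ∂μ)) := by
    refine tendsto_lintegral_of_dominated_convergence' (fun x => ‖B x‖ₑ ^ p)
      (fun k => (hF k).enorm.pow_const p) (fun k => Eventually.of_forall fun x => ?_) ?_
      (Eventually.of_forall fun x => ?_)
    · have := hle k x
      refine ENNReal.rpow_le_rpow ?_ hp.le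
      rw [← ofReal_norm, ← ofReal_norm]
      exact ENNReal.ofReal_le_ofReal this
    · have := (lintegral_rpow_enorm_lt_top_of_eLpNorm_lt_top hpE ENNReal.ofReal_ne_top hB.2).ne
      rwa [ENNReal.toReal_ofReal hp.le] at this
    · have h2 : Tendsto (fun k => ‖F k x‖ₑ) atTop (𝓝 0) := by
        simpa using (hlim x).enorm
      simpa [hp] using h2.ennrpow_const p
  rw [lintegral_zero] at h1
  simpa [hp] using h1.ennrpow_const (1 / p)

open Classical in
/-- A functional on `L^p`, as a function on all functions. -/
noncomputable def lift {p : ℝ≥0∞} [Fact (1 ≤ p)] (L : Lp 𝕜 p μ →L[𝕜] 𝕜) (g : X → 𝕜) : 𝕜 :=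
  if h : MemLp g p μ then L (h.toLp g) else 0

section lift

variable {p : ℝ≥0∞} [Fact (1 ≤ p)] (L : Lp 𝕜 p μ →L[𝕜] 𝕜) {f g : X → 𝕜}

theorem lift_of_memLp (hg : MemLp g p μ) : lift L g = L (hg.toLp g) := dif_pos hg

theorem lift_add (hf : MemLp f p μ) (hg : MemLp g p μ) : lift L (f + g) = lift L f + lift L g := by
  rw [lift_of_memLp L hf, lift_of_memLp L hg, lift_of_memLp L (hf.add hg), MemLp.toLp_add, map_add]

theorem lift_sub (hf : MemLp f p μ) (hg : MemLp g p μ) : lift L (f - g) = lift L f - lift L g := by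
  rw [lift_of_memLp L hf, lift_of_memLp L hg, lift_of_memLp L (hf.sub hg), MemLp.toLp_sub, map_sub]

theorem lift_const_mul (c : 𝕜) (hf : MemLp f p μ) : lift L (c • f) = c * lift L f := by
  rw [lift_of_memLp L hf, lift_of_memLp L (hf.const_smul c), MemLp.toLp_const_smul, map_smul,
    smul_eq_mul]

theorem norm_lift_le (hf : MemLp f p μ) : ‖lift L f‖ ≤ ‖L‖ * (eLpNorm f p μ).toReal := by
  rw [lift_of_memLp L hf]
  refine (L.le_opNorm _).trans ?_
  rw [Lp.norm_toLp]

theorem lift_congr (h : f =ᵐ[μ] g) : lift L f = lift L g := by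
  by_cases hf : MemLp f p μ
  · have hg := hf.ae_eq h
    rw [lift_of_memLp L hf, lift_of_memLp L hg, (MemLp.toLp_eq_toLp_iff hf hg).2 h]
  · have hg : ¬ MemLp g p μ := fun hg => hf (hg.ae_eq h.symm)
    rw [lift, lift, dif_neg hf, dif_neg hg]

theorem lift_zero : lift L (0 : X → 𝕜) = 0 := by
  have := lift_const_mul L (0 : 𝕜) (f := 0) MemLp.zero'
  simpa using this

theorem tendsto_lift {F : ℕ → X → 𝕜} (hF : ∀ k, MemLp (F k) p μ) (hf : MemLp f p μ)
    (h : Tendsto (fun k => eLpNorm (F k - f) p μ) atTop (𝓝 0)) :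
    Tendsto (fun k => lift L (F k)) atTop (𝓝 (lift L f)) := by
  rw [tendsto_iff_norm_sub_tendsto_zero]
  have h1 : Tendsto (fun k => ‖L‖ * (eLpNorm (F k - f) p μ).toReal) atTop (𝓝 0) := by
    have := (ENNReal.tendsto_toReal ENNReal.zero_ne_top).comp h
    simpa using this.const_mul ‖L‖
  refine squeeze_zero (fun k => norm_nonneg _) (fun k => ?_) h1
  rw [← lift_sub L (hF k) hf]
  exact norm_lift_le L ((hF k).sub hf)

theorem lift_sum_indicator {κ : X → 𝕜} (hκ : MemLp κ p μ) {E : ℕ → Set X}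
    (hE : ∀ i, MeasurableSet (E i)) (hd : Pairwise (Function.onFun Disjoint E)) (s : Finset ℕ) :
    lift L ((⋃ i ∈ s, E i).indicator κ) = ∑ i ∈ s, lift L ((E i).indicator κ) := by
  classical
  induction s using Finset.induction_on with
  | empty =>
    simp only [Finset.notMem_empty, Set.iUnion_of_empty, Set.iUnion_empty, Set.indicator_empty,
      Finset.sum_empty]
    exact lift_zero L
  | insert a s ha ih =>
    rw [Finset.sum_insert ha, ← ih, ← lift_add L (hκ.indicator (hE a))
      (hκ.indicator (Finset.measurableSet_biUnion s fun i _ => hE i))]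
    congr 1
    rw [Finset.set_biUnion_insert, Set.indicator_union_of_disjoint]
    · rfl
    · rw [Set.disjoint_iUnion₂_right]
      exact fun i hi => hd (fun h => ha (h ▸ hi))

end lift

/-- By continuity of L, the error after a finite set of indices is at most ‖L‖ times the L^p norm of
κ on the remaining sets, which is the tail of a convergent series. -/
theorem hasSum_lift_indicator {p : ℝ} (hp : 0 < p) [Fact (1 ≤ ENNReal.ofReal p)]
    (L : Lp 𝕜 (ENNReal.ofReal p) μ →L[𝕜] 𝕜) {κ : X → 𝕜} (hκ : MemLp κ (ENNReal.ofReal p) μ)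
    {E : ℕ → Set X} (hE : ∀ i, MeasurableSet (E i))
    (hd : Pairwise (Function.onFun Disjoint E)) :
    HasSum (fun i => lift L ((E i).indicator κ)) (lift L ((⋃ i, E i).indicator κ)) := by
  have hpE : ENNReal.ofReal p ≠ 0 := by simpa using hp
  have hU := MeasurableSet.iUnion hE
  set τ : Finset ℕ → ℝ≥0∞ := fun s => ∑' i : {i // i ∉ s}, ∫⁻ x in E i, ‖κ x‖ₑ ^ p ∂μ
  have hτ : Tendsto τ atTop (𝓝 0) := by
    refine ENNReal.tendsto_tsum_compl_atTop_zero (f := fun i => ∫⁻ x in E i, ‖κ x‖ₑ ^ p ∂μ) ?_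
    rw [← lintegral_iUnion hE hd]
    refine ne_top_of_le_ne_top ?_ (setLIntegral_le_lintegral _ _)
    have := (lintegral_rpow_enorm_lt_top_of_eLpNorm_lt_top hpE ENNReal.ofReal_ne_top hκ.2).ne
    rwa [ENNReal.toReal_ofReal hp.le] at this
  have hnorm : ∀ s : Finset ℕ, eLpNorm ((⋃ i, E i).indicator κ - (⋃ i ∈ s, E i).indicator κ)
      (ENNReal.ofReal p) μ ≤ τ s ^ (1 / p) := by
    intro s
    have hsm : MeasurableSet (⋃ i ∈ s, E i) := Finset.measurableSet_biUnion s fun i _ => hE i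
    have heq : (⋃ i, E i).indicator κ - (⋃ i ∈ s, E i).indicator κ =
        (⋃ i : {i // i ∉ s}, E i).indicator κ := by
      have hset : (⋃ i, E i) \ (⋃ i ∈ s, E i) = ⋃ i : {i // i ∉ s}, E i := by
        ext x
        simp only [Set.mem_sdiff, Set.mem_iUnion, not_exists, Subtype.exists, exists_prop]
        constructor
        · rintro ⟨⟨i, hi⟩, h⟩
          exact ⟨i, fun his => h i ⟨his, hi⟩, hi⟩
        · rintro ⟨i, his, hi⟩
          refine ⟨⟨i, hi⟩, fun j hj => ?_⟩
          exact Set.disjoint_left.1 (hd (fun h : i = j => his (h ▸ hj.1))) hi hj.2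
      have hsub : (⋃ i ∈ s, E i) ⊆ ⋃ i, E i := Set.iUnion₂_subset fun i _ => Set.subset_iUnion E i
      rw [← hset, Set.indicator_sdiff hsub]
    rw [heq, eLpNorm_indicator_eq_eLpNorm_restrict
      (MeasurableSet.iUnion fun i : {i // i ∉ s} => hE i),
      eLpNorm_eq_lintegral_rpow_enorm_toReal hpE ENNReal.ofReal_ne_top,
      ENNReal.toReal_ofReal hp.le, lintegral_iUnion (fun i : {i // i ∉ s} => hE i)
        (fun i j hij => hd (fun h => hij (Subtype.ext h)))]
  rw [HasSum, tendsto_iff_norm_sub_tendsto_zero]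
  simp only [← lift_sum_indicator L hκ hE hd]
  have h1 : Tendsto (fun s => ‖L‖ * (τ s ^ (1 / p)).toReal) atTop (𝓝 0) := by
    have h2 : Tendsto (fun s => τ s ^ (1 / p)) atTop (𝓝 0) := by
      simpa [hp] using hτ.ennrpow_const (1 / p)
    have := (ENNReal.tendsto_toReal ENNReal.zero_ne_top).comp h2
    simpa using this.const_mul ‖L‖
  have hev : ∀ᶠ s in atTop, τ s < ∞ := hτ.eventually_lt_const ENNReal.zero_lt_top
  refine squeeze_zero' (Eventually.of_forall fun s => norm_nonneg _) ?_ h1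
  filter_upwards [hev] with s hs
  have hsm : MeasurableSet (⋃ i ∈ s, E i) := Finset.measurableSet_biUnion s fun i _ => hE i
  rw [norm_sub_rev, ← lift_sub L (hκ.indicator hU) (hκ.indicator hsm)]
  refine (norm_lift_le L ((hκ.indicator hU).sub (hκ.indicator hsm))).trans ?_
  gcongr
  · exact ENNReal.rpow_ne_top_of_nonneg (by positivity) hs.ne
  · exact hnorm s

open Classical in
/-- The vector measure `E ↦ L (κ 1_E)` of a functional `L` on `L^p`. -/
noncomputable def liftMeasure {p : ℝ} (hp : 0 < p) [Fact (1 ≤ ENNReal.ofReal p)]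
    (L : Lp 𝕜 (ENNReal.ofReal p) μ →L[𝕜] 𝕜) {κ : X → 𝕜} (hκ : MemLp κ (ENNReal.ofReal p) μ) :
    VectorMeasure X 𝕜 where
  measureOf' E := if MeasurableSet E then lift L (E.indicator κ) else 0
  empty' := by
    rw [if_pos MeasurableSet.empty, Set.indicator_empty]
    exact lift_zero L
  not_measurable' E hE := by simp [hE]
  m_iUnion' E hE hd := by
    simpa [hE, MeasurableSet.iUnion hE] using hasSum_lift_indicator hp L hκ hE hd

/-- Radon–Nikodym for signed measures, applied to the real and imaginary parts. -/
theorem exists_density [SigmaFinite μ] (v : VectorMeasure X 𝕜)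
    (hv : ∀ E, MeasurableSet E → μ E = 0 → v E = 0) :
    ∃ k : X → 𝕜, Measurable k ∧ Integrable k μ ∧ ∀ E, MeasurableSet E → ∫ x in E, k x ∂μ = v E := by
  have hreal : ∀ s : SignedMeasure X, (∀ E, MeasurableSet E → μ E = 0 → s E = 0) →
      ∀ E, MeasurableSet E → ∫ x in E, s.rnDeriv μ x ∂μ = s E := by
    intro s hs E hE
    have hac : s ≪ᵥ μ.toENNRealVectorMeasure := VectorMeasure.AbsolutelyContinuous.mk
      fun E hE h0 => hs E hE (by rwa [Measure.toENNRealVectorMeasure_apply_measurable hE] at h0)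
    conv_rhs => rw [← SignedMeasure.withDensityᵥ_rnDeriv_eq s μ hac]
    rw [withDensityᵥ_apply (SignedMeasure.integrable_rnDeriv s μ) hE]
  set vr : SignedMeasure X := v.mapRange (RCLike.re : 𝕜 →+ ℝ) RCLike.continuous_re
  set vi : SignedMeasure X := v.mapRange (RCLike.im : 𝕜 →+ ℝ) RCLike.continuous_im
  have hr := hreal vr fun E hE h0 => by simp [vr, hv E hE h0]
  have hi := hreal vi fun E hE h0 => by simp [vi, hv E hE h0]
  have ir := (SignedMeasure.integrable_rnDeriv vr μ)
  have ii := (SignedMeasure.integrable_rnDeriv vi μ)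
  refine ⟨fun x => (vr.rnDeriv μ x : 𝕜) + (vi.rnDeriv μ x : 𝕜) * RCLike.I, ?_, ?_, ?_⟩
  · have h1 := SignedMeasure.measurable_rnDeriv vr μ
    have h2 := SignedMeasure.measurable_rnDeriv vi μ
    fun_prop
  · exact ir.ofReal.add (ii.ofReal.mul_const _)
  · intro E hE
    rw [integral_add ir.ofReal.restrict (ii.ofReal.mul_const _).restrict,
      integral_mul_const, integral_ofReal, integral_ofReal, hr E hE, hi E hE]
    simp [vr, vi]

/-- Multiplying by such a κ puts every indicator into L^p, also for sets of infinite measure, so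
that E ↦ L(κ 1_E) is defined on all measurable sets. -/
theorem exists_pos_memLp [SigmaFinite μ] {p : ℝ} (hp : 0 < p) :
    ∃ κ : X → ℝ, (∀ x, 0 < κ x) ∧ Measurable κ ∧
      MemLp (fun x => (κ x : 𝕜)) (ENNReal.ofReal p) μ := by
  have hpE : ENNReal.ofReal p ≠ 0 := by simpa using hp
  obtain ⟨g, hg0, hgm, hg⟩ := exists_pos_lintegral_lt_of_sigmaFinite μ (one_ne_zero (α := ℝ≥0∞))
  have hm : Measurable fun x => (g x : ℝ) ^ (1 / p) := by fun_prop
  refine ⟨fun x => (g x : ℝ) ^ (1 / p), fun x => Real.rpow_pos_of_pos (hg0 x) _, hm, ?_, ?_⟩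
  · exact (RCLike.measurable_ofReal.comp hm).aestronglyMeasurable
  · rw [eLpNorm_lt_top_iff_lintegral_rpow_enorm_lt_top hpE ENNReal.ofReal_ne_top,
      ENNReal.toReal_ofReal hp.le]
    refine lt_of_eq_of_lt (lintegral_congr fun x => ?_) (hg.trans ENNReal.one_lt_top)
    have h0 : (0 : ℝ) ≤ (g x : ℝ) ^ (1 / p) := by positivity
    rw [← ofReal_norm, RCLike.norm_of_nonneg h0, ENNReal.ofReal_rpow_of_nonneg h0 hp.le,
      ← Real.rpow_mul (by positivity), one_div_mul_cancel hp.ne', Real.rpow_one,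
      ENNReal.ofReal_coe_nnreal]

/-- Pairing a bounded function times `κ` with the functional. -/
theorem lift_mul_eq_integral {p : ℝ} (hp : 0 < p) [Fact (1 ≤ ENNReal.ofReal p)]
    (L : Lp 𝕜 (ENNReal.ofReal p) μ →L[𝕜] 𝕜) {κ k : X → 𝕜} (hκ : MemLp κ (ENNReal.ofReal p) μ)
    (hk : Integrable k μ)
    (h : ∀ E, MeasurableSet E → ∫ x in E, k x ∂μ = lift L (E.indicator κ))
    {φ : X → 𝕜} (hφ : StronglyMeasurable φ) {c : ℝ} (hc : ∀ x, ‖φ x‖ ≤ c) :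
    lift L (fun x => φ x * κ x) = ∫ x, φ x * k x ∂μ := by
  have hmem : ∀ {ψ : X → 𝕜}, StronglyMeasurable ψ → (∀ x, ‖ψ x‖ ≤ c) →
      MemLp (fun x => ψ x * κ x) (ENNReal.ofReal p) μ := fun {ψ} hψ hψc =>
    MemLp.of_le_mul (c := c) hκ (hψ.aestronglyMeasurable.mul hκ.1)
      (Eventually.of_forall fun x => by
        rw [norm_mul]; exact mul_le_mul_of_nonneg_right (hψc x) (norm_nonneg _))
  have hmem' : ∀ ψ : SimpleFunc X 𝕜, MemLp (fun x => ψ x * κ x) (ENNReal.ofReal p) μ := by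
    intro ψ
    obtain ⟨b, hb⟩ := ψ.exists_forall_norm_le
    exact MemLp.of_le_mul (c := b) hκ (ψ.stronglyMeasurable.aestronglyMeasurable.mul hκ.1)
      (Eventually.of_forall fun x => by
        rw [norm_mul]; exact mul_le_mul_of_nonneg_right (hb x) (norm_nonneg _))
  have hint' : ∀ ψ : SimpleFunc X 𝕜, Integrable (fun x => ψ x * k x) μ := by
    intro ψ
    obtain ⟨b, hb⟩ := ψ.exists_forall_norm_le
    exact hk.bdd_mul ψ.stronglyMeasurable.aestronglyMeasurable (Eventually.of_forall hb)
  have hsimple : ∀ ψ : SimpleFunc X 𝕜,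
      lift L (fun x => ψ x * κ x) = ∫ x, ψ x * k x ∂μ := by
    intro ψ
    induction ψ using SimpleFunc.induction with
    | const a hs =>
      rename_i s
      have e1 : (fun x => (SimpleFunc.piecewise s hs (SimpleFunc.const X a)
          (SimpleFunc.const X 0)) x * κ x) = a • s.indicator κ := by
        ext x
        by_cases hx : x ∈ s <;> simp [hx]
      have e2 : (fun x => (SimpleFunc.piecewise s hs (SimpleFunc.const X a)
          (SimpleFunc.const X 0)) x * k x) = s.indicator (fun x => a * k x) := by
        ext x
        by_cases hx : x ∈ s <;> simp [hx]
      rw [e1, e2, lift_const_mul L a (hκ.indicator hs), integral_indicator hs,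
        integral_const_mul, h s hs]
    | add _ hf hg =>
      rename_i f g _
      have e1 : (fun x => (f + g) x * κ x) = (fun x => f x * κ x) + fun x => g x * κ x := by
        ext x; simp [add_mul]
      have e2 : (fun x => (f + g) x * k x) = fun x => f x * k x + g x * k x := by
        ext x; simp [add_mul]
      rw [e1, e2, lift_add L (hmem' f) (hmem' g), hf, hg, integral_add (hint' f) (hint' g)]
  -- Nonnegativity of c is read off at a point, since X may be empty.
  have hc0 : ∀ x : X, 0 ≤ c := fun x => (norm_nonneg _).trans (hc x)
  set Φ := fun N => hφ.approxBounded c N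
  have hΦ : ∀ x, Tendsto (fun N => Φ N x) atTop (𝓝 (φ x)) :=
    fun x => hφ.tendsto_approxBounded_of_norm_le (hc x)
  have hΦc : ∀ N x, ‖Φ N x‖ ≤ c := fun N x => hφ.norm_approxBounded_le (hc0 x) N x
  have lim1 : Tendsto (fun N => ∫ x, Φ N x * k x ∂μ) atTop (𝓝 (∫ x, φ x * k x ∂μ)) := by
    refine tendsto_integral_of_dominated_convergence (fun x => c * ‖k x‖)
      (fun N => (hint' _).1) (hk.norm.const_mul c) (fun N => Eventually.of_forall fun x => ?_)
      (Eventually.of_forall fun x => (hΦ x).mul_const _)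
    rw [norm_mul]
    exact mul_le_mul_of_nonneg_right (hΦc N x) (norm_nonneg _)
  have lim2 : Tendsto (fun N => lift L (fun x => Φ N x * κ x)) atTop
      (𝓝 (lift L (fun x => φ x * κ x))) := by
    refine tendsto_lift L (fun N => hmem' _) (hmem hφ hc) ?_
    refine tendsto_eLpNorm_zero_of_dominated hp (B := fun x => ((2 * c : ℝ) : 𝕜) * κ x)
      (fun N => (hmem' _).1.sub (hmem hφ hc).1) (hκ.const_mul _) (fun N x => ?_) fun x => ?_
    · simp only [Pi.sub_apply]
      rw [← sub_mul, norm_mul, norm_mul, RCLike.norm_of_nonneg (by linarith [hc0 x])]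
      refine mul_le_mul_of_nonneg_right ?_ (norm_nonneg _)
      exact (norm_sub_le _ _).trans (by linarith [hΦc N x, hc x])
    · simp only [Pi.sub_apply]
      have := ((hΦ x).mul_const (κ x)).sub_const (φ x * κ x)
      simpa using this
  refine tendsto_nhds_unique lim2 ?_
  simp_rw [fun N => hsimple (Φ N)]
  exact lim1

/-- The Riesz representation theorem for functionals on `L^p`, `1 < p < ∞`. -/
theorem exists_memLp_eq_integral [SigmaFinite μ] {p q : ℝ} (hpq : p.HolderConjugate q)
    [Fact (1 ≤ ENNReal.ofReal p)] (L : Lp 𝕜 (ENNReal.ofReal p) μ →L[𝕜] 𝕜) :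
    ∃ h : X → 𝕜, MemLp h (ENNReal.ofReal q) μ ∧
      ∀ g (hg : MemLp g (ENNReal.ofReal p) μ), L (hg.toLp g) = ∫ x, h x * g x ∂μ := by
  have hp := hpq.pos
  have hq := hpq.symm.pos
  have hpE : ENNReal.ofReal p ≠ 0 := by simpa using hp
  have hqE : ENNReal.ofReal q ≠ 0 := by simpa using hq
  obtain ⟨κ, hκ0, hκm, hκ⟩ := exists_pos_memLp (μ := μ) (𝕜 := 𝕜) hp
  obtain ⟨k, hkm, hk, hkE⟩ := exists_density (liftMeasure hp L hκ) (μ := μ) (by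
    intro E hE h0
    rw [← lift_zero L]
    refine (if_pos hE).trans ?_
    exact lift_congr L (indicator_meas_zero h0))
  replace hkE : ∀ E, MeasurableSet E → ∫ x in E, k x ∂μ =
      lift L (E.indicator fun x => (κ x : 𝕜)) := fun E hE => (hkE E hE).trans (if_pos hE)
  have hκne : ∀ x, (κ x : 𝕜) ≠ 0 := fun x => by
    simpa using (hκ0 x).ne'
  -- The density of E ↦ L(κ 1_E) must be h κ, so the representing function is the quotient.
  set h : X → 𝕜 := fun x => k x / κ x with hh
  have hhm : Measurable h := by fun_prop
  have hhk : ∀ x, h x * κ x = k x := fun x => div_mul_cancel₀ _ (hκne x)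
  have key := fun {φ : X → 𝕜} (hφ : StronglyMeasurable φ) {c : ℝ} (hc : ∀ x, ‖φ x‖ ≤ c) =>
    lift_mul_eq_integral hp L hκ hk hkE hφ hc
  have hq1 : 0 < q - 1 := by linarith [hpq.symm.lt]
  -- bound on the truncations
  set E : ℕ → Set X := fun N => {x | ‖h x‖ ≤ N ∧ (1 : ℝ) ≤ N * κ x} with hE
  have hEm : ∀ N, MeasurableSet (E N) := fun N =>
    (measurableSet_le hhm.norm measurable_const).inter
      (measurableSet_le measurable_const (hκm.const_mul _))
  have hbound : ∀ N, (∫⁻ x in E N, ‖h x‖ₑ ^ q ∂μ) ^ (1 / q) ≤ ENNReal.ofReal ‖L‖ := by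
    intro N
    -- φ κ is the extremal function h̄ |h|^{q-2} of the converse Hölder inequality, cut to E N,
    -- where |h| ≤ N and 1/κ ≤ N keep φ bounded.
    set φ : X → 𝕜 := (E N).indicator
      fun x => (starRingEnd 𝕜 (h x)) * ((‖h x‖ ^ (q - 2) : ℝ) : 𝕜) / κ x with hφ
    have hφm : StronglyMeasurable φ :=
      (Measurable.indicator (by
        have := RCLike.continuous_conj.measurable.comp hhm
        have h2 : Measurable fun x => ((‖h x‖ ^ (q - 2) : ℝ) : 𝕜) :=
          RCLike.measurable_ofReal.comp (hhm.norm.pow_const _)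
        exact (this.mul h2).div (RCLike.measurable_ofReal.comp hκm)) (hEm N)).stronglyMeasurable
    have hnorm : ∀ x ∈ E N, ‖φ x * κ x‖ = ‖h x‖ ^ (q - 1) := by
      intro x hx
      rw [hφ, Set.indicator_of_mem hx, div_mul_cancel₀ _ (hκne x), norm_mul, RCLike.norm_conj,
        RCLike.norm_of_nonneg (by positivity)]
      rcases eq_or_ne ‖h x‖ 0 with h0 | h0
      · rw [h0, Real.zero_rpow hq1.ne', zero_mul]
      · rw [← Real.rpow_one_add' (norm_nonneg _) (by linarith)]; ring_nf
    have hφc : ∀ x, ‖φ x‖ ≤ (N : ℝ) ^ (q - 1) * N := by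
      intro x
      by_cases hx : x ∈ E N
      · have h1 := hnorm x hx
        rw [norm_mul, RCLike.norm_of_nonneg (hκ0 x).le] at h1
        calc ‖φ x‖ = ‖φ x‖ * 1 := (mul_one _).symm
          _ ≤ ‖φ x‖ * (N * κ x) := by gcongr; exact hx.2
          _ = ‖h x‖ ^ (q - 1) * N := by rw [← h1]; ring
          _ ≤ _ := by gcongr; exact hx.1
      · rw [hφ, Set.indicator_of_notMem hx, norm_zero]; positivity
    have hint : ∫ x, φ x * k x ∂μ = ((∫ x in E N, ‖h x‖ ^ q ∂μ : ℝ) : 𝕜) := by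
      rw [← integral_indicator (hEm N), ← integral_ofReal]
      refine integral_congr_ae (Eventually.of_forall fun x => ?_)
      by_cases hx : x ∈ E N
      · simp only [hφ, Set.indicator_of_mem hx]
        rw [← hhk x, show starRingEnd 𝕜 (h x) * ((‖h x‖ ^ (q - 2) : ℝ) : 𝕜) / κ x * (h x * κ x) =
          (h x * starRingEnd 𝕜 (h x)) * ((‖h x‖ ^ (q - 2) : ℝ) : 𝕜) * (κ x / κ x) by ring,
          div_self (hκne x), mul_one, RCLike.mul_conj, ← RCLike.ofReal_pow, ← RCLike.ofReal_mul]
        congr 1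
        rcases eq_or_ne ‖h x‖ 0 with h0 | h0
        · rw [h0, Real.zero_rpow hq.ne']; simp
        · rw [← Real.rpow_natCast, ← Real.rpow_add (by positivity)]; norm_num
      · simp [hφ, hx]
    set I := ∫⁻ x in E N, ‖h x‖ₑ ^ q ∂μ with hI
    have hmemφ : MemLp (fun x => φ x * κ x) (ENNReal.ofReal p) μ :=
      MemLp.of_le_mul (c := (N : ℝ) ^ (q - 1) * N) hκ (hφm.aestronglyMeasurable.mul hκ.1)
        (Eventually.of_forall fun x => by
          rw [norm_mul]; exact mul_le_mul_of_nonneg_right (hφc x) (norm_nonneg _))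
    have hnormφ : eLpNorm (fun x => φ x * κ x) (ENNReal.ofReal p) μ = I ^ (1 / p) := by
      rw [eLpNorm_eq_lintegral_rpow_enorm_toReal hpE ENNReal.ofReal_ne_top,
        ENNReal.toReal_ofReal hp.le, hI, ← lintegral_indicator (hEm N)]
      congr 1
      refine lintegral_congr fun x => ?_
      by_cases hx : x ∈ E N
      · rw [Set.indicator_of_mem hx, ← ofReal_norm, hnorm x hx, ← ofReal_norm,
          ENNReal.ofReal_rpow_of_nonneg (by positivity) hp.le,
          ENNReal.ofReal_rpow_of_nonneg (by positivity) hq.le, ← Real.rpow_mul (norm_nonneg _),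
          hpq.symm.sub_one_mul_conj]
      · simp [hφ, hx, hp]
    have hIt : I ≠ ∞ := by
      intro hcon
      have := hmemφ.2
      rw [hnormφ, hcon, ENNReal.top_rpow_of_pos (by positivity)] at this
      exact lt_irrefl _ this
    have hI2 : ∫ x in E N, ‖h x‖ ^ q ∂μ = I.toReal := by
      rw [integral_eq_lintegral_of_nonneg_ae (Eventually.of_forall fun x => by positivity)
        (hhm.norm.pow_const _).aestronglyMeasurable]
      congr 1
      refine lintegral_congr fun x => ?_
      rw [← ofReal_norm, ENNReal.ofReal_rpow_of_nonneg (norm_nonneg _) hq.le]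
    have h1 : I.toReal ≤ ‖L‖ * (I ^ (1 / p)).toReal := by
      have := norm_lift_le L hmemφ
      rwa [key hφm hφc, hint, hnormφ, hI2, RCLike.norm_of_nonneg ENNReal.toReal_nonneg] at this
    by_cases hI0 : I = 0
    · rw [hI0, ENNReal.zero_rpow_of_pos (by positivity)]; exact zero_le
    have h2 : I ≤ ENNReal.ofReal ‖L‖ * I ^ (1 / p) := by
      have hpt : I ^ (1 / p) ≠ ∞ := ENNReal.rpow_ne_top_of_nonneg (by positivity) hIt
      rw [← ENNReal.ofReal_toReal hIt]
      refine (ENNReal.ofReal_le_ofReal h1).trans ?_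
      rw [ENNReal.ofReal_mul (norm_nonneg _), ENNReal.ofReal_toReal hpt, ENNReal.ofReal_toReal hIt]
    have h3 : I = I ^ (1 / q) * I ^ (1 / p) := by
      rw [← ENNReal.rpow_add _ _ hI0 hIt, one_div, one_div, hpq.symm.inv_add_inv_eq_one,
        ENNReal.rpow_one]
    rw [h3] at h2
    have hp0 : I ^ (1 / p) ≠ 0 := (ENNReal.rpow_pos (pos_iff_ne_zero.2 hI0) hIt).ne'
    have hpt : I ^ (1 / p) ≠ ∞ := ENNReal.rpow_ne_top_of_nonneg (by positivity) hIt
    refine (ENNReal.mul_le_mul_iff_left hp0 hpt).1 (h2.trans ?_)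
    rw [← h3]
  have hmono : Monotone E := by
    intro a b hab x hx
    have hab' : (a : ℝ) ≤ b := by exact_mod_cast hab
    exact ⟨hx.1.trans hab', hx.2.trans (by have := hκ0 x; gcongr)⟩
  have hcover : ⋃ N, E N = Set.univ := by
    refine Set.eq_univ_of_forall fun x => ?_
    obtain ⟨N, hN⟩ := exists_nat_ge (max ‖h x‖ (κ x)⁻¹)
    refine Set.mem_iUnion.2 ⟨N, (le_max_left _ _).trans hN, ?_⟩
    rw [← div_le_iff₀ (hκ0 x), one_div]
    exact (le_max_right _ _).trans hN
  have hmem : MemLp h (ENNReal.ofReal q) μ := by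
    refine ⟨hhm.aestronglyMeasurable, ?_⟩
    rw [eLpNorm_eq_lintegral_rpow_enorm_toReal hqE ENNReal.ofReal_ne_top,
      ENNReal.toReal_ofReal hq.le, ← setLIntegral_univ, ← hcover,
      setLIntegral_iUnion_of_directed _ hmono.directed_le,
      (ENNReal.monotone_rpow_of_nonneg (by positivity : 0 ≤ 1 / q)).map_iSup_of_continuousAt
        ENNReal.continuous_rpow_const.continuousAt (by simp [hq])]
    exact (iSup_le hbound).trans_lt ENNReal.ofReal_lt_top
  refine ⟨h, hmem, fun g hg => ?_⟩
  rw [← lift_of_memLp L hg]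
  -- reduce to a strongly measurable representative
  wlog hgm : StronglyMeasurable g generalizing g
  · have hae := hg.1.ae_eq_mk
    have := this _ (hg.ae_eq hae) hg.1.stronglyMeasurable_mk
    rw [lift_congr L hae, this]
    refine integral_congr_ae ?_
    filter_upwards [hae] with x hx
    rw [hx]
  have hholder : (ENNReal.ofReal q).HolderConjugate (ENNReal.ofReal p) :=
    hpq.symm.ennrealOfReal
  have hinth : Integrable (fun x => h x * g x) μ := hmem.integrable_mul hg
  -- On A N the quotient g/κ is bounded, so the identity for bounded multiples of κ applies.
  set A : ℕ → Set X := fun N => {x | ‖g x‖ ≤ N * κ x}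
  have hAm : ∀ N, MeasurableSet (A N) := fun N =>
    measurableSet_le hgm.measurable.norm (hκm.const_mul _)
  have hAev : ∀ x, ∀ᶠ N : ℕ in atTop, x ∈ A N := by
    intro x
    filter_upwards [eventually_ge_atTop ⌈‖g x‖ / κ x⌉₊] with N hN
    have : ‖g x‖ / κ x ≤ N := (Nat.le_ceil _).trans (by exact_mod_cast hN)
    exact (div_le_iff₀ (hκ0 x)).1 this
  have htrunc : ∀ N, lift L ((A N).indicator g) = ∫ x, h x * (A N).indicator g x ∂μ := by
    intro N
    have e1 : (A N).indicator g = fun x => (A N).indicator (fun x => g x / κ x) x * κ x := by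
      ext x
      by_cases hx : x ∈ A N
      · simp [hx, div_mul_cancel₀ _ (hκne x)]
      · simp [hx]
    rw [e1, key (c := N) (StronglyMeasurable.indicator
      (Measurable.stronglyMeasurable (by have := hgm.measurable; fun_prop)) (hAm N))]
    · refine integral_congr_ae (Eventually.of_forall fun x => ?_)
      simp only
      rw [← hhk x]; ring
    · intro x
      by_cases hx : x ∈ A N
      · rw [Set.indicator_of_mem hx, norm_div, RCLike.norm_of_nonneg (hκ0 x).le,
          div_le_iff₀ (hκ0 x)]
        exact hx
      · simp [hx]
  have lim1 : Tendsto (fun N => lift L ((A N).indicator g)) atTop (𝓝 (lift L g)) := by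
    refine tendsto_lift L (fun N => hg.indicator (hAm N)) hg ?_
    refine tendsto_eLpNorm_zero_of_dominated hp (B := g)
      (fun N => (hg.indicator (hAm N)).1.sub hg.1) hg (fun N x => ?_) fun x => ?_
    · by_cases hx : x ∈ A N <;> simp [hx]
    · refine tendsto_const_nhds.congr' ?_
      filter_upwards [hAev x] with N hx
      simp [hx]
  have lim2 : Tendsto (fun N => ∫ x, h x * (A N).indicator g x ∂μ) atTop
      (𝓝 (∫ x, h x * g x ∂μ)) := by
    refine tendsto_integral_of_dominated_convergence (fun x => ‖h x * g x‖)
      (fun N => hmem.1.mul (hg.indicator (hAm N)).1) hinth.norm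
      (fun N => Eventually.of_forall fun x => ?_) (Eventually.of_forall fun x => ?_)
    · by_cases hx : x ∈ A N <;> simp [hx]; positivity
    · refine tendsto_const_nhds.congr' ?_
      filter_upwards [hAev x] with N hx
      simp [hx]
  refine tendsto_nhds_unique lim1 ?_
  simp_rw [htrunc]
  exact lim2

end Duality

/-! ### Sparse forms on Lebesgue spaces -/

section SparseForms

variable {n : ℕ} {μ : Measure (EuclideanSpace ℝ (Fin n))} {η : ℝ≥0}
  {𝒮 : Set (Set (EuclideanSpace ℝ (Fin n)))} {F : Type*} [NormedAddCommGroup F]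

theorem avg_eq_laverage {p : ℝ} (hp : 0 < p) (f : EuclideanSpace ℝ (Fin n) → F)
    (Q : Set (EuclideanSpace ℝ (Fin n))) :
    avg μ f (ENNReal.ofReal p) Q = (⨍⁻ x in Q, ‖f x‖ₑ ^ p ∂μ) ^ (1 / p) := by
  rw [avg, eLpNorm_eq_lintegral_rpow_enorm_toReal (by simpa using hp) ENNReal.ofReal_ne_top,
    ENNReal.toReal_ofReal hp.le, setLAverage_eq']

theorem IsSparse.isSparseFamily (hn : 1 ≤ n) (hμ : IsDoubling μ) (h : IsSparse μ η 𝒮)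
    {α : Fin n → Fin 3} {𝒬 : Finset (Set (EuclideanSpace ℝ (Fin n)))}
    (h𝒬 : ∀ Q ∈ 𝒬, Q ∈ 𝒮 ∩ dyadicGrid α) :
    ∃ E, IsSparseFamily μ 𝒬 E (η : ℝ≥0∞)⁻¹ := by
  obtain ⟨E, hd, hE⟩ := h.2 α
  have hmem : ∀ Q ∈ 𝒬, Q ∈ dyadicCubes n := fun Q hQ => dyadicGrid_subset α (h𝒬 Q hQ).2
  exact ⟨E, {
    laminar := (isLaminar_dyadicGrid α).mono fun Q hQ => (h𝒬 Q hQ).2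
    measurableSet := fun Q hQ => measurableSet_of_mem_dyadicCubes (hmem Q hQ)
    ne_top := fun Q hQ => (hμ.measure_cube_lt_top hn (hmem Q hQ)).ne
    ne_zero := fun Q hQ => (hμ.measure_cube_pos (hmem Q hQ)).ne'
    disjoint := hd.subset fun Q hQ => h𝒬 Q hQ
    measurableSet_part := fun Q hQ => (hE Q (h𝒬 Q hQ)).1
    part_subset := fun Q hQ => (hE Q (h𝒬 Q hQ)).2.1
    measure_le := fun Q hQ => (hE Q (h𝒬 Q hQ)).2.2 }⟩

/-- Only cubes of one grid form a laminar family, so the sum is split over the 3^n grids and then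
into finite subsums. -/
theorem IsSparse.tsum_le (h : IsSparse μ η 𝒮) (a : Set (EuclideanSpace ℝ (Fin n)) → ℝ≥0∞)
    {B : ℝ≥0∞} (hB : ∀ (α : Fin n → Fin 3) (𝒬 : Finset (Set (EuclideanSpace ℝ (Fin n)))),
      (∀ Q ∈ 𝒬, Q ∈ 𝒮 ∩ dyadicGrid α) → ∑ Q ∈ 𝒬, a Q ≤ B) :
    ∑' Q : 𝒮, a Q ≤ 3 ^ n * B := by
  have hU : 𝒮 ⊆ ⋃ α : Fin n → Fin 3, 𝒮 ∩ dyadicGrid α := by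
    intro Q hQ
    obtain ⟨α, hα⟩ := Set.mem_iUnion.1 (h.1 hQ)
    exact Set.mem_iUnion.2 ⟨α, hQ, hα⟩
  calc ∑' Q : 𝒮, a Q ≤ ∑' Q : (⋃ α : Fin n → Fin 3, 𝒮 ∩ dyadicGrid α), a Q :=
        ENNReal.tsum_mono_subtype a hU
    _ ≤ ∑ α : Fin n → Fin 3, ∑' Q : ↥(𝒮 ∩ dyadicGrid α), a Q := ENNReal.tsum_iUnion_le a _
    _ ≤ ∑ _α : Fin n → Fin 3, B := by
        refine Finset.sum_le_sum fun α _ => ?_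
        rw [ENNReal.tsum_eq_iSup_sum]
        refine iSup_le fun t => ?_
        have := hB α (t.map (Function.Embedding.subtype _)) (fun Q hQ => by
          obtain ⟨Q', -, rfl⟩ := Finset.mem_map.1 hQ
          exact Q'.2)
        simpa using this
    _ = 3 ^ n * B := by simp

/-- The constant is chosen before μ: only the exponents, n and η enter the Carleson embeddings. -/
theorem exists_sparseForm_le (n : ℕ) (η : ℝ≥0) (hη : 0 < η) {s r p q : ℝ} (hs : 0 < s)
    (hr : 0 < r) (hpq : p.HolderConjugate q) (hsp : s < p) (hrq : r < q) :
    ∃ K : ℝ≥0, ∀ (μ : Measure (EuclideanSpace ℝ (Fin n))), 1 ≤ n → IsDoubling μ →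
      ∀ (𝒮 : Set (Set (EuclideanSpace ℝ (Fin n)))), IsSparse μ η 𝒮 →
      ∀ f g : EuclideanSpace ℝ (Fin n) → F, AEStronglyMeasurable f μ → AEStronglyMeasurable g μ →
      ∑' Q : 𝒮, avg μ f (ENNReal.ofReal s) Q * avg μ g (ENNReal.ofReal r) Q * μ Q ≤
        K * (eLpNorm f (ENNReal.ofReal p) μ * eLpNorm g (ENNReal.ofReal q) μ) := by
  have hp := hpq.pos
  have hq := hpq.symm.pos
  set a := ((η : ℝ≥0∞)⁻¹ * ENNReal.ofReal (p / (p - s)) ^ (p / s)) ^ (1 / p) with ha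
  set b := ((η : ℝ≥0∞)⁻¹ * ENNReal.ofReal (q / (q - r)) ^ (q / r)) ^ (1 / q) with hb
  have hηt : (η : ℝ≥0∞)⁻¹ ≠ ∞ := ENNReal.inv_ne_top.2 (by exact_mod_cast hη.ne')
  have hat : a ≠ ∞ := ENNReal.rpow_ne_top_of_nonneg (by positivity) (ENNReal.mul_ne_top hηt
    (ENNReal.rpow_ne_top_of_nonneg (by positivity) ENNReal.ofReal_ne_top))
  have hbt : b ≠ ∞ := ENNReal.rpow_ne_top_of_nonneg (by positivity) (ENNReal.mul_ne_top hηt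
    (ENNReal.rpow_ne_top_of_nonneg (by positivity) ENNReal.ofReal_ne_top))
  have hK : 3 ^ n * (a * b) ≠ ∞ := ENNReal.mul_ne_top (by simp) (ENNReal.mul_ne_top hat hbt)
  refine ⟨(3 ^ n * (a * b)).toNNReal, fun μ hn hμ 𝒮 h𝒮 f g hf hg => ?_⟩
  rw [ENNReal.coe_toNNReal hK, mul_assoc]
  refine h𝒮.tsum_le (fun Q => avg μ f (ENNReal.ofReal s) Q * avg μ g (ENNReal.ofReal r) Q * μ Q)
    fun α 𝒬 h𝒬 => ?_
  obtain ⟨E, hE⟩ := h𝒮.isSparseFamily hn hμ h𝒬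
  have := hE.sum_form_le hf.enorm hg.enorm hs hr hpq hsp hrq
  simp_rw [avg_eq_laverage hs, avg_eq_laverage hr]
  refine this.trans (le_of_eq ?_)
  rw [eLpNorm_eq_lintegral_rpow_enorm_toReal (by simpa using hp) ENNReal.ofReal_ne_top,
    eLpNorm_eq_lintegral_rpow_enorm_toReal (by simpa using hq) ENNReal.ofReal_ne_top,
    ENNReal.toReal_ofReal hp.le, ENNReal.toReal_ofReal hq.le, ← mul_assoc, ← mul_assoc,
    ENNReal.mul_rpow_of_nonneg _ _ (by positivity : 0 ≤ 1 / p),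
    ENNReal.mul_rpow_of_nonneg _ _ (by positivity : 0 ≤ 1 / q), ha, hb]
  ring

theorem tsum_avg_add_le {p : ℝ≥0∞} (hp : 1 ≤ p) {f g : EuclideanSpace ℝ (Fin n) → F}
    (hf : AEStronglyMeasurable f μ) (hg : AEStronglyMeasurable g μ)
    (b : Set (EuclideanSpace ℝ (Fin n)) → ℝ≥0∞) :
    ∑' Q : 𝒮, avg μ (f + g) p Q * b Q * μ Q ≤
      ∑' Q : 𝒮, avg μ f p Q * b Q * μ Q + ∑' Q : 𝒮, avg μ g p Q * b Q * μ Q := by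
  rw [← ENNReal.tsum_add]
  refine ENNReal.tsum_le_tsum fun Q => ?_
  rw [← add_mul, ← add_mul]
  gcongr
  have hac : (μ Q)⁻¹ • μ.restrict Q ≪ μ :=
    Measure.smul_absolutelyContinuous.trans Measure.restrict_le_self.absolutelyContinuous
  exact eLpNorm_add_le (hf.mono_ac hac) (hg.mono_ac hac) hp

end SparseForms

/-! ### The dual operator on test functions -/

section TestFunctions

variable {n : ℕ} {μ : Measure (EuclideanSpace ℝ (Fin n))} {𝕜 : Type*} [RCLike 𝕜]
  {𝒟 : Submodule 𝕜 (EuclideanSpace ℝ (Fin n) → 𝕜)}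
  {T : 𝒟 →ₗ[𝕜] (EuclideanSpace ℝ (Fin n) →ₘ[μ] 𝕜)} {C η : ℝ≥0} {q₀ : ℝ≥0∞} {s r : ℝ}

theorem one_le_ofReal {p : ℝ} (hp : 1 ≤ p) : 1 ≤ ENNReal.ofReal p := by
  rw [← ENNReal.ofReal_one]; exact ENNReal.ofReal_le_ofReal hp

/-- `h` represents the functional `g ↦ ⟨f, T g⟩` on the test functions. -/
def Represents (T : 𝒟 →ₗ[𝕜] (EuclideanSpace ℝ (Fin n) →ₘ[μ] 𝕜))
    (f h : EuclideanSpace ℝ (Fin n) → 𝕜) : Prop :=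
  ∀ g : 𝒟, ∫ x, h x * g.1 x ∂μ = ∫ x, f x * T g x ∂μ

theorem enorm_integral_mul_le {p q : ℝ} (hpq : p.HolderConjugate q)
    {h g : EuclideanSpace ℝ (Fin n) → 𝕜} (hh : AEStronglyMeasurable h μ)
    (hg : AEStronglyMeasurable g μ) :
    ‖∫ x, h x * g x ∂μ‖ₑ ≤ eLpNorm h (ENNReal.ofReal q) μ * eLpNorm g (ENNReal.ofReal p) μ := by
  have : (ENNReal.ofReal q).HolderTriple (ENNReal.ofReal p) 1 := hpq.symm.ennrealOfReal
  refine (enorm_integral_le_lintegral_enorm _).trans ?_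
  rw [← eLpNorm_one_eq_lintegral_enorm]
  exact eLpNorm_smul_le_mul_eLpNorm (φ := h) (f := g) hg hh

theorem integrable_mul_of_memLp {p q : ℝ} (hpq : p.HolderConjugate q)
    {h g : EuclideanSpace ℝ (Fin n) → 𝕜} (hh : MemLp h (ENNReal.ofReal q) μ)
    (hg : MemLp g (ENNReal.ofReal p) μ) : Integrable (fun x => h x * g x) μ := by
  have : (ENNReal.ofReal q).HolderConjugate (ENNReal.ofReal p) := hpq.symm.ennrealOfReal
  exact hh.integrable_mul hg

/-- The sparse form estimate makes g ↦ ⟨f, Tg⟩ bounded in the L^p norm on the dense space of test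
functions; its continuous extension is represented by Riesz. -/
theorem SparselyDominated.exists_represents (hn : 1 ≤ n) (hμ : IsDoubling μ)
    (h𝒟 : IsTestSpace μ 𝒟) (hr : q₀.conjExponent = ENNReal.ofReal r) (hr1 : 1 ≤ r) (hs : 1 ≤ s)
    (hη : 0 < η)
    (hT : SparselyDominated μ (ENNReal.ofReal s) q₀ C η 𝒟 T) {p q : ℝ} (hpq : p.HolderConjugate q)
    (hsp : s < p) (hrq : r < q) (f : 𝒟) :
    ∃ h : EuclideanSpace ℝ (Fin n) → 𝕜, MemLp h (ENNReal.ofReal q) μ ∧ Represents T f.1 h := by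
  have : IsLocallyFiniteMeasure μ := hμ.isLocallyFiniteMeasure
  have hp1 : 1 ≤ ENNReal.ofReal p := one_le_ofReal hpq.lt.le
  have hq1 : 1 ≤ ENNReal.ofReal q := one_le_ofReal hpq.symm.lt.le
  have : Fact (1 ≤ ENNReal.ofReal p) := ⟨hp1⟩
  obtain ⟨K, hK⟩ := exists_sparseForm_le (F := 𝕜) n η hη (by linarith : 0 < s)
    (by linarith : 0 < r) hpq hsp hrq
  have hmem : ∀ g : 𝒟, MemLp g.1 (ENNReal.ofReal p) μ :=
    fun g => h𝒟.memLp hμ hp1 ENNReal.ofReal_lt_top g.2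
  have hint : ∀ g : 𝒟, Integrable (fun x => f.1 x * T g x) μ := fun g =>
    ((hT g f).1).congr (Eventually.of_forall fun x => mul_comm _ _)
  let e : 𝒟 →ₗ[𝕜] Lp 𝕜 (ENNReal.ofReal p) μ :=
    { toFun := fun g => (hmem g).toLp g.1
      map_add' := fun g g' => MemLp.toLp_add (hmem g) (hmem g')
      map_smul' := fun c g => MemLp.toLp_const_smul c (hmem g) }
  let ℓ : 𝒟 →ₗ[𝕜] 𝕜 :=
    { toFun := fun g => ∫ x, f.1 x * T g x ∂μ
      map_add' := fun g g' => by
        rw [← integral_add (hint g) (hint g')]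
        refine integral_congr_ae ?_
        rw [map_add]
        filter_upwards [AEEqFun.coeFn_add (T g) (T g')] with x hx
        rw [hx, Pi.add_apply, mul_add]
      map_smul' := fun c g => by
        rw [RingHom.id_apply, smul_eq_mul, ← integral_const_mul]
        refine integral_congr_ae ?_
        rw [map_smul]
        filter_upwards [AEEqFun.coeFn_smul c (T g)] with x hx
        rw [hx, Pi.smul_apply, smul_eq_mul]
        ring }
  have hdense : DenseRange e := by
    intro F
    rw [Metric.mem_closure_iff]
    intro ε hε
    obtain ⟨g, hg, hge⟩ := h𝒟.exists_approx hμ hp1 ENNReal.ofReal_lt_top (Lp.memLp F)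
      (ENNReal.ofReal_pos.2 (half_pos hε))
    refine ⟨e ⟨g, hg⟩, ⟨⟨g, hg⟩, rfl⟩, ?_⟩
    have h1 : F = (Lp.memLp F).toLp F := (Lp.toLp_coeFn F (Lp.memLp F)).symm
    have h2 : edist F (e ⟨g, hg⟩) ≤ ENNReal.ofReal (ε / 2) := by
      conv_lhs => rw [h1]
      change edist _ ((hmem ⟨g, hg⟩).toLp g) ≤ _
      rw [Lp.edist_toLp_toLp]
      exact hge
    rw [edist_dist, ENNReal.ofReal_le_ofReal_iff (by positivity)] at h2
    linarith
  have hbound : ∃ c : ℝ, ∀ g, ‖ℓ g‖ ≤ c * ‖e g‖ := by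
    refine ⟨(C * (K * (eLpNorm f.1 (ENNReal.ofReal q) μ))).toReal, fun g => ?_⟩
    obtain ⟨𝒮, h𝒮, hle⟩ := (hT g f).2
    rw [hr] at hle
    have hf : MemLp f.1 (ENNReal.ofReal q) μ := h𝒟.memLp hμ hq1 ENNReal.ofReal_lt_top f.2
    have h1 : ‖ℓ g‖ₑ ≤ (C * (K * eLpNorm f.1 (ENNReal.ofReal q) μ)) *
        eLpNorm g.1 (ENNReal.ofReal p) μ := by
      have : ℓ g = ∫ x, T g x * f.1 x ∂μ :=
        integral_congr_ae (Eventually.of_forall fun x => mul_comm _ _)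
      rw [this]
      refine hle.trans ?_
      calc _ ≤ C * (K * (eLpNorm g.1 (ENNReal.ofReal p) μ * eLpNorm f.1 (ENNReal.ofReal q) μ)) := by
            gcongr
            exact hK μ hn hμ 𝒮 h𝒮 g.1 f.1 (hmem g).1 hf.1
        _ = _ := by ring
    have h2 : ‖e g‖ = (eLpNorm g.1 (ENNReal.ofReal p) μ).toReal := Lp.norm_toLp _ (hmem g)
    rw [h2, ← ENNReal.toReal_mul, ← toReal_enorm]
    refine ENNReal.toReal_mono ?_ h1
    exact ENNReal.mul_ne_top (ENNReal.mul_ne_top ENNReal.coe_ne_top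
      (ENNReal.mul_ne_top ENNReal.coe_ne_top hf.2.ne)) (hmem g).2.ne
  obtain ⟨h, hh, hrep⟩ := exists_memLp_eq_integral hpq (ℓ.extendOfNorm e)
  refine ⟨h, hh, fun g => ?_⟩
  rw [← hrep g.1 (hmem g)]
  exact LinearMap.extendOfNorm_eq hdense hbound g

theorem IsTestSpace.exists_approx_pair (h𝒟 : IsTestSpace μ 𝒟) (hn : 1 ≤ n) (hμ : IsDoubling μ)
    {p q : ℝ} (hp : 1 ≤ p) (hq : 1 ≤ q) {F : EuclideanSpace ℝ (Fin n) → 𝕜}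
    (hF : AEStronglyMeasurable F μ) {R C : ℝ} (hR : ∀ x, F x ≠ 0 → ‖x‖ ≤ R)
    (hC : ∀ x, ‖F x‖ ≤ C) {ε : ℝ≥0∞} (hε : 0 < ε) :
    ∃ f ∈ 𝒟, eLpNorm (F - f) (ENNReal.ofReal p) μ ≤ ε ∧
      eLpNorm (F - f) (ENNReal.ofReal q) μ ≤ ε := by
  rcases lt_trichotomy p q with h | rfl | h
  · exact h𝒟.exists_approx_two hn hμ hp h hF hR hC hε
  · obtain ⟨f, hf, h1, -⟩ := h𝒟.exists_approx_two hn hμ hp (lt_add_one p) hF hR hC hε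
    exact ⟨f, hf, h1, h1⟩
  · obtain ⟨f, hf, h1, h2⟩ := h𝒟.exists_approx_two hn hμ hq h hF hR hC hε
    exact ⟨f, hf, h2, h1⟩

/-- The two exponents may differ, so the difference lies in no single Lebesgue space. It is tested
against its own conjugate sign cut to a ball, a bounded function with bounded support, which test
functions approximate in both dual norms at once. -/
theorem Represents.ae_eq (hn : 1 ≤ n) (hμ : IsDoubling μ) (h𝒟 : IsTestSpace μ 𝒟) {p q p' q' : ℝ}
    (hpq : p.HolderConjugate q) (hpq' : p'.HolderConjugate q')
    {f h h' : EuclideanSpace ℝ (Fin n) → 𝕜} (hh : MemLp h (ENNReal.ofReal q) μ)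
    (hh' : MemLp h' (ENNReal.ofReal q') μ) (hrep : Represents T f h) (hrep' : Represents T f h') :
    h =ᵐ[μ] h' := by
  have : IsLocallyFiniteMeasure μ := hμ.isLocallyFiniteMeasure
  set d := h - h' with hd
  obtain ⟨d', hd'm, hdd'⟩ : AEStronglyMeasurable d μ := hh.1.sub hh'.1
  suffices hsuff : ∀ N : ℕ, ∀ᵐ x ∂μ, x ∈ Metric.ball (0 : EuclideanSpace ℝ (Fin n)) N → d' x = 0 by
    filter_upwards [ae_all_iff.2 hsuff, hdd'] with x hx hx'
    obtain ⟨N, hN⟩ := exists_nat_gt ‖x‖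
    have h1 := hx N (by simpa using hN)
    rw [← hx', hd, Pi.sub_apply] at h1
    exact sub_eq_zero.1 h1
  intro N
  set B := Metric.ball (0 : EuclideanSpace ℝ (Fin n)) N
  have hBm : MeasurableSet B := Metric.isOpen_ball.measurableSet
  set F : EuclideanSpace ℝ (Fin n) → 𝕜 := B.indicator
    fun x => starRingEnd 𝕜 (d' x) * ((‖d' x‖⁻¹ : ℝ) : 𝕜) with hF
  have hFm : AEStronglyMeasurable F μ := by
    refine AEStronglyMeasurable.indicator ?_ hBm
    have h1 := RCLike.continuous_conj.comp_stronglyMeasurable hd'm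
    have h2 : Measurable fun x => ((‖d' x‖⁻¹ : ℝ) : 𝕜) :=
      RCLike.measurable_ofReal.comp hd'm.measurable.norm.inv
    exact (h1.measurable.mul h2).aestronglyMeasurable
  have hFn : ∀ x, ‖F x‖ ≤ 1 := by
    intro x
    by_cases hx : x ∈ B
    · rw [hF, Set.indicator_of_mem hx, norm_mul, RCLike.norm_conj,
        RCLike.norm_of_nonneg (by positivity)]
      exact mul_inv_le_one
    · simp [hF, hx]
  have hFs : ∀ x, F x ≠ 0 → ‖x‖ ≤ N := by
    intro x hx
    have : x ∈ B := by
      by_contra h; exact hx (by simp [hF, h])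
    exact (by simpa [B] using this : ‖x‖ < N).le
  have hFp : ∀ t : ℝ, 0 < t → MemLp F (ENNReal.ofReal t) μ := by
    intro t ht
    have : F = B.indicator F := by rw [hF, Set.indicator_indicator, Set.inter_self]
    rw [this, memLp_indicator_iff_restrict hBm]
    have hfin : IsFiniteMeasure (μ.restrict B) := by
      refine ⟨?_⟩
      rw [Measure.restrict_apply_univ]
      exact (measure_mono (Metric.ball_subset_ball (lt_add_one _).le)).trans_lt
        (hμ.finite 0 ((N : ℝ) + 1) (by positivity))
    exact MemLp.of_bound hFm.restrict 1 (Eventually.of_forall hFn)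
  have hzero : ∫ x, h x * F x ∂μ - ∫ x, h' x * F x ∂μ = 0 := by
    rw [← enorm_eq_zero]
    refine le_antisymm (ENNReal.le_of_forall_pos_le_add fun ε hε _ => ?_) zero_le
    set S := eLpNorm h (ENNReal.ofReal q) μ + eLpNorm h' (ENNReal.ofReal q') μ + 1 with hS
    have hSt : S ≠ ∞ := by simp [hS, hh.2.ne, hh'.2.ne]
    have hS0 : S ≠ 0 := by simp [hS]
    obtain ⟨g, hg, hg1, hg2⟩ := h𝒟.exists_approx_pair hn hμ hpq.lt.le hpq'.lt.le hFm hFs hFn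
      (ε := ε / S) (ENNReal.div_pos (by exact_mod_cast hε.ne') hSt)
    have hgp : ∀ t : ℝ, 1 ≤ t → MemLp g (ENNReal.ofReal t) μ := fun t ht =>
      h𝒟.memLp hμ (one_le_ofReal ht) ENNReal.ofReal_lt_top hg
    have e1 : ∀ {u : EuclideanSpace ℝ (Fin n) → 𝕜} {a b : ℝ}, a.HolderConjugate b →
        MemLp u (ENNReal.ofReal b) μ →
        ∫ x, u x * F x ∂μ = ∫ x, u x * (F - g) x ∂μ + ∫ x, u x * g x ∂μ := by
      intro u a b hab hu
      rw [← integral_add (integrable_mul_of_memLp hab hu ((hFp a hab.pos).sub (hgp a hab.lt.le)))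
        (integrable_mul_of_memLp hab hu (hgp a hab.lt.le))]
      congr 1
      ext x
      simp only [Pi.sub_apply]
      ring
    rw [e1 hpq hh, e1 hpq' hh', hrep ⟨g, hg⟩, hrep' ⟨g, hg⟩, add_sub_add_right_eq_sub, zero_add]
    calc _ ≤ ‖∫ x, h x * (F - g) x ∂μ‖ₑ + ‖∫ x, h' x * (F - g) x ∂μ‖ₑ := enorm_sub_le
      _ ≤ eLpNorm h (ENNReal.ofReal q) μ * (ε / S) +
          eLpNorm h' (ENNReal.ofReal q') μ * (ε / S) := by
          gcongr
          · exact (enorm_integral_mul_le hpq hh.1 (hFm.sub (hgp 1 le_rfl).1)).trans (by gcongr)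
          · exact (enorm_integral_mul_le hpq' hh'.1 (hFm.sub (hgp 1 le_rfl).1)).trans (by gcongr)
      _ ≤ S * (ε / S) := by rw [← add_mul]; gcongr; exact le_self_add
      _ = ε := ENNReal.mul_div_cancel hS0 hSt
  have hint : Integrable (fun x => d x * F x) μ := by
    have := (integrable_mul_of_memLp hpq hh (hFp p hpq.pos)).sub
      (integrable_mul_of_memLp hpq' hh' (hFp p' hpq'.pos))
    refine this.congr (Eventually.of_forall fun x => ?_)
    simp [hd, sub_mul]
  have hdF : (fun x => d x * F x) =ᵐ[μ] fun x => ((B.indicator (fun x => ‖d' x‖) x : ℝ) : 𝕜) := by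
    filter_upwards [hdd'] with x hx
    by_cases hxB : x ∈ B
    · rw [hF, Set.indicator_of_mem hxB, Set.indicator_of_mem hxB, hx, ← mul_assoc, RCLike.mul_conj]
      rcases eq_or_ne ‖d' x‖ 0 with h0 | h0
      · simp [h0]
      · rw [← RCLike.ofReal_pow, ← RCLike.ofReal_mul]
        congr 1
        field_simp
    · simp [hF, hxB]
  have hzero' : ∫ x, B.indicator (fun x => ‖d' x‖) x ∂μ = 0 := by
    have h1 : ∫ x, d x * F x ∂μ = 0 := by
      rw [← hzero, ← integral_sub (integrable_mul_of_memLp hpq hh (hFp p hpq.pos))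
        (integrable_mul_of_memLp hpq' hh' (hFp p' hpq'.pos))]
      congr 1
      ext x
      simp [hd, sub_mul]
    rw [integral_congr_ae hdF, integral_ofReal] at h1
    exact_mod_cast h1
  have hnn : 0 ≤ᵐ[μ] B.indicator fun x => ‖d' x‖ :=
    Eventually.of_forall fun x => Set.indicator_nonneg (fun _ _ => norm_nonneg _) x
  have hint' : Integrable (B.indicator fun x => ‖d' x‖) μ := by
    have := (hint.congr hdF).re
    simpa using this
  filter_upwards [(integral_eq_zero_iff_of_nonneg_ae hnn hint').1 hzero'] with x hx hxB
  simpa [Set.indicator_of_mem hxB] using hx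

/-- The pairing of `T* f` with a function in `L^p` is controlled by sparse forms. -/
theorem Represents.enorm_integral_le (hn : 1 ≤ n) (hμ : IsDoubling μ)
    (h𝒟 : IsTestSpace μ 𝒟) (hr : q₀.conjExponent = ENNReal.ofReal r) (hr1 : 1 ≤ r) (hs : 1 ≤ s)
    (hη : 0 < η)
    (hT : SparselyDominated μ (ENNReal.ofReal s) q₀ C η 𝒟 T) {p q : ℝ} (hpq : p.HolderConjugate q)
    (hsp : s < p) (hrq : r < q) (f : 𝒟) {h : EuclideanSpace ℝ (Fin n) → 𝕜}
    (hh : MemLp h (ENNReal.ofReal q) μ) (hrep : Represents T f.1 h)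
    {g : EuclideanSpace ℝ (Fin n) → 𝕜} (hg : MemLp g (ENNReal.ofReal p) μ) {B : ℝ≥0∞}
    (hB : ∀ 𝒮, IsSparse μ η 𝒮 → ∑' Q : 𝒮, avg μ g (ENNReal.ofReal s) Q *
      avg μ f.1 (ENNReal.ofReal r) Q * μ Q ≤ B) :
    ‖∫ x, h x * g x ∂μ‖ₑ ≤ C * B := by
  have hp1 : 1 ≤ ENNReal.ofReal p := one_le_ofReal hpq.lt.le
  have hq1 : 1 ≤ ENNReal.ofReal q := one_le_ofReal hpq.symm.lt.le
  obtain ⟨K, hK⟩ := exists_sparseForm_le (F := 𝕜) n η hη (by linarith : 0 < s)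
    (by linarith : 0 < r) hpq hsp hrq
  have hf : MemLp f.1 (ENNReal.ofReal q) μ := h𝒟.memLp hμ hq1 ENNReal.ofReal_lt_top f.2
  refine ENNReal.le_of_forall_pos_le_add fun ε hε _ => ?_
  set S := eLpNorm h (ENNReal.ofReal q) μ + C * (K * eLpNorm f.1 (ENNReal.ofReal q) μ) + 1 with hS
  have hSt : S ≠ ∞ := by
    have : C * (K * eLpNorm f.1 (ENNReal.ofReal q) μ) ≠ ∞ :=
      ENNReal.mul_ne_top ENNReal.coe_ne_top (ENNReal.mul_ne_top ENNReal.coe_ne_top hf.2.ne)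
    exact ENNReal.add_ne_top.2 ⟨ENNReal.add_ne_top.2 ⟨hh.2.ne, this⟩, ENNReal.one_ne_top⟩
  have hS0 : S ≠ 0 := by simp [hS]
  obtain ⟨g', hg', hgg'⟩ := h𝒟.exists_approx hμ hp1 ENNReal.ofReal_lt_top hg (ε := ε / S)
    (ENNReal.div_pos (by exact_mod_cast hε.ne') hSt)
  have hg'm : MemLp g' (ENNReal.ofReal p) μ := h𝒟.memLp hμ hp1 ENNReal.ofReal_lt_top hg'
  have hgg'2 : eLpNorm (g' - g) (ENNReal.ofReal p) μ ≤ ε / S := by rwa [eLpNorm_sub_comm]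
  have e1 : ∫ x, h x * g x ∂μ = ∫ x, h x * (g - g') x ∂μ + ∫ x, T ⟨g', hg'⟩ x * f.1 x ∂μ := by
    have : ∫ x, T ⟨g', hg'⟩ x * f.1 x ∂μ = ∫ x, h x * g' x ∂μ := by
      rw [hrep ⟨g', hg'⟩]
      exact integral_congr_ae (Eventually.of_forall fun x => mul_comm _ _)
    rw [this, ← integral_add (integrable_mul_of_memLp hpq hh (hg.sub hg'm))
      (integrable_mul_of_memLp hpq hh hg'm)]
    congr 1
    ext x
    simp only [Pi.sub_apply]
    ring
  -- The sparse family depends on the approximant g', which is why the bound B is required for every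
  -- sparse family.
  obtain ⟨𝒮, h𝒮, hle⟩ := (hT ⟨g', hg'⟩ f).2
  rw [hr] at hle
  have h2 : ‖∫ x, T ⟨g', hg'⟩ x * f.1 x ∂μ‖ₑ ≤
      C * (B + K * (ε / S * eLpNorm f.1 (ENNReal.ofReal q) μ)) := by
    refine hle.trans ?_
    gcongr
    have : g' = g + (g' - g) := by abel
    simp only
    rw [this]
    refine (tsum_avg_add_le (one_le_ofReal hs) hg.1 (hg'm.sub hg).1 _).trans ?_
    gcongr
    · exact hB 𝒮 h𝒮
    · refine (hK μ hn hμ 𝒮 h𝒮 _ f.1 (hg'm.sub hg).1 hf.1).trans ?_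
      gcongr
  calc ‖∫ x, h x * g x ∂μ‖ₑ ≤ ‖∫ x, h x * (g - g') x ∂μ‖ₑ +
        ‖∫ x, T ⟨g', hg'⟩ x * f.1 x ∂μ‖ₑ := by rw [e1]; exact enorm_add_le _ _
    _ ≤ eLpNorm h (ENNReal.ofReal q) μ * (ε / S) +
        C * (B + K * (ε / S * eLpNorm f.1 (ENNReal.ofReal q) μ)) := by
        gcongr
        exact (enorm_integral_mul_le hpq hh.1 (hg.sub hg'm).1).trans (by gcongr)
    _ = C * B + (eLpNorm h (ENNReal.ofReal q) μ +
        C * (K * eLpNorm f.1 (ENNReal.ofReal q) μ)) * (ε / S) := by ring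
    _ ≤ C * B + S * (ε / S) := by gcongr; exact le_self_add
    _ = C * B + ε := by rw [ENNReal.mul_div_cancel hS0 hSt]

end TestFunctions

/-! ### The weak type estimate on test functions -/

section WeakType

/-- Absorption: divide by y^{1/p}, which is legitimate because y is finite, and raise to the power
q. -/
theorem le_rpow_mul_of_le_mul_rpow {p q : ℝ} (hpq : p.HolderConjugate q) {X y Z : ℝ≥0∞}
    (hy : y ≠ ∞) (h : y ≤ X * (y ^ (1 / p) * Z ^ (1 / q))) : y ≤ X ^ q * Z := by
  have hp := hpq.pos
  have hq := hpq.symm.pos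
  rcases eq_or_ne y 0 with rfl | hy0
  · exact zero_le
  have hsplit : y = y ^ (1 / p) * y ^ (1 / q) := by
    rw [← ENNReal.rpow_add _ _ hy0 hy, one_div, one_div, hpq.inv_add_inv_eq_one, ENNReal.rpow_one]
  have h1 : y ^ (1 / p) ≠ 0 := by simp [hy0, hy]
  have h2 : y ^ (1 / p) ≠ ∞ := ENNReal.rpow_ne_top_of_nonneg (by positivity) hy
  have h3 : y ^ (1 / q) ≤ X * Z ^ (1 / q) := by
    rw [← ENNReal.mul_le_mul_iff_right h1 h2, ← hsplit]
    calc y ≤ _ := h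
      _ = _ := by ring
  calc y = (y ^ (1 / q)) ^ q := by
        rw [← ENNReal.rpow_mul, one_div_mul_cancel hq.ne', ENNReal.rpow_one]
    _ ≤ (X * Z ^ (1 / q)) ^ q := by gcongr
    _ = X ^ q * Z := by
        rw [ENNReal.mul_rpow_of_nonneg _ _ hq.le, ← ENNReal.rpow_mul, one_div_mul_cancel hq.ne',
          ENNReal.rpow_one]

/-- The gap between the exponents, which limits the room for perturbing them. -/
noncomputable def exponentGap (s r : ℝ) : ℝ := min (1 / (2 * r)) ((1 / s - (1 - 1 / r)) / 2)

/-- An upper bound for the norm of the maximal operator at the perturbed exponents. -/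
noncomputable def maximalBound (s r : ℝ) : ℝ := (1 - s * ((1 - 1 / r + 1 / s) / 2))⁻¹

/-- Take 1/q = 1/r - δ and 1/p = 1 - 1/r + δ. The bound δ ≤ 1/(2r) gives q ≤ 2r and δq ≤ 1. The
other bound keeps 1/p below the midpoint of 1 - 1/r and 1/s, so p/(p-s) stays bounded uniformly in
L. -/
theorem exists_exponents {s r L : ℝ} (hs : 1 ≤ s) (hr : 1 ≤ r) (hsr : 1 - 1 / r < 1 / s)
    (hL : 1 ≤ L) :
    ∃ p q δ : ℝ, p.HolderConjugate q ∧ δ = exponentGap s r / L ∧ 0 < δ ∧ 1 / r = 1 / q + δ ∧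
      δ * q ≤ 1 ∧ s < p ∧ r < q ∧ q ≤ 2 * r ∧ 1 ≤ p / (p - s) ∧
      p / (p - s) ≤ maximalBound s r := by
  have hs0 : 0 < s := by linarith
  have hr0 : 0 < r := by linarith
  have hgap : 0 < exponentGap s r := by
    refine lt_min (by positivity) ?_
    linarith
  set δ := exponentGap s r / L with hδ
  have hδ0 : 0 < δ := by positivity
  have hδg : δ ≤ exponentGap s r := div_le_self hgap.le hL
  have hδ1 : δ ≤ 1 / (2 * r) := hδg.trans (min_le_left _ _)
  have hδ2 : δ ≤ (1 / s - (1 - 1 / r)) / 2 := hδg.trans (min_le_right _ _)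
  have hr2 : 1 / (2 * r) = 1 / r / 2 := by field_simp
  have hr1 : 1 / r ≤ 1 := by rw [div_le_one hr0]; exact hr
  have hri : 0 < 1 / r := by positivity
  have hsi : 0 < 1 / s := by positivity
  set a := 1 - 1 / r + δ with ha
  set b := 1 / r - δ with hb
  have ha0 : 0 < a := by linarith
  have hb0 : 0 < b := by linarith
  have has : a < 1 / s := by linarith
  have hpq : (1 / a).HolderConjugate (1 / b) := by
    rw [Real.holderConjugate_iff]
    refine ⟨?_, ?_⟩
    · rw [lt_div_iff₀ ha0]; linarith
    · simp only [one_div, inv_inv]; linarith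
  have hbq : 1 / b ≤ 2 * r := by
    rw [div_le_iff₀ hb0]
    have : 2 * r * (1 / (2 * r)) = 1 := by field_simp
    nlinarith
  have hsa : s * a < 1 := by
    calc s * a < s * (1 / s) := by gcongr
      _ = 1 := by field_simp
  have hfrac : 1 / a / (1 / a - s) = (1 - s * a)⁻¹ := by
    have : 1 / a - s = (1 - s * a) / a := by field_simp
    rw [this]
    field_simp
  refine ⟨1 / a, 1 / b, δ, hpq, rfl, hδ0, ?_, ?_, ?_, ?_, hbq, ?_, ?_⟩
  · rw [one_div_one_div]; linarith
  · rw [mul_one_div, div_le_one hb0]; linarith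
  · rw [lt_div_iff₀ ha0]; exact hsa
  · rw [lt_div_iff₀ hb0]
    have : r * (1 / r) = 1 := by field_simp
    nlinarith
  · rw [hfrac]
    refine (one_le_inv₀ (by linarith)).2 ?_
    have := mul_pos hs0 ha0
    linarith
  · rw [hfrac, maximalBound]
    have h1 : s * ((1 - 1 / r + 1 / s) / 2) < 1 := by
      calc s * ((1 - 1 / r + 1 / s) / 2) < s * (1 / s) :=
          mul_lt_mul_of_pos_left (by linarith) hs0
        _ = 1 := by field_simp
    refine inv_anti₀ (by linarith) ?_
    have : s * a ≤ s * ((1 - 1 / r + 1 / s) / 2) := by gcongr; linarith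
    linarith

variable {n : ℕ} {μ : Measure (EuclideanSpace ℝ (Fin n))} {w : EuclideanSpace ℝ (Fin n) → ℝ}
  {D C η : ℝ≥0}

/-- A cube with W(Q) < ∫_Q H lies in the bad set, where g vanishes, so its term is zero. The
remaining cubes satisfy the hypothesis F ≤ W of the weighted form estimate. -/
theorem IsSparse.tsum_weighted_le {F : Type*} [NormedAddCommGroup F]
    {𝒮 : Set (Set (EuclideanSpace ℝ (Fin n)))} (hn : 1 ≤ n) (hμ : IsDoubling μ)
    (hD : DoublingWith μ D) (hw : IsA1 μ w) (h : IsSparse μ η 𝒮) {s r p q δ : ℝ} (hs : 0 < s)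
    (hr : 0 < r) (hpq : p.HolderConjugate q) (hsp : s < p) (hδ : 0 < δ) (hrq : 1 / r = 1 / q + δ)
    (hδq : δ * q ≤ 1) {f g : EuclideanSpace ℝ (Fin n) → F} {G : Set (EuclideanSpace ℝ (Fin n))}
    (hG : MeasurableSet G) (hGb : Disjoint G (badSet μ w fun x => ‖f x‖ₑ ^ r))
    (hg : ∀ x, ‖g x‖ₑ = G.indicator (fun x => ENNReal.ofReal (w x) ^ (1 - 1 / r)) x) :
    ∑' Q : 𝒮, avg μ g (ENNReal.ofReal s) Q * avg μ f (ENNReal.ofReal r) Q * μ Q ≤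
      3 ^ n * (((D : ℝ≥0∞) ^ (2 * n + 6) * A1Const μ w) ^ δ *
        (((η : ℝ≥0∞)⁻¹ * (ENNReal.ofReal (p / (p - s)) ^ (p / s) * weightMeasure μ w G)) ^ (1 / p) *
        (ENNReal.ofReal (4 / (δ * q)) * ((D : ℝ≥0∞) ^ (n + 1) * (η : ℝ≥0∞)⁻¹ * AInftyConst μ w) *
          ∫⁻ x, ‖f x‖ₑ ^ r ∂μ) ^ (1 / q))) := by
  set H : EuclideanSpace ℝ (Fin n) → ℝ≥0∞ := fun x => ‖f x‖ₑ ^ r with hH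
  refine h.tsum_le (fun Q => avg μ g (ENNReal.ofReal s) Q * avg μ f (ENNReal.ofReal r) Q * μ Q)
    fun α 𝒬 h𝒬 => ?_
  classical
  set 𝒬' := 𝒬.filter fun Q => ∫⁻ x in Q, H x ∂μ ≤ weightMeasure μ w (cubeBall Q) with h𝒬'
  have hsub : ∀ Q ∈ 𝒬', Q ∈ 𝒬 := fun Q hQ => (Finset.mem_filter.1 hQ).1
  have hcube : ∀ Q ∈ 𝒬', Q ∈ dyadicCubes n := fun Q hQ =>
    dyadicGrid_subset α (h𝒬 Q (hsub Q hQ)).2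
  obtain ⟨E, hE⟩ := h.isSparseFamily hn hμ (fun Q hQ => h𝒬 Q (hsub Q hQ))
  have hzero : ∀ Q ∈ 𝒬, Q ∉ 𝒬' →
      avg μ g (ENNReal.ofReal s) Q * avg μ f (ENNReal.ofReal r) Q * μ Q = 0 := by
    intro Q hQ hQ'
    have hlt : weightMeasure μ w (cubeBall Q) < ∫⁻ x in Q, H x ∂μ := by
      by_contra hle
      exact hQ' (Finset.mem_filter.2 ⟨hQ, not_lt.1 hle⟩)
    have hQb : Q ⊆ badSet μ w H := fun x hx => by
      simp only [badSet, Set.mem_iUnion]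
      exact ⟨α, Q, ⟨(h𝒬 Q hQ).2, hlt⟩, hx⟩
    have hmeas := measurableSet_of_mem_dyadicCubes (dyadicGrid_subset α (h𝒬 Q hQ).2)
    have h0 : ∫⁻ x in Q, ‖g x‖ₑ ^ s ∂μ = 0 := by
      rw [← lintegral_zero (μ := μ.restrict Q)]
      refine setLIntegral_congr_fun hmeas fun x hx => ?_
      have : x ∉ G := fun hxG => Set.disjoint_left.1 hGb hxG (hQb hx)
      simp [hg, this, hs]
    rw [avg_eq_laverage hs, setLAverage_eq, h0]
    simp [hs]
  rw [← Finset.sum_subset (Finset.filter_subset _ 𝒬) hzero]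
  have key := hE.sum_weighted_form_le (w := fun x => ENNReal.ofReal (w x)) (H := H) (G := G)
    (ENNReal.measurable_ofReal.comp hw.1.1) (fun x => by simpa using hw.1.2 x)
    (fun x => ENNReal.ofReal_ne_top) hG
    (W := fun Q => weightMeasure μ w (cubeBall Q))
    (fun Q _ => hμ.weightMeasure_ball_pos hw.1 _ (cubeBall_radius_pos hn Q))
    (fun Q _ => (hμ.weightMeasure_ball_lt_top hn hw _ _).ne)
    (fun Q hQ => (Finset.mem_filter.1 hQ).2)
    (fun R hR => hE.packing hn hμ hD hw hcube R hR)
    (fun Q hQ => hμ.ae_cubeBall_avg_le hn hD hw.1 (hcube Q hQ)) hs hpq hsp hδ hrq hδq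
  rw [weightMeasure_apply hG]
  refine le_trans (le_of_eq ?_) key
  refine Finset.sum_congr rfl fun Q _ => ?_
  rw [avg_eq_laverage hs, avg_eq_laverage hr]
  simp_rw [hg]
  rfl

/-- The constant in the weak type estimate. -/
noncomputable def weakTypeConst (n : ℕ) (D C η : ℝ≥0) (s r : ℝ) : ℝ≥0∞ :=
  (((C : ℝ≥0∞) + 1) * 3 ^ n * ((D : ℝ≥0∞) ^ (2 * n + 6) * ENNReal.ofReal (Real.exp 1)) *
    (η : ℝ≥0∞)⁻¹ * ENNReal.ofReal (maximalBound s r)) ^ (2 * r) *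
  (ENNReal.ofReal (4 / exponentGap s r) * ((D : ℝ≥0∞) ^ (n + 1) * (η : ℝ≥0∞)⁻¹)) + 3 ^ n

theorem weakTypeConst_ne_top {s r : ℝ} (hr : 0 ≤ r) (hη : 0 < η) :
    weakTypeConst n D C η s r ≠ ∞ := by
  have hη' : (η : ℝ≥0∞)⁻¹ ≠ ∞ := ENNReal.inv_ne_top.2 (by exact_mod_cast hη.ne')
  refine ENNReal.add_ne_top.2 ⟨ENNReal.mul_ne_top (ENNReal.rpow_ne_top_of_nonneg (by positivity) ?_)
    ?_, by simp⟩
  · refine ENNReal.mul_ne_top (ENNReal.mul_ne_top (ENNReal.mul_ne_top (ENNReal.mul_ne_top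
      (by simp) (by simp)) (ENNReal.mul_ne_top (by simp) (by simp))) hη') (by simp)
  · exact ENNReal.mul_ne_top (by simp) (ENNReal.mul_ne_top (by simp) hη')

theorem weakTypeConst_ne_zero {s r : ℝ} : weakTypeConst n D C η s r ≠ 0 := by
  simp [weakTypeConst]

/-- The logarithmic factor in the weak type estimate. -/
noncomputable def logFactor (μ : Measure (EuclideanSpace ℝ (Fin n)))
    (w : EuclideanSpace ℝ (Fin n) → ℝ) : ℝ :=
  Real.log (Real.exp 1 + (A1Const μ w).toReal)

theorem one_le_logFactor : 1 ≤ logFactor μ w := by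
  rw [logFactor, Real.le_log_iff_exp_le (by positivity)]
  exact le_add_of_nonneg_right ENNReal.toReal_nonneg

/-- The reason for choosing δ inversely proportional to the logarithm: x^{1/log x} = e. -/
theorem A1Const_rpow_le (hw : A1Const μ w ≠ ∞) {a : ℝ} (ha : 0 < a) (ha1 : a ≤ 1) :
    A1Const μ w ^ (a / logFactor μ w) ≤ ENNReal.ofReal (Real.exp 1) := by
  have hL : 0 < logFactor μ w := zero_lt_one.trans_le one_le_logFactor
  set x := Real.exp 1 + (A1Const μ w).toReal with hx
  have hx0 : 0 < x := by positivity
  calc A1Const μ w ^ (a / logFactor μ w) ≤ ENNReal.ofReal x ^ (a / logFactor μ w) := by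
        gcongr
        rw [← ENNReal.ofReal_toReal hw]
        exact ENNReal.ofReal_le_ofReal (le_add_of_nonneg_left (by positivity))
    _ = ENNReal.ofReal (Real.exp a) := by
        rw [ENNReal.ofReal_rpow_of_pos hx0, Real.rpow_def_of_pos hx0]
        congr 2
        change logFactor μ w * (a / logFactor μ w) = a
        field_simp
    _ ≤ ENNReal.ofReal (Real.exp 1) := ENNReal.ofReal_le_ofReal (Real.exp_le_exp.2 ha1)

theorem exponentGap_le_one {s r : ℝ} (hr : 1 ≤ r) : exponentGap s r ≤ 1 := by
  refine (min_le_left _ _).trans ?_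
  rw [div_le_one (by positivity)]
  linarith

/-- Absorbing the measure of the level set in the weak type estimate. -/
theorem le_weakTypeConst_mul (hD : 1 ≤ D) (hη : η ≤ 1) (hw : A1Const μ w ≠ ∞)
    {s r p q δ : ℝ} (hs : 1 ≤ s) (hr : 1 ≤ r) (hpq : p.HolderConjugate q)
    (hδ : δ = exponentGap s r / logFactor μ w) (hδ0 : 0 < δ) (hq2 : q ≤ 2 * r)
    (hN : 1 ≤ p / (p - s)) (hM : p / (p - s) ≤ maximalBound s r) {y I : ℝ≥0∞} (hy : y ≠ ∞)
    (h : y ≤ C * (3 ^ n * (((D : ℝ≥0∞) ^ (2 * n + 6) * A1Const μ w) ^ δ *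
        (((η : ℝ≥0∞)⁻¹ * (ENNReal.ofReal (p / (p - s)) ^ (p / s) * y)) ^ (1 / p) *
        (ENNReal.ofReal (4 / (δ * q)) * ((D : ℝ≥0∞) ^ (n + 1) * (η : ℝ≥0∞)⁻¹ * AInftyConst μ w) *
          I) ^ (1 / q))))) :
    y + 3 ^ n * (AInftyConst μ w * ENNReal.ofReal (logFactor μ w)) * I ≤
      weakTypeConst n D C η s r * (AInftyConst μ w * ENNReal.ofReal (logFactor μ w)) * I := by
  have hp := hpq.pos
  have hq := hpq.symm.pos
  have hs0 : 0 < s := by linarith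
  have hL1 : 1 ≤ logFactor μ w := one_le_logFactor
  have hL : 0 < logFactor μ w := zero_lt_one.trans_le hL1
  have hg : exponentGap s r = δ * logFactor μ w := by rw [hδ]; field_simp
  have hg0 : 0 < exponentGap s r := by rw [hg]; positivity
  have hδ1 : δ ≤ 1 := by
    rw [hδ]; exact (div_le_self hg0.le hL1).trans (exponentGap_le_one hr)
  set κ := (η : ℝ≥0∞)⁻¹ with hκ
  set N := ENNReal.ofReal (p / (p - s)) with hNdef
  have hN1 : 1 ≤ N := one_le_ofReal hN
  have hκ1 : 1 ≤ κ := ENNReal.one_le_inv.2 (by exact_mod_cast hη)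
  have hD1 : 1 ≤ (D : ℝ≥0∞) ^ (2 * n + 6) := one_le_pow₀ (by exact_mod_cast hD)
  set Z := ENNReal.ofReal (4 / (δ * q)) * ((D : ℝ≥0∞) ^ (n + 1) * κ * AInftyConst μ w) * I with hZ
  set X := ((C : ℝ≥0∞) + 1) * 3 ^ n * ((D : ℝ≥0∞) ^ (2 * n + 6) * ENNReal.ofReal (Real.exp 1)) *
    κ * ENNReal.ofReal (maximalBound s r) with hX
  -- Having C + 1 in place of C makes X at least 1, so X^q ≤ X^{2r} although q depends on the
  -- weight.
  have hX1 : 1 ≤ X := by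
    refine one_le_mul (one_le_mul (one_le_mul (one_le_mul le_add_self ?_) (one_le_mul hD1 ?_)) hκ1)
      (hN1.trans (ENNReal.ofReal_le_ofReal hM))
    · exact one_le_pow₀ (by norm_num)
    · exact one_le_ofReal (Real.one_le_exp zero_le_one)
  have h1 : y ≤ X * (y ^ (1 / p) * Z ^ (1 / q)) := by
    refine h.trans ?_
    have e1 : ((D : ℝ≥0∞) ^ (2 * n + 6) * A1Const μ w) ^ δ ≤
        (D : ℝ≥0∞) ^ (2 * n + 6) * ENNReal.ofReal (Real.exp 1) := by
      rw [ENNReal.mul_rpow_of_nonneg _ _ hδ0.le]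
      refine mul_le_mul' ?_ ?_
      · exact (ENNReal.rpow_le_rpow_of_exponent_le hD1 hδ1).trans_eq (ENNReal.rpow_one _)
      · rw [hδ]; exact A1Const_rpow_le hw hg0 (exponentGap_le_one hr)
    have e2 : (κ * (N ^ (p / s) * y)) ^ (1 / p) ≤
        κ * ENNReal.ofReal (maximalBound s r) * y ^ (1 / p) := by
      rw [ENNReal.mul_rpow_of_nonneg _ _ (by positivity : 0 ≤ 1 / p),
        ENNReal.mul_rpow_of_nonneg _ _ (by positivity : 0 ≤ 1 / p), mul_assoc]
      refine mul_le_mul' ?_ (mul_le_mul' ?_ le_rfl)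
      · refine (ENNReal.rpow_le_rpow_of_exponent_le hκ1 ?_).trans_eq (ENNReal.rpow_one _)
        rw [div_le_one hp]; exact hpq.lt.le
      · rw [← ENNReal.rpow_mul]
        calc N ^ (p / s * (1 / p)) ≤ N ^ (1 : ℝ) := by
              refine ENNReal.rpow_le_rpow_of_exponent_le hN1 ?_
              have : p / s * (1 / p) = 1 / s := by field_simp
              rw [this, div_le_one hs0]; exact hs
          _ = N := ENNReal.rpow_one _
          _ ≤ _ := ENNReal.ofReal_le_ofReal hM
    calc _ ≤ ((C : ℝ≥0∞) + 1) * (3 ^ n * (((D : ℝ≥0∞) ^ (2 * n + 6) * ENNReal.ofReal (Real.exp 1)) *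
          ((κ * ENNReal.ofReal (maximalBound s r) * y ^ (1 / p)) * Z ^ (1 / q)))) := by
          gcongr
          exact le_self_add
      _ = _ := by rw [hX]; ring
  have h2 := le_rpow_mul_of_le_mul_rpow hpq hy h1
  have h3 : X ^ q ≤ X ^ (2 * r) := ENNReal.rpow_le_rpow_of_exponent_le hX1 hq2
  -- The logarithm enters here, through 1/δ.
  have h4 : ENNReal.ofReal (4 / (δ * q)) ≤
      ENNReal.ofReal (4 / exponentGap s r) * ENNReal.ofReal (logFactor μ w) := by
    rw [← ENNReal.ofReal_mul (by positivity)]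
    refine ENNReal.ofReal_le_ofReal ?_
    have : 4 / exponentGap s r * logFactor μ w = 4 / δ := by rw [hg]; field_simp
    rw [this]
    exact div_le_div_of_nonneg_left (by norm_num) hδ0 (le_mul_of_one_le_right hδ0.le hpq.symm.lt.le)
  calc _ ≤ X ^ (2 * r) * (ENNReal.ofReal (4 / exponentGap s r) * ENNReal.ofReal (logFactor μ w) *
        ((D : ℝ≥0∞) ^ (n + 1) * κ * AInftyConst μ w) * I) +
        3 ^ n * (AInftyConst μ w * ENNReal.ofReal (logFactor μ w)) * I := by
        refine add_le_add_left (h2.trans (mul_le_mul' h3 ?_)) _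
        rw [hZ]
        gcongr
    _ = _ := by rw [weakTypeConst]; ring

end WeakType

/-! ### Testing T*f on its level sets. -/

section WeakType

variable {n : ℕ} {μ : Measure (EuclideanSpace ℝ (Fin n))} {𝕜 : Type*} [RCLike 𝕜]
  {𝒟 : Submodule 𝕜 (EuclideanSpace ℝ (Fin n) → 𝕜)}
  {T : 𝒟 →ₗ[𝕜] (EuclideanSpace ℝ (Fin n) →ₘ[μ] 𝕜)} {D C η : ℝ≥0} {q₀ : ℝ≥0∞} {s r : ℝ}
  {w : EuclideanSpace ℝ (Fin n) → ℝ}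

theorem IsDoubling.memLp_indicator (hμ : IsDoubling μ) {F : EuclideanSpace ℝ (Fin n) → 𝕜}
    (hF : Measurable F) {R M : ℝ} (hR : ∀ x, F x ≠ 0 → ‖x‖ < R) (hM : ∀ x, ‖F x‖ ≤ M)
    (p : ℝ≥0∞) : MemLp F p μ := by
  have : F = (Metric.ball 0 R).indicator F := by
    refine (Set.indicator_eq_self.2 fun x hx => ?_).symm
    simpa using hR x hx
  rw [this, memLp_indicator_iff_restrict Metric.isOpen_ball.measurableSet]
  have hfin : IsFiniteMeasure (μ.restrict (Metric.ball 0 R)) := by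
    refine ⟨?_⟩
    rw [Measure.restrict_apply_univ]
    exact (measure_mono (Metric.ball_subset_ball (le_max_left R 1))).trans_lt
      (hμ.finite 0 _ (lt_max_of_lt_right one_pos))
  exact MemLp.of_bound hF.aestronglyMeasurable M (Eventually.of_forall hM)

/-- The function testing the size of `h` on `G` against a weight. -/
noncomputable def testFun (h : EuclideanSpace ℝ (Fin n) → 𝕜) (G : Set (EuclideanSpace ℝ (Fin n)))
    (w : EuclideanSpace ℝ (Fin n) → ℝ) (a : ℝ) : EuclideanSpace ℝ (Fin n) → 𝕜 :=
  G.indicator fun x => starRingEnd 𝕜 (h x) * ((‖h x‖⁻¹ * w x ^ a : ℝ) : 𝕜)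

theorem measurable_testFun {h : EuclideanSpace ℝ (Fin n) → 𝕜} (hh : Measurable h)
    {G : Set (EuclideanSpace ℝ (Fin n))} (hG : MeasurableSet G) (hw : Measurable w) (a : ℝ) :
    Measurable (testFun h G w a) := by
  refine Measurable.indicator (Measurable.mul ?_ ?_) hG
  · exact RCLike.continuous_conj.measurable.comp hh
  · exact RCLike.measurable_ofReal.comp (hh.norm.inv.mul (hw.pow_const a))

theorem norm_testFun {h : EuclideanSpace ℝ (Fin n) → 𝕜} {G : Set (EuclideanSpace ℝ (Fin n))}
    (hw : ∀ x, 0 < w x) (hG : ∀ x ∈ G, h x ≠ 0) (a : ℝ) (x : EuclideanSpace ℝ (Fin n)) :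
    ‖testFun h G w a x‖ = G.indicator (fun x => w x ^ a) x := by
  by_cases hx : x ∈ G
  · have h0 : ‖h x‖ ≠ 0 := norm_ne_zero_iff.2 (hG x hx)
    have hwx := (hw x).le
    rw [testFun, Set.indicator_of_mem hx, Set.indicator_of_mem hx, norm_mul, RCLike.norm_conj,
      RCLike.norm_of_nonneg (by positivity), ← mul_assoc, mul_inv_cancel₀ h0, one_mul]
  · simp [testFun, hx]

theorem mul_testFun {h : EuclideanSpace ℝ (Fin n) → 𝕜} {G : Set (EuclideanSpace ℝ (Fin n))}
    (hG : ∀ x ∈ G, h x ≠ 0) (a : ℝ) (x : EuclideanSpace ℝ (Fin n)) :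
    h x * testFun h G w a x = ((G.indicator (fun x => ‖h x‖ * w x ^ a) x : ℝ) : 𝕜) := by
  by_cases hx : x ∈ G
  · have h0 : ‖h x‖ ≠ 0 := norm_ne_zero_iff.2 (hG x hx)
    rw [testFun, Set.indicator_of_mem hx, Set.indicator_of_mem hx, ← mul_assoc, RCLike.mul_conj,
      ← RCLike.ofReal_pow, ← RCLike.ofReal_mul]
    congr 1
    field_simp
  · simp [testFun, hx]

/-- On G one has w = w^{1/r} w^{1-1/r} ≤ |h| w^{1-1/r}, whose integral is the pairing of h with the
test function, a quantity controlled by sparse forms. The term with 3^n on the left reserves room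
for the bad set. -/
theorem Represents.weightMeasure_inter_le (hn : 1 ≤ n) (hμ : IsDoubling μ)
    (hD : DoublingWith μ D) (hD1 : 1 ≤ D) (h𝒟 : IsTestSpace μ 𝒟)
    (hr : q₀.conjExponent = ENNReal.ofReal r) (hr1 : 1 ≤ r) (hs : 1 ≤ s) (hη : 0 < η) (hη1 : η ≤ 1)
    (hT : SparselyDominated μ (ENNReal.ofReal s) q₀ C η 𝒟 T) (hw : IsA1 μ w)
    {p q δ : ℝ} (hpq : p.HolderConjugate q)
    (hδ : δ = exponentGap s r / logFactor μ w) (hδ0 : 0 < δ) (hrq' : 1 / r = 1 / q + δ)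
    (hδq : δ * q ≤ 1) (hsp : s < p) (hrq : r < q) (hq2 : q ≤ 2 * r)
    (hN : 1 ≤ p / (p - s)) (hM : p / (p - s) ≤ maximalBound s r)
    (f : 𝒟) {h : EuclideanSpace ℝ (Fin n) → 𝕜} (hh : MemLp h (ENNReal.ofReal q) μ)
    (hhm : Measurable h) (hrep : Represents T f.1 h) {G : Set (EuclideanSpace ℝ (Fin n))}
    (hG : MeasurableSet G) (hGb : Disjoint G (badSet μ w fun x => ‖f.1 x‖ₑ ^ r))
    {M : ℝ} (hGM : ∀ x ∈ G, ‖x‖ < M ∧ w x ≤ M) (hGh : ∀ x ∈ G, w x ^ (1 / r) < ‖h x‖) :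
    weightMeasure μ w G +
        3 ^ n * (AInftyConst μ w * ENNReal.ofReal (logFactor μ w)) * ∫⁻ x, ‖f.1 x‖ₑ ^ r ∂μ ≤
      weakTypeConst n D C η s r * (AInftyConst μ w * ENNReal.ofReal (logFactor μ w)) *
        ∫⁻ x, ‖f.1 x‖ₑ ^ r ∂μ := by
  have hr0 : 0 < r := by linarith
  have ha0 : 0 ≤ 1 - 1 / r := by
    rw [sub_nonneg, div_le_one hr0]; exact hr1
  have hh0 : ∀ x ∈ G, h x ≠ 0 := fun x hx =>
    norm_ne_zero_iff.1 ((Real.rpow_nonneg (hw.1.2 x).le _).trans_lt (hGh x hx)).ne'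
  set g := testFun h G w (1 - 1 / r) with hgdef
  have hgn := norm_testFun (h := h) hw.1.2 hh0 (1 - 1 / r)
  have hgLp : ∀ t : ℝ≥0∞, MemLp g t μ := by
    refine hμ.memLp_indicator (measurable_testFun hhm hG hw.1.1 _) (R := M)
      (M := (max M 0) ^ (1 - 1 / r)) (fun x hx => ?_) (fun x => ?_)
    · by_contra hx'
      refine hx ?_
      rw [hgdef, testFun, Set.indicator_of_notMem]
      exact fun hxG => hx' (hGM x hxG).1
    · rw [hgdef, hgn]
      by_cases hx : x ∈ G
      · rw [Set.indicator_of_mem hx]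
        exact Real.rpow_le_rpow (hw.1.2 x).le ((hGM x hx).2.trans (le_max_left _ _)) ha0
      · rw [Set.indicator_of_notMem hx]
        positivity
  have hge : ∀ x, ‖g x‖ₑ = G.indicator (fun x => ENNReal.ofReal (w x) ^ (1 - 1 / r)) x := by
    intro x
    rw [← ofReal_norm, hgdef, hgn]
    by_cases hx : x ∈ G
    · rw [Set.indicator_of_mem hx, Set.indicator_of_mem hx, ENNReal.ofReal_rpow_of_pos (hw.1.2 x)]
    · simp [hx]
  -- Finiteness, needed for the absorption, is the reason for truncating G to a ball.
  have hfin : weightMeasure μ w G ≠ ∞ := by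
    refine ((measure_mono fun x hx => ?_).trans_lt (hμ.weightMeasure_ball_lt_top hn hw 0 M)).ne
    simpa using (hGM x hx).1
  refine le_weakTypeConst_mul hD1 hη1 hw.2.ne hs hr1 hpq hδ hδ0 hq2 hN hM hfin ?_
  refine le_trans ?_ (hrep.enorm_integral_le hn hμ h𝒟 hr hr1 hs hη hT hpq hsp hrq f hh (hgLp _)
    (fun 𝒮 h𝒮 => h𝒮.tsum_weighted_le hn hμ hD hw (by linarith) hr0 hpq hsp hδ0 hrq' hδq hG hGb hge))
  set φ : EuclideanSpace ℝ (Fin n) → ℝ := G.indicator fun x => ‖h x‖ * w x ^ (1 - 1 / r) with hφ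
  have hmul : ∀ x, h x * g x = ((φ x : ℝ) : 𝕜) := mul_testFun hh0 _
  have hint : Integrable φ μ := by
    have := (integrable_mul_of_memLp hpq hh (hgLp _)).re
    simpa [hmul] using this
  have hφ0 : ∀ x, 0 ≤ φ x := fun x => Set.indicator_nonneg
    (fun x _ => mul_nonneg (norm_nonneg _) (Real.rpow_nonneg (hw.1.2 x).le _)) x
  simp_rw [hmul]
  rw [integral_ofReal, ← ofReal_norm, RCLike.norm_of_nonneg (integral_nonneg hφ0),
    ofReal_integral_eq_lintegral_ofReal hint (Eventually.of_forall hφ0), weightMeasure_apply hG,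
    ← lintegral_indicator hG]
  refine lintegral_mono fun x => ?_
  by_cases hx : x ∈ G
  · rw [Set.indicator_of_mem hx, hφ, Set.indicator_of_mem hx]
    refine ENNReal.ofReal_le_ofReal ?_
    calc w x = w x ^ (1 / r) * w x ^ (1 - 1 / r) := by
          rw [← Real.rpow_add (hw.1.2 x)]; simp
      _ ≤ ‖h x‖ * w x ^ (1 - 1 / r) := by
          gcongr
          · exact Real.rpow_nonneg (hw.1.2 x).le _
          · exact (hGh x hx).le
  · simp [hx]

/-- The level set is its part off the bad set plus a piece of the bad set; the former is exhausted
by bounded truncations. -/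
theorem Represents.weightMeasure_le (hn : 1 ≤ n) (hμ : IsDoubling μ)
    (hD : DoublingWith μ D) (hD1 : 1 ≤ D) (h𝒟 : IsTestSpace μ 𝒟)
    (hr : q₀.conjExponent = ENNReal.ofReal r) (hr1 : 1 ≤ r) (hs : 1 ≤ s) (hsr : 1 - 1 / r < 1 / s)
    (hη : 0 < η) (hη1 : η ≤ 1)
    (hT : SparselyDominated μ (ENNReal.ofReal s) q₀ C η 𝒟 T) (hw : IsA1 μ w)
    (f : 𝒟) {h : EuclideanSpace ℝ (Fin n) → 𝕜} {t t' : ℝ} (htt' : t.HolderConjugate t')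
    (hh : MemLp h (ENNReal.ofReal t') μ) (hrep : Represents T f.1 h) :
    weightMeasure μ w {x | w x ^ (1 / r) < ‖h x‖} ≤
      weakTypeConst n D C η s r * (AInftyConst μ w * ENNReal.ofReal (logFactor μ w)) *
        ∫⁻ x, ‖f.1 x‖ₑ ^ r ∂μ := by
  obtain ⟨p, q, δ, hpq, hδ, hδ0, hrq', hδq, hsp, hrq, hq2, hN, hM⟩ :=
    exists_exponents hs hr1 hsr (one_le_logFactor (μ := μ) (w := w))
  -- The exponent q depends on the weight through δ, so h is represented anew in L^q and identified
  -- with the given function by uniqueness.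
  obtain ⟨h₁, hh₁, hrep₁⟩ := hT.exists_represents hn hμ h𝒟 hr hr1 hs hη hpq hsp hrq f
  have hae₁ := hrep.ae_eq hn hμ h𝒟 htt' hpq hh hh₁ hrep₁
  set h₂ := hh₁.1.mk h₁ with hh₂def
  have hae₂ : h₁ =ᵐ[μ] h₂ := hh₁.1.ae_eq_mk
  have hh₂m : Measurable h₂ := hh₁.1.stronglyMeasurable_mk.measurable
  have hh₂ : MemLp h₂ (ENNReal.ofReal q) μ := (memLp_congr_ae hae₂).1 hh₁
  have hrep₂ : Represents T f.1 h₂ := fun g => by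
    rw [← hrep₁ g]
    refine integral_congr_ae ?_
    filter_upwards [hae₂] with x hx
    rw [hx]
  set H : EuclideanSpace ℝ (Fin n) → ℝ≥0∞ := fun x => ‖f.1 x‖ₑ ^ r with hH
  set U := {x | w x ^ (1 / r) < ‖h₂ x‖} with hU
  have hUm : MeasurableSet U := measurableSet_lt (hw.1.1.pow_const _) hh₂m.norm
  have hset : weightMeasure μ w {x | w x ^ (1 / r) < ‖h x‖} = weightMeasure μ w U := by
    refine measure_congr ((withDensity_absolutelyContinuous _ _).ae_eq ?_)
    filter_upwards [hae₁, hae₂] with x hx hx'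
    change (w x ^ (1 / r) < ‖h x‖) = (w x ^ (1 / r) < ‖h₂ x‖)
    rw [hx, hx']
  have hbad := measurableSet_badSet (μ := μ) (w := w) H
  set G : ℕ → Set (EuclideanSpace ℝ (Fin n)) := fun N =>
    (U \ badSet μ w H) ∩ (Metric.ball 0 N ∩ {x | w x ≤ N}) with hGdef
  have hGm : ∀ N, MeasurableSet (G N) := fun N => (hUm.diff hbad).inter
    (Metric.isOpen_ball.measurableSet.inter (measurableSet_le hw.1.1 measurable_const))
  have hUG : U \ badSet μ w H = ⋃ N, G N := by
    rw [hGdef, ← Set.inter_iUnion]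
    refine (Set.inter_eq_left.2 fun x _ => ?_).symm
    obtain ⟨N, hN⟩ := exists_nat_gt (max ‖x‖ (w x))
    refine Set.mem_iUnion.2 ⟨N, ?_, ?_⟩
    · simpa using (le_max_left _ _).trans_lt hN
    · exact ((le_max_right _ _).trans_lt hN).le
  have hGmono : Monotone G := fun N N' hNN' => by
    have : (N : ℝ) ≤ N' := by exact_mod_cast hNN'
    refine Set.inter_subset_inter_right _ (Set.inter_subset_inter (Metric.ball_subset_ball this) ?_)
    exact fun x (hx : w x ≤ N) => hx.trans this
  set K := AInftyConst μ w * ENNReal.ofReal (logFactor μ w) with hK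
  have hK1 : 1 ≤ K := one_le_mul (hμ.one_le_AInftyConst hn hw) (one_le_ofReal one_le_logFactor)
  have hgood : weightMeasure μ w (U \ badSet μ w H) + 3 ^ n * K * ∫⁻ x, H x ∂μ ≤
      weakTypeConst n D C η s r * K * ∫⁻ x, H x ∂μ := by
    rw [hUG, hGmono.measure_iUnion, ENNReal.iSup_add]
    refine iSup_le fun N => ?_
    refine hrep₂.weightMeasure_inter_le hn hμ hD hD1 h𝒟 hr hr1 hs hη hη1 hT hw hpq hδ hδ0 hrq'
      hδq hsp hrq hq2 hN hM f hh₂ hh₂m (hGm N) ?_ (M := N) ?_ ?_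
    · exact Set.disjoint_left.2 fun x hx => hx.1.2
    · exact fun x hx => ⟨by simpa using hx.2.1, hx.2.2⟩
    · exact fun x hx => hx.1.1
  rw [hset]
  calc weightMeasure μ w U ≤ weightMeasure μ w (U \ badSet μ w H ∪ badSet μ w H) :=
        measure_mono fun x hx => by
          by_cases hxb : x ∈ badSet μ w H
          · exact Or.inr hxb
          · exact Or.inl ⟨hx, hxb⟩
    _ ≤ weightMeasure μ w (U \ badSet μ w H) + weightMeasure μ w (badSet μ w H) :=
        measure_union_le _ _
    _ ≤ weightMeasure μ w (U \ badSet μ w H) + 3 ^ n * K * ∫⁻ x, H x ∂μ := by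
        gcongr
        refine (weightMeasure_badSet_le hn H).trans ?_
        gcongr
        exact le_mul_of_one_le_right' hK1
    _ ≤ _ := hgood

theorem Represents.const_smul {f h : EuclideanSpace ℝ (Fin n) → 𝕜} (hrep : Represents T f h)
    (c : 𝕜) : Represents T (c • f) (c • h) := fun g => by
  simp only [Pi.smul_apply, smul_eq_mul, mul_assoc, integral_const_mul, hrep g]

/-- The weak type estimate for test functions. -/
theorem Represents.weak_type (hn : 1 ≤ n) (hμ : IsDoubling μ)
    (hD : DoublingWith μ D) (hD1 : 1 ≤ D) (h𝒟 : IsTestSpace μ 𝒟)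
    (hr : q₀.conjExponent = ENNReal.ofReal r) (hr1 : 1 ≤ r) (hs : 1 ≤ s) (hsr : 1 - 1 / r < 1 / s)
    (hη : 0 < η) (hη1 : η ≤ 1)
    (hT : SparselyDominated μ (ENNReal.ofReal s) q₀ C η 𝒟 T) (hw : IsA1 μ w)
    {f h : EuclideanSpace ℝ (Fin n) → 𝕜} (hf : f ∈ 𝒟) {t t' : ℝ} (htt' : t.HolderConjugate t')
    (hh : MemLp h (ENNReal.ofReal t') μ) (hrep : Represents T f h) {a : ℝ} (ha : 0 < a) :
    weightMeasure μ w {x | a * w x ^ (1 / r) < ‖h x‖} ≤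
      weakTypeConst n D C η s r * (AInftyConst μ w * ENNReal.ofReal (logFactor μ w)) *
        ((∫⁻ x, ‖f x‖ₑ ^ r ∂μ) / ENNReal.ofReal a ^ r) := by
  have hr0 : 0 < r := by linarith
  -- The level a is scaled to 1; this uses linearity of the representation in f and h.
  set c : 𝕜 := ((a⁻¹ : ℝ) : 𝕜) with hc
  have hcn : ‖c‖ = a⁻¹ := RCLike.norm_of_nonneg (by positivity)
  have hce : ‖c‖ₑ = (ENNReal.ofReal a)⁻¹ := by
    rw [← ofReal_norm, hcn, ENNReal.ofReal_inv_of_pos ha]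
  have key := (hrep.const_smul c).weightMeasure_le hn hμ hD hD1 h𝒟 hr hr1 hs hsr hη hη1 hT hw
    ⟨c • f, 𝒟.smul_mem c hf⟩ htt' (hh.const_smul c)
  have hset : {x | a * w x ^ (1 / r) < ‖h x‖} = {x | w x ^ (1 / r) < ‖(c • h) x‖} := by
    ext x
    simp only [Set.mem_ofPred_eq, Pi.smul_apply, norm_smul, hcn]
    rw [lt_inv_mul_iff₀ ha]
  rw [hset]
  refine key.trans (le_of_eq ?_)
  congr 1
  simp only [Pi.smul_apply, enorm_smul, hce]
  simp_rw [ENNReal.mul_rpow_of_nonneg _ _ hr0.le]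
  rw [lintegral_const_mul' _ _ (ENNReal.rpow_ne_top_of_nonneg hr0.le (by simpa using ha)),
    ENNReal.inv_rpow, ENNReal.div_eq_inv_mul]

end WeakType

/-! ### Extension of operators of weak type by density -/

section Extension

variable {X : Type*} [MeasurableSpace X] {μ : Measure X} {𝕜 : Type*} [RCLike 𝕜]

/-- Fatou for level sets: where b < ‖v‖, the strict inequality holds for all large k, so the set
lies up to a null set in an increasing union of tail intersections. -/
theorem measure_lt_norm_le_of_tendsto {u : ℕ → X → 𝕜} {v : X → 𝕜} {b : X → ℝ} {c : ℕ → ℝ≥0∞}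
    {c' : ℝ≥0∞} (h : ∀ᵐ x ∂μ, Tendsto (fun k => u k x) atTop (𝓝 (v x)))
    (hc : ∀ k, μ {x | b x < ‖u k x‖} ≤ c k) (hc' : Tendsto c atTop (𝓝 c')) :
    μ {x | b x < ‖v x‖} ≤ c' := by
  set S : ℕ → Set X := fun i => ⋂ j ≥ i, {x | b x < ‖u j x‖} with hS
  have hmono : Monotone S := fun i i' hii' =>
    Set.biInter_subset_biInter_left fun j (hj : i' ≤ j) => hii'.trans hj
  have hsub : {x | b x < ‖v x‖} ≤ᵐ[μ] ⋃ i, S i := by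
    filter_upwards [h] with x hx (hbx : b x < ‖v x‖)
    obtain ⟨i, hi⟩ := eventually_atTop.1 (hx.norm.eventually_const_lt hbx)
    exact Set.mem_iUnion.2 ⟨i, Set.mem_iInter₂.2 hi⟩
  refine (measure_mono_ae hsub).trans ?_
  rw [hmono.measure_iUnion]
  refine iSup_le fun i => ge_of_tendsto hc' ?_
  filter_upwards [eventually_ge_atTop i] with j hj
  exact (measure_mono (Set.biInter_subset_of_mem hj)).trans (hc j)

theorem measure_lt_norm_add_le (u v : X → 𝕜) (a b : ℝ) :
    μ {x | a + b < ‖u x + v x‖} ≤ μ {x | a < ‖u x‖} + μ {x | b < ‖v x‖} := by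
  refine (measure_mono fun x (hx : a + b < ‖u x + v x‖) => ?_).trans (measure_union_le _ _)
  by_contra hx'
  simp only [Set.mem_union, Set.mem_ofPred_eq, not_or, not_lt] at hx'
  linarith [norm_add_le (u x) (v x), hx'.1, hx'.2]

theorem ae_eq_zero_of_measure_lt_norm {u : X → 𝕜} (h : ∀ a : ℝ, 0 < a → μ {x | a < ‖u x‖} = 0) :
    u =ᵐ[μ] 0 := by
  have : ∀ k : ℕ, ∀ᵐ x ∂μ, ‖u x‖ ≤ 1 / ((k : ℝ) + 1) := fun k => by
    have := h (1 / ((k : ℝ) + 1)) (by positivity)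
    rw [ae_iff]
    simpa only [not_le] using this
  filter_upwards [ae_all_iff.2 this] with x hx
  have := ge_of_tendsto tendsto_one_div_add_atTop_nhds_zero_nat (Eventually.of_forall hx)
  exact norm_le_zero_iff.1 this

/-- By Borel–Cantelli almost every point has increments eventually below 2^{-k}, so its sequence is
Cauchy. -/
theorem exists_ae_tendsto_of_measure_lt_le {u : ℕ → X → 𝕜}
    (hu : ∀ k, AEStronglyMeasurable (u k) μ)
    (h : ∀ k, μ {x | (1 / 2 : ℝ) ^ k < ‖u (k + 1) x - u k x‖} ≤ (1 / 2 : ℝ≥0∞) ^ k) :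
    ∃ v : X → 𝕜, StronglyMeasurable v ∧ ∀ᵐ x ∂μ, Tendsto (fun k => u k x) atTop (𝓝 (v x)) := by
  refine exists_stronglyMeasurable_limit_of_tendsto_ae hu ?_
  have hsum : ∑' k, μ {x | (1 / 2 : ℝ) ^ k < ‖u (k + 1) x - u k x‖} ≠ ∞ := by
    refine ne_top_of_le_ne_top ?_ (ENNReal.tsum_le_tsum h)
    rw [ENNReal.tsum_geometric]
    simp
  filter_upwards [ae_eventually_notMem hsum] with x hx
  refine cauchySeq_tendsto_of_complete (cauchySeq_of_summable_dist ?_)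
  refine Summable.of_norm_bounded_eventually_nat (g := fun k => (1 / 2 : ℝ) ^ k)
    (summable_geometric_of_lt_one (by norm_num) (by norm_num)) ?_
  filter_upwards [hx] with k hk
  rw [Real.norm_of_nonneg dist_nonneg, dist_comm, dist_eq_norm]
  simpa using hk

variable {E V : Type*} [NormedAddCommGroup E] [NormedSpace 𝕜 E] [AddCommGroup V] [Module 𝕜 V]
  {e : V →ₗ[𝕜] E} {S₀ : V →ₗ[𝕜] (X →ₘ[μ] 𝕜)} {Φ : ℝ → ℝ≥0∞}

/-- Images of an approximating sequence are Cauchy in measure. A fast subsequence converges a.e.,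
and the bound for differences passes to the limit by Fatou for level sets and continuity of Φ. -/
theorem exists_limit_of_weak_type (he : DenseRange e) (hΦ : Continuous Φ) (hΦ0 : Φ 0 = 0)
    (h : ∀ (v : V) (a : ℝ), 0 < a → μ {x | a < ‖S₀ v x‖} ≤ Φ (‖e v‖ / a)) (F : E) :
    ∃ G : X →ₘ[μ] 𝕜, ∀ (v : V) (a : ℝ), 0 < a →
      μ {x | a < ‖G x - S₀ v x‖} ≤ Φ (‖F - e v‖ / a) := by
  have hsub : ∀ (v v' : V) (a : ℝ), 0 < a →
      μ {x | a < ‖S₀ v x - S₀ v' x‖} ≤ Φ (‖e v - e v'‖ / a) := by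
    intro v v' a ha
    rw [← map_sub]
    refine le_trans (le_of_eq (measure_congr ?_)) (h (v - v') a ha)
    rw [map_sub]
    filter_upwards [AEEqFun.coeFn_sub (S₀ v) (S₀ v')] with x hx
    change (a < _) = (a < _)
    rw [hx, Pi.sub_apply]
  obtain ⟨g, hg⟩ : ∃ g : ℕ → V, Tendsto (fun k => e (g k)) atTop (𝓝 F) := by
    obtain ⟨y, hy, hyF⟩ := mem_closure_iff_seq_limit.1 (he F)
    choose g hg using hy
    exact ⟨g, by simpa only [hg] using hyF⟩
  have hcau : ∀ k : ℕ, ∃ N, ∀ i ≥ N, ∀ j ≥ N,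
      Φ (‖e (g i) - e (g j)‖ / (1 / 2) ^ k) ≤ (1 / 2) ^ k := by
    intro k
    have h1 : Tendsto (fun ij : ℕ × ℕ => Φ (‖e (g ij.1) - e (g ij.2)‖ / (1 / 2) ^ k))
        (atTop ×ˢ atTop) (𝓝 0) := by
      have h2 : Tendsto (fun ij : ℕ × ℕ => ‖e (g ij.1) - e (g ij.2)‖ / (1 / 2) ^ k)
          (atTop ×ˢ atTop) (𝓝 0) := by
        have := (((hg.comp tendsto_fst).sub (hg.comp tendsto_snd)).norm).div_const ((1 / 2) ^ k)
        simpa using this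
      simpa [hΦ0, Function.comp_def] using (hΦ.tendsto 0).comp h2
    have h3 := h1.eventually_le_const (u := (1 / 2 : ℝ≥0∞) ^ k)
      (ENNReal.pow_pos (by norm_num) k)
    rw [prod_atTop_atTop_eq, eventually_atTop] at h3
    obtain ⟨⟨N₁, N₂⟩, hN⟩ := h3
    exact ⟨max N₁ N₂, fun i hi j hj =>
      hN (i, j) ⟨(le_max_left _ _).trans hi, (le_max_right _ _).trans hj⟩⟩
  choose N hN using hcau
  obtain ⟨φ, hφ, hφN⟩ := extraction_forall_of_eventually
    (P := fun k m => N k ≤ m) fun k => eventually_ge_atTop (N k)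
  have hlim := (hg.comp hφ.tendsto_atTop)
  obtain ⟨G, hGm, hG⟩ := exists_ae_tendsto_of_measure_lt_le (μ := μ)
    (u := fun k => S₀ (g (φ k))) (fun k => (S₀ (g (φ k))).aestronglyMeasurable) (fun k =>
      (hsub _ _ _ (by positivity)).trans (hN k _ ((hφN k).trans (hφ (Nat.lt_succ_self k)).le) _
        (hφN k)))
  refine ⟨AEEqFun.mk G hGm.aestronglyMeasurable, fun v a ha => ?_⟩
  refine measure_lt_norm_le_of_tendsto (u := fun k x => S₀ (g (φ k)) x - S₀ v x) ?_
    (fun k => hsub (g (φ k)) v a ha) ((hΦ.tendsto _).comp ((hlim.sub_const (e v)).norm.div_const a))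
  filter_upwards [hG, AEEqFun.coeFn_mk G hGm.aestronglyMeasurable] with x hx hx'
  rw [hx']
  exact hx.sub_const _

/-- An operator of weak type on a dense subspace extends to the whole space. -/
theorem exists_extension_of_weak_type (he : DenseRange e) (hΦ : Continuous Φ) (hΦ0 : Φ 0 = 0)
    (h : ∀ (v : V) (a : ℝ), 0 < a → μ {x | a < ‖S₀ v x‖} ≤ Φ (‖e v‖ / a)) :
    ∃ S : E →ₗ[𝕜] (X →ₘ[μ] 𝕜), (∀ v, S (e v) = S₀ v) ∧
      ∀ (F : E) (a : ℝ), 0 < a → μ {x | a < ‖S F x‖} ≤ Φ (‖F‖ / a) := by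
  choose S hS using exists_limit_of_weak_type he hΦ hΦ0 h
  obtain ⟨g, hg⟩ : ∃ g : E → ℕ → V, ∀ F, Tendsto (fun k => e (g F k)) atTop (𝓝 F) := by
    have : ∀ F : E, ∃ g : ℕ → V, Tendsto (fun k => e (g k)) atTop (𝓝 F) := fun F => by
      obtain ⟨y, hy, hyF⟩ := mem_closure_iff_seq_limit.1 (he F)
      choose g hg using hy
      exact ⟨g, by simpa only [hg] using hyF⟩
    exact ⟨fun F => (this F).choose, fun F => (this F).choose_spec⟩
  have hlim : ∀ (F : E) (v : ℕ → V) (a : ℝ), 0 < a → Tendsto (fun k => e (v k)) atTop (𝓝 F) →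
      Tendsto (fun k => Φ (‖F - e (v k)‖ / a)) atTop (𝓝 0) := by
    intro F v a ha hv
    have : Tendsto (fun k => ‖F - e (v k)‖ / a) atTop (𝓝 0) := by
      simpa using ((hv.const_sub F).norm).div_const a
    simpa [hΦ0, Function.comp_def] using (hΦ.tendsto 0).comp this
  -- S F is characterised as the limit in measure of S₀ along any approximating sequence, so the
  -- arbitrary choice defining S is harmless; linearity follows from this.
  have huniq : ∀ (F : E) (v : ℕ → V) (G : X →ₘ[μ] 𝕜), Tendsto (fun k => e (v k)) atTop (𝓝 F) →
      (∀ a : ℝ, 0 < a → Tendsto (fun k => μ {x | a < ‖G x - S₀ (v k) x‖}) atTop (𝓝 0)) →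
      S F = G := by
    intro F v G hv hG
    refine AEEqFun.ext ?_
    have : (fun x => S F x - G x) =ᵐ[μ] 0 := by
      refine ae_eq_zero_of_measure_lt_norm fun a ha => ?_
      have ha2 : 0 < a / 2 := by positivity
      have h1 := (hlim F v _ ha2 hv).add (hG _ ha2)
      rw [add_zero] at h1
      refine le_antisymm (ge_of_tendsto' h1 fun k => ?_) zero_le
      have h2 := measure_lt_norm_add_le (μ := μ) (fun x => S F x - S₀ (v k) x)
        (fun x => S₀ (v k) x - G x) (a / 2) (a / 2)
      simp only [add_halves, sub_add_sub_cancel] at h2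
      refine h2.trans (add_le_add (hS F (v k) _ ha2) (le_of_eq ?_))
      simp_rw [norm_sub_rev]
    filter_upwards [this] with x hx
    exact sub_eq_zero.1 hx
  have hconv : ∀ (F : E) (a : ℝ), 0 < a →
      Tendsto (fun k => μ {x | a < ‖S F x - S₀ (g F k) x‖}) atTop (𝓝 0) := fun F a ha =>
    tendsto_of_tendsto_of_tendsto_of_le_of_le tendsto_const_nhds (hlim F (g F) a ha (hg F))
      (fun k => zero_le) (fun k => hS F (g F k) a ha)
  refine ⟨{ toFun := S, map_add' := fun F F' => ?_, map_smul' := fun c F => ?_ }, fun v => ?_,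
    fun F a ha => ?_⟩
  · refine huniq (F + F') (fun k => g F k + g F' k) _ ?_ fun a ha => ?_
    · simpa only [map_add] using (hg F).add (hg F')
    · have ha2 : 0 < a / 2 := by positivity
      have h1 := (hconv F _ ha2).add (hconv F' _ ha2)
      rw [add_zero] at h1
      refine tendsto_of_tendsto_of_tendsto_of_le_of_le tendsto_const_nhds h1
        (fun k => zero_le) (fun k => ?_)
      refine le_trans (le_of_eq (measure_congr ?_)) (measure_lt_norm_add_le (μ := μ)
        (fun x => S F x - S₀ (g F k) x) (fun x => S F' x - S₀ (g F' k) x) (a / 2) (a / 2))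
      rw [map_add]
      filter_upwards [AEEqFun.coeFn_add (S F) (S F'),
        AEEqFun.coeFn_add (S₀ (g F k)) (S₀ (g F' k))] with x hx hx'
      change (a < _) = (a / 2 + a / 2 < _)
      rw [hx, hx', Pi.add_apply, Pi.add_apply, add_halves, add_sub_add_comm]
  · refine huniq (c • F) (fun k => c • g F k) _ ?_ fun a ha => ?_
    · simpa only [map_smul] using (hg F).const_smul c
    · have hc : 0 < ‖c‖ + 1 := by positivity
      refine tendsto_of_tendsto_of_tendsto_of_le_of_le tendsto_const_nhds
        (hconv F _ (div_pos ha hc)) (fun k => zero_le) (fun k => measure_mono_ae ?_)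
      rw [RingHom.id_apply, map_smul]
      filter_upwards [AEEqFun.coeFn_smul c (S F), AEEqFun.coeFn_smul c (S₀ (g F k))]
        with x hx hx' (hax : a < _)
      change a / (‖c‖ + 1) < _
      rw [hx, hx', Pi.smul_apply, Pi.smul_apply, ← smul_sub, norm_smul] at hax
      rw [div_lt_iff₀ hc]
      nlinarith [norm_nonneg (S F x - S₀ (g F k) x)]
  · refine huniq (e v) (fun _ => v) _ tendsto_const_nhds fun a ha => ?_
    simp [not_lt.2 ha.le]
  · have h1 := hS F 0 a ha
    rw [map_zero, map_zero, sub_zero] at h1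
    refine le_trans (le_of_eq (measure_congr ?_)) h1
    filter_upwards [AEEqFun.coeFn_zero (α := X) (β := 𝕜) (μ := μ)] with x hx
    change (a < _) = (a < _)
    rw [hx, Pi.zero_apply, sub_zero]
    rfl

end Extension

/-! ### The dual operator -/

section Exponents

theorem conjExponent_ofReal {t : ℝ} (ht : 1 < t) :
    (ENNReal.ofReal t).conjExponent = ENNReal.ofReal (1 + (t - 1)⁻¹) := by
  have h : 0 < t - 1 := sub_pos.2 ht
  rw [ENNReal.conjExponent, ENNReal.ofReal_add zero_le_one (by positivity), ENNReal.ofReal_one,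
    ENNReal.ofReal_inv_of_pos h, ENNReal.ofReal_sub t zero_le_one, ENNReal.ofReal_one]

theorem holderConjugate_one_add_inv {t : ℝ} (ht : 1 < t) : t.HolderConjugate (1 + (t - 1)⁻¹) := by
  have h : 0 < t - 1 := sub_pos.2 ht
  rw [Real.holderConjugate_iff]
  refine ⟨ht, ?_⟩
  have : 1 + (t - 1)⁻¹ = t / (t - 1) := by field_simp; ring
  rw [this]
  field_simp
  ring

/-- Passes to real exponents s = p₀ and r = q₀'. Both are finite even when q₀ = ∞, in which case r =
1. The hypothesis p₀ < q₀ becomes 1 - 1/r < 1/s. -/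
theorem exists_real_exponents {p₀ q₀ : ℝ≥0∞} (hp₀ : 1 ≤ p₀) (hpq : p₀ < q₀) :
    ∃ s r : ℝ, p₀ = ENNReal.ofReal s ∧ q₀.conjExponent = ENNReal.ofReal r ∧ 1 ≤ s ∧ 1 ≤ r ∧
      1 - 1 / r < 1 / s ∧ ∀ p, p₀ < p → p < q₀ → ∃ t t' : ℝ, p.conjExponent = ENNReal.ofReal t' ∧
        t.HolderConjugate t' ∧ s < t ∧ r < t' := by
  have hp₀t : p₀ ≠ ∞ := hpq.ne_top
  obtain ⟨s, hs, rfl⟩ : ∃ s : ℝ, 1 ≤ s ∧ p₀ = ENNReal.ofReal s :=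
    ⟨p₀.toReal, by simpa using ENNReal.toReal_mono hp₀t hp₀, (ENNReal.ofReal_toReal hp₀t).symm⟩
  have hs0 : 0 < s := by linarith
  have hmid : ∀ p, ENNReal.ofReal s < p → p < q₀ → ∃ t : ℝ, s < t ∧ p = ENNReal.ofReal t := by
    intro p hp hpq₀
    refine ⟨p.toReal, ?_, (ENNReal.ofReal_toReal hpq₀.ne_top).symm⟩
    exact (ENNReal.ofReal_lt_iff_lt_toReal hs0.le hpq₀.ne_top).1 hp
  rcases eq_or_ne q₀ ∞ with rfl | hq₀
  · refine ⟨s, 1, rfl, by simp [ENNReal.conjExponent], hs, le_rfl, by simpa using hs0, ?_⟩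
    intro p hp hpq₀
    obtain ⟨t, hst, rfl⟩ := hmid p hp hpq₀
    have ht : 1 < t := by linarith
    have : 0 < (t - 1)⁻¹ := inv_pos.2 (sub_pos.2 ht)
    exact ⟨t, _, conjExponent_ofReal ht, holderConjugate_one_add_inv ht, hst, by linarith⟩
  · obtain ⟨b, hb, rfl⟩ : ∃ b : ℝ, s < b ∧ q₀ = ENNReal.ofReal b :=
      ⟨q₀.toReal, (ENNReal.ofReal_lt_iff_lt_toReal hs0.le hq₀).1 hpq,
        (ENNReal.ofReal_toReal hq₀).symm⟩
    have hb1 : 1 < b := by linarith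
    have hconj := holderConjugate_one_add_inv hb1
    refine ⟨s, 1 + (b - 1)⁻¹, rfl, conjExponent_ofReal hb1, hs, hconj.symm.lt.le, ?_, ?_⟩
    · have h1 := hconj.inv_add_inv_eq_one
      have h2 : 1 / b < 1 / s := one_div_lt_one_div_of_lt hs0 hb
      rw [one_div] at h2 ⊢
      linarith
    · intro p hp hpq₀
      obtain ⟨t, hst, rfl⟩ := hmid p hp hpq₀
      have ht : 1 < t := by linarith
      have htb : t < b := (ENNReal.ofReal_lt_ofReal_iff (by linarith)).1 hpq₀
      refine ⟨t, _, conjExponent_ofReal ht, holderConjugate_one_add_inv ht, hst, ?_⟩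
      have : (b - 1)⁻¹ < (t - 1)⁻¹ := inv_strictAnti₀ (by linarith) (by linarith)
      linarith

end Exponents

/-! ### Existence, uniqueness and weighted bounds for T*. -/

section Dual

variable {n : ℕ} {μ : Measure (EuclideanSpace ℝ (Fin n))} {𝕜 : Type*} [RCLike 𝕜]
  {𝒟 : Submodule 𝕜 (EuclideanSpace ℝ (Fin n) → 𝕜)}
  {T : 𝒟 →ₗ[𝕜] (EuclideanSpace ℝ (Fin n) →ₘ[μ] 𝕜)} {D C η : ℝ≥0} {p₀ q₀ : ℝ≥0∞} {s r : ℝ}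
  {w : EuclideanSpace ℝ (Fin n) → ℝ}
  {S S' : Lp 𝕜 q₀.conjExponent μ →ₗ[𝕜] (EuclideanSpace ℝ (Fin n) →ₘ[μ] 𝕜)}

theorem lintegral_enorm_rpow_eq (hr : 0 < r) (f : EuclideanSpace ℝ (Fin n) → 𝕜) :
    ∫⁻ x, ‖f x‖ₑ ^ r ∂μ = eLpNorm f (ENNReal.ofReal r) μ ^ r := by
  rw [eLpNorm_eq_lintegral_rpow_enorm_toReal (by simpa using hr) ENNReal.ofReal_ne_top,
    ENNReal.toReal_ofReal hr.le, ← ENNReal.rpow_mul, one_div_mul_cancel hr.ne', ENNReal.rpow_one]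

/-- The inclusion of the test functions in `L^p`. -/
def IsTestSpace.toLp (h𝒟 : IsTestSpace μ 𝒟) (hμ : IsDoubling μ) {p : ℝ≥0∞} (hp : 1 ≤ p)
    (hpt : p < ∞) : 𝒟 →ₗ[𝕜] Lp 𝕜 p μ where
  toFun f := (h𝒟.memLp hμ hp hpt f.2).toLp f.1
  map_add' f g := MemLp.toLp_add (h𝒟.memLp hμ hp hpt f.2) (h𝒟.memLp hμ hp hpt g.2)
  map_smul' c f := MemLp.toLp_const_smul c (h𝒟.memLp hμ hp hpt f.2)

theorem IsTestSpace.denseRange_toLp (h𝒟 : IsTestSpace μ 𝒟) (hμ : IsDoubling μ) {p : ℝ≥0∞}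
    [Fact (1 ≤ p)] (hp : 1 ≤ p) (hpt : p < ∞) : DenseRange (h𝒟.toLp hμ hp hpt) := by
  intro F
  rw [EMetric.mem_closure_iff]
  intro ε hε
  obtain ⟨ε', hε'0, hε'⟩ := exists_between hε
  obtain ⟨g, hg, hge⟩ := h𝒟.exists_approx hμ hp hpt (Lp.memLp F) hε'0
  refine ⟨h𝒟.toLp hμ hp hpt ⟨g, hg⟩, ⟨⟨g, hg⟩, rfl⟩, lt_of_le_of_lt ?_ hε'⟩
  have h1 : F = (Lp.memLp F).toLp F := (Lp.toLp_coeFn F (Lp.memLp F)).symm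
  conv_lhs => rw [h1]
  change edist _ ((h𝒟.memLp hμ hp hpt hg).toLp g) ≤ _
  rw [Lp.edist_toLp_toLp]
  exact hge

/-- Every function in `L^p` is the limit of a sequence of test functions. -/
theorem IsTestSpace.exists_seq_tendsto (h𝒟 : IsTestSpace μ 𝒟) (hμ : IsDoubling μ) {p : ℝ≥0∞}
    [Fact (1 ≤ p)] (hp : 1 ≤ p) (hpt : p < ∞) (F : Lp 𝕜 p μ) :
    ∃ g : ℕ → 𝒟, Tendsto (fun k => h𝒟.toLp hμ hp hpt (g k)) atTop (𝓝 F) := by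
  obtain ⟨y, hy, hyF⟩ := mem_closure_iff_seq_limit.1 (h𝒟.denseRange_toLp hμ hp hpt F)
  choose g hg using hy
  exact ⟨g, by simpa only [hg] using hyF⟩

theorem IsDual.tendstoInMeasure [Fact (1 ≤ q₀.conjExponent)] (hS : IsDual μ p₀ q₀ 𝒟 T S)
    {u : ℕ → Lp 𝕜 q₀.conjExponent μ} {f : Lp 𝕜 q₀.conjExponent μ} (hu : Tendsto u atTop (𝓝 f)) :
    TendstoInMeasure μ (fun k => (S (u k) : EuclideanSpace ℝ (Fin n) → 𝕜)) atTop (S f) := by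
  refine hS.continuous u f ?_
  have h := (tendsto_iff_edist_tendsto_0.1 hu)
  simp_rw [Lp.edist_def] at h
  refine h.congr fun k => eLpNorm_congr_ae ?_
  exact (Lp.coeFn_sub _ _).symm

theorem IsDual.represents (hS : IsDual μ p₀ q₀ 𝒟 T S) (f : 𝒟)
    (hf : MemLp f.1 q₀.conjExponent μ) : Represents T f.1 (S (hf.toLp f.1)) :=
  fun g => hS.pairing f g hf

/-- There is at most one dual operator. -/
theorem IsDual.eq (hn : 1 ≤ n) (hμ : IsDoubling μ) (h𝒟 : IsTestSpace μ 𝒟)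
    (hp₀ : 1 ≤ p₀) (hpq : p₀ < q₀) (hS : IsDual μ p₀ q₀ 𝒟 T S) (hS' : IsDual μ p₀ q₀ 𝒟 T S') :
    S = S' := by
  obtain ⟨s, r, hs, hr, hs1, hr1, -, hmid⟩ := exists_real_exponents hp₀ hpq
  obtain ⟨p, hp, hpq₀⟩ := exists_between hpq
  obtain ⟨t, t', ht', htt', -, -⟩ := hmid p hp hpq₀
  have h1 : 1 ≤ q₀.conjExponent := by rw [hr]; exact one_le_ofReal hr1
  have h2 : q₀.conjExponent < ∞ := by rw [hr]; exact ENNReal.ofReal_lt_top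
  have : Fact (1 ≤ q₀.conjExponent) := ⟨h1⟩
  have htest : ∀ f : 𝒟, S (h𝒟.toLp hμ h1 h2 f) = S' (h𝒟.toLp hμ h1 h2 f) := fun f => by
    have hf : MemLp f.1 q₀.conjExponent μ := h𝒟.memLp hμ h1 h2 f.2
    have hm := hS.memLp f hf p hp hpq₀
    have hm' := hS'.memLp f hf p hp hpq₀
    rw [ht'] at hm hm'
    exact AEEqFun.ext ((hS.represents f hf).ae_eq hn hμ h𝒟 htt' htt' hm hm' (hS'.represents f hf))
  refine LinearMap.ext fun F => AEEqFun.ext ?_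
  obtain ⟨g, hg⟩ := h𝒟.exists_seq_tendsto hμ h1 h2 F
  refine tendstoInMeasure_ae_unique (hS.tendstoInMeasure hg) ?_
  simp_rw [htest]
  exact hS'.tendstoInMeasure hg

/-- The dual operator exists. -/
theorem SparselyDominated.exists_isDual (hn : 1 ≤ n) (hμ : IsDoubling μ) (h𝒟 : IsTestSpace μ 𝒟)
    (hp₀ : 1 ≤ p₀) (hpq : p₀ < q₀) (hη : 0 < η) (hη1 : η ≤ 1)
    (hT : SparselyDominated μ p₀ q₀ C η 𝒟 T) :
    ∃ S : Lp 𝕜 q₀.conjExponent μ →ₗ[𝕜] (EuclideanSpace ℝ (Fin n) →ₘ[μ] 𝕜),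
      IsDual μ p₀ q₀ 𝒟 T S := by
  obtain ⟨s, r, rfl, hr, hs1, hr1, hsr, hmid⟩ := exists_real_exponents hp₀ hpq
  obtain ⟨p, hp, hpq₀⟩ := exists_between hpq
  obtain ⟨t, t', -, htt', hst, hrt'⟩ := hmid p hp hpq₀
  have hr0 : 0 < r := by linarith
  have h1 : 1 ≤ q₀.conjExponent := by rw [hr]; exact one_le_ofReal hr1
  have h2 : q₀.conjExponent < ∞ := by rw [hr]; exact ENNReal.ofReal_lt_top
  have : Fact (1 ≤ q₀.conjExponent) := ⟨h1⟩
  choose h hh hrep using fun f : 𝒟 => hT.exists_represents hn hμ h𝒟 hr hr1 hs1 hη htt' hst hrt' f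
  have hint : ∀ f g : 𝒟, Integrable (fun x => f.1 x * T g x) μ := fun f g =>
    ((hT g f).1).congr (Eventually.of_forall fun x => mul_comm _ _)
  have htest : ∀ f : 𝒟, MemLp f.1 (ENNReal.ofReal t) μ := fun f =>
    h𝒟.memLp hμ (one_le_ofReal htt'.lt.le) ENNReal.ofReal_lt_top f.2
  let S₀ : 𝒟 →ₗ[𝕜] (EuclideanSpace ℝ (Fin n) →ₘ[μ] 𝕜) :=
    { toFun := fun f => AEEqFun.mk (h f) (hh f).1
      map_add' := fun f f' => by
        rw [AEEqFun.mk_add_mk, AEEqFun.mk_eq_mk]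
        refine (hrep (f + f')).ae_eq hn hμ h𝒟 htt' htt' (hh _) ((hh f).add (hh f')) fun g => ?_
        simp only [Pi.add_apply, Submodule.coe_add, add_mul]
        rw [integral_add (integrable_mul_of_memLp htt' (hh f) (htest g))
          (integrable_mul_of_memLp htt' (hh f') (htest g)), integral_add (hint f g) (hint f' g),
          hrep f g, hrep f' g]
      map_smul' := fun c f => by
        change AEEqFun.mk (h (c • f)) (hh (c • f)).1 = AEEqFun.mk (c • h f) ((hh f).1.const_smul c)
        exact AEEqFun.mk_eq_mk.2 <| (hrep (c • f)).ae_eq hn hμ h𝒟 htt' htt' (hh _) ((hh f).const_smul c)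
          ((hrep f).const_smul c) }
  have hS₀ : ∀ f, S₀ f =ᵐ[μ] h f := fun f => AEEqFun.coeFn_mk _ _
  set D := Real.toNNReal (2 ^ doublingDimension μ) + 1
  -- For the constant weight the estimate is the unweighted weak type (r,r), which is what the
  -- extension to L^r requires.
  set w₁ : EuclideanSpace ℝ (Fin n) → ℝ := fun _ => 1
  set K := weakTypeConst n D C η s r * (AInftyConst μ w₁ * ENNReal.ofReal (logFactor μ w₁))
  have hK : K ≠ ∞ := ENNReal.mul_ne_top (weakTypeConst_ne_top hr0.le hη) (ENNReal.mul_ne_top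
    ((AInftyConst_one_le hμ).trans_lt ENNReal.one_lt_top).ne ENNReal.ofReal_ne_top)
  set e := h𝒟.toLp hμ h1 h2 with he
  obtain ⟨S, hSe, hSw⟩ := exists_extension_of_weak_type (e := e) (S₀ := S₀)
    (Φ := fun z => K * ENNReal.ofReal z ^ r) (h𝒟.denseRange_toLp hμ h1 h2)
    ((ENNReal.continuous_const_mul hK).comp
      (ENNReal.continuous_rpow_const.comp ENNReal.continuous_ofReal)) (by simp [hr0])
    (fun f a ha => by
      have key := (hrep f).weak_type hn hμ hμ.doublingWith (by simp) h𝒟 hr hr1 hs1 hsr hη hη1 hT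
        (isA1_one hn hμ) f.2 htt' (hh f) ha
      simp only [weightMeasure_one, Real.one_rpow, mul_one] at key
      refine (le_of_eq (measure_congr ?_)).trans (key.trans (le_of_eq ?_))
      · filter_upwards [hS₀ f] with x hx
        change (a < _) = (a < _)
        rw [hx]
      · have h3 : ‖e f‖ = (eLpNorm f.1 q₀.conjExponent μ).toReal :=
          Lp.norm_toLp _ (h𝒟.memLp hμ h1 h2 f.2)
        rw [h3, ENNReal.ofReal_div_of_pos ha,
          ENNReal.ofReal_toReal (h𝒟.memLp hμ h1 h2 f.2).2.ne, lintegral_enorm_rpow_eq hr0, hr,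
          ENNReal.div_rpow_of_nonneg _ _ hr0.le])
  refine ⟨S, ?_, ?_, ?_⟩
  · intro f hf q hq hqq₀
    obtain ⟨v, v', hv', hvv', hsv, hrv'⟩ := hmid q hq hqq₀
    -- S₀ was built with one exponent; the representative for any other exponent agrees with it
    -- a.e., which gives membership for all of them.
    obtain ⟨h', hh', hrep'⟩ := hT.exists_represents hn hμ h𝒟 hr hr1 hs1 hη hvv' hsv hrv' f
    have heq : S (hf.toLp f.1) = S₀ f := hSe f
    rw [hv', heq]
    exact (memLp_congr_ae ((hS₀ f).trans ((hrep f).ae_eq hn hμ h𝒟 htt' hvv' (hh f) hh' hrep'))).2 hh'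
  · intro f g hf
    have heq : S (hf.toLp f.1) = S₀ f := hSe f
    rw [heq, ← hrep f g]
    refine integral_congr_ae ?_
    filter_upwards [hS₀ f] with x hx
    rw [hx]
  · intro u f hu
    rw [tendstoInMeasure_iff_norm]
    intro ε hε
    -- Convergence in measure concerns the sets ε ≤ ‖·‖, while the weak bound has a strict
    -- inequality; halving ε bridges the two.
    have hε2 : 0 < ε / 2 := by positivity
    have hnorm : Tendsto (fun k => K * ENNReal.ofReal (‖u k - f‖ / (ε / 2)) ^ r) atTop (𝓝 0) := by
      have h3 : Tendsto (fun k => ‖u k - f‖ / (ε / 2)) atTop (𝓝 0) := by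
        have := (ENNReal.tendsto_toReal ENNReal.zero_ne_top).comp hu
        simpa [Lp.norm_def, Function.comp_def] using this.div_const (ε / 2)
      have h4 := ((ENNReal.continuous_const_mul hK).comp
        ((ENNReal.continuous_rpow_const (y := r)).comp ENNReal.continuous_ofReal)).tendsto 0
      simpa [Function.comp_def, hr0] using h4.comp h3
    refine tendsto_of_tendsto_of_tendsto_of_le_of_le tendsto_const_nhds hnorm
      (fun k => zero_le) (fun k => le_trans (measure_mono_ae ?_) (hSw (u k - f) (ε / 2) hε2))
    rw [map_sub]
    filter_upwards [AEEqFun.coeFn_sub (S (u k)) (S f)] with x hx (hεx : ε ≤ _)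
    change ε / 2 < _
    rw [hx, Pi.sub_apply]
    linarith

/-- The weak type estimate for the dual operator. -/
theorem IsDual.weightMeasure_le (hn : 1 ≤ n) (hμ : IsDoubling μ)
    (hD : DoublingWith μ D) (hD1 : 1 ≤ D) (h𝒟 : IsTestSpace μ 𝒟)
    (hs : p₀ = ENNReal.ofReal s) (hpq : p₀ < q₀)
    (hr : q₀.conjExponent = ENNReal.ofReal r) (hr1 : 1 ≤ r) (hs1 : 1 ≤ s) (hsr : 1 - 1 / r < 1 / s)
    (hη : 0 < η) (hη1 : η ≤ 1)
    (hT : SparselyDominated μ p₀ q₀ C η 𝒟 T) (hS : IsDual μ p₀ q₀ 𝒟 T S) (hw : IsA1 μ w)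
    (hwt : AInftyConst μ w ≠ ∞) (f : Lp 𝕜 q₀.conjExponent μ) {a : ℝ} (ha : 0 < a) :
    weightMeasure μ w {x | a * w x ^ (1 / r) < ‖S f x‖} ≤
      weakTypeConst n D C η s r * (AInftyConst μ w * ENNReal.ofReal (logFactor μ w)) *
        (eLpNorm f q₀.conjExponent μ ^ r / ENNReal.ofReal a ^ r) := by
  have hr0 : 0 < r := by linarith
  have h1 : 1 ≤ q₀.conjExponent := by rw [hr]; exact one_le_ofReal hr1
  have h2 : q₀.conjExponent < ∞ := by rw [hr]; exact ENNReal.ofReal_lt_top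
  have : Fact (1 ≤ q₀.conjExponent) := ⟨h1⟩
  obtain ⟨_, _, -, -, -, -, -, hmid⟩ := exists_real_exponents (hs ▸ one_le_ofReal hs1) hpq
  obtain ⟨p, hp, hpq₀⟩ := exists_between hpq
  obtain ⟨t, t', ht', htt', -, -⟩ := hmid p hp hpq₀
  obtain ⟨g, hg⟩ := h𝒟.exists_seq_tendsto hμ h1 h2 f
  -- Convergence in measure refers to μ and not to w dμ; a.e. convergence of a subsequence transfers
  -- by absolute continuity.
  obtain ⟨φ, hφ, hae⟩ := (hS.tendstoInMeasure hg).exists_seq_tendsto_ae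
  have hK : weakTypeConst n D C η s r * (AInftyConst μ w * ENNReal.ofReal (logFactor μ w)) ≠ ∞ :=
    ENNReal.mul_ne_top (weakTypeConst_ne_top hr0.le hη)
      (ENNReal.mul_ne_top hwt ENNReal.ofReal_ne_top)
  have hmem : ∀ k, MemLp (g (φ k)).1 q₀.conjExponent μ := fun k => h𝒟.memLp hμ h1 h2 (g (φ k)).2
  refine measure_lt_norm_le_of_tendsto (withDensity_absolutelyContinuous _ _ hae)
    (c := fun k => weakTypeConst n D C η s r * (AInftyConst μ w *
      ENNReal.ofReal (logFactor μ w)) * (eLpNorm (g (φ k)).1 q₀.conjExponent μ ^ r /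
        ENNReal.ofReal a ^ r)) (fun k => ?_) ?_
  · have hm := hS.memLp (g (φ k)) (hmem k) p hp hpq₀
    rw [ht'] at hm
    have := (hS.represents (g (φ k)) (hmem k)).weak_type hn hμ hD hD1 h𝒟 hr hr1 hs1 hsr hη hη1
      (hs ▸ hT) hw (g (φ k)).2 htt' hm ha
    rw [lintegral_enorm_rpow_eq hr0, ← hr] at this
    exact this
  · refine ENNReal.Tendsto.const_mul (ENNReal.Tendsto.div_const ?_ (Or.inr ?_)) (Or.inr hK)
    · refine (ENNReal.continuous_rpow_const.tendsto _).comp ?_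
      have h3 := (hg.comp hφ.tendsto_atTop).enorm
      simp only [Lp.enorm_def] at h3
      refine h3.congr fun k => eLpNorm_congr_ae ?_
      exact (hmem k).coeFn_toLp
    · exact (ENNReal.rpow_pos (by simpa using ha) ENNReal.ofReal_ne_top).ne'

/-- If [w]_{A∞} is infinite the right side is infinite unless f = 0. The case f = 0 is treated
separately, because there the product is 0 by the convention ∞ · 0 = 0. -/
theorem IsDual.weakNorm_le (hn : 1 ≤ n) (hμ : IsDoubling μ)
    (hD : DoublingWith μ D) (hD1 : 1 ≤ D) (h𝒟 : IsTestSpace μ 𝒟)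
    (hs : p₀ = ENNReal.ofReal s) (hpq : p₀ < q₀)
    (hr : q₀.conjExponent = ENNReal.ofReal r) (hr1 : 1 ≤ r) (hs1 : 1 ≤ s) (hsr : 1 - 1 / r < 1 / s)
    (hη : 0 < η) (hη1 : η ≤ 1)
    (hT : SparselyDominated μ p₀ q₀ C η 𝒟 T) (hS : IsDual μ p₀ q₀ 𝒟 T S) (hw : IsA1 μ w)
    (f : Lp 𝕜 q₀.conjExponent μ) :
    weakNorm (fun x => S f x / ((w x ^ (1 / q₀.conjExponent.toReal) : ℝ) : 𝕜))
        q₀.conjExponent (weightMeasure μ w) ≤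
      weakTypeConst n D C η s r ^ (1 / r) *
        (AInftyConst μ w * ENNReal.ofReal (logFactor μ w)) ^ (1 / q₀.conjExponent.toReal) *
        eLpNorm f q₀.conjExponent μ := by
  have hr0 : 0 < r := by linarith
  have hri : 0 < 1 / r := by positivity
  have hrr : q₀.conjExponent.toReal = r := by rw [hr, ENNReal.toReal_ofReal hr0.le]
  rw [hrr]
  set K := AInftyConst μ w * ENNReal.ofReal (logFactor μ w) with hK
  set A := weakTypeConst n D C η s r
  have hL0 : ENNReal.ofReal (logFactor μ w) ≠ 0 :=
    (ENNReal.ofReal_pos.2 (zero_lt_one.trans_le one_le_logFactor)).ne'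
  refine iSup_le fun a => ?_
  rw [hrr]
  rcases eq_or_ne a 0 with rfl | ha
  · simp
  have ha0 : (0 : ℝ) < a := by exact_mod_cast pos_iff_ne_zero.2 ha
  have hset : {x | (a : ℝ≥0∞) < ‖S f x / ((w x ^ (1 / r) : ℝ) : 𝕜)‖ₑ} =
      {x | (a : ℝ) * w x ^ (1 / r) < ‖S f x‖} := by
    ext x
    have hwx : 0 < w x ^ (1 / r) := Real.rpow_pos_of_pos (hw.1.2 x) _
    simp only [Set.mem_ofPred_eq]
    rw [← ofReal_norm, norm_div, RCLike.norm_of_nonneg hwx.le, ENNReal.lt_ofReal_iff_toReal_lt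
      ENNReal.coe_ne_top, ENNReal.coe_toReal, lt_div_iff₀ hwx]
  rw [hset]
  have : Fact (1 ≤ q₀.conjExponent) := ⟨by rw [hr]; exact one_le_ofReal hr1⟩
  rcases eq_or_ne f 0 with rfl | hf
  · have hzero : weightMeasure μ w {x | (a : ℝ) * w x ^ (1 / r) <
        ‖S (0 : Lp 𝕜 q₀.conjExponent μ) x‖} = 0 := by
      refine withDensity_absolutelyContinuous μ _ ?_
      have : S 0 =ᵐ[μ] (0 : EuclideanSpace ℝ (Fin n) → 𝕜) := by
        rw [map_zero]; exact AEEqFun.coeFn_zero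
      refine measure_eq_zero_iff_ae_notMem.2 ?_
      filter_upwards [this] with x hx (hx' : (a : ℝ) * w x ^ (1 / r) < ‖S 0 x‖)
      have hwx : 0 < w x ^ (1 / r) := Real.rpow_pos_of_pos (hw.1.2 x) _
      rw [hx, Pi.zero_apply, norm_zero] at hx'
      exact absurd hx' (not_lt.2 (by positivity))
    rw [hzero, ENNReal.zero_rpow_of_pos hri, mul_zero]
    exact zero_le
  rcases eq_or_ne (AInftyConst μ w) ∞ with hAt | hAt
  · have hf0 : eLpNorm f q₀.conjExponent μ ≠ 0 := by
      rw [← Lp.enorm_def]; exact enorm_ne_zero.2 hf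
    have hA0 : A ^ (1 / r) ≠ 0 := by
      simp [A, ENNReal.rpow_eq_zero_iff, weakTypeConst_ne_zero, weakTypeConst_ne_top hr0.le hη]
    rw [hK, hAt, ENNReal.top_mul hL0, ENNReal.top_rpow_of_pos hri, ENNReal.mul_top hA0,
      ENNReal.top_mul hf0]
    exact le_top
  · have key := hS.weightMeasure_le hn hμ hD hD1 h𝒟 hs hpq hr hr1 hs1 hsr hη hη1 hT hw hAt f ha0
    have ha' : (a : ℝ≥0∞) ≠ 0 := by exact_mod_cast ha
    rw [ENNReal.ofReal_coe_nnreal, ← ENNReal.div_rpow_of_nonneg _ _ hr0.le] at key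
    calc _ ≤ (a : ℝ≥0∞) * (A * K * (eLpNorm f q₀.conjExponent μ / a) ^ r) ^ (1 / r) := by gcongr
      _ = A ^ (1 / r) * K ^ (1 / r) * (a * (eLpNorm f q₀.conjExponent μ / a)) := by
          rw [ENNReal.mul_rpow_of_nonneg _ _ hri.le, ENNReal.mul_rpow_of_nonneg _ _ hri.le,
            ← ENNReal.rpow_mul, mul_one_div_cancel hr0.ne', ENNReal.rpow_one]
          ring
      _ = _ := by rw [ENNReal.mul_div_cancel ha' ENNReal.coe_ne_top]

end Dual

end SparseDual

/-! ### The main theorem. -/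

theorem theorem1p3 {𝕜 : Type*} [RCLike 𝕜] (n : ℕ) (hn : 1 ≤ n)
    (p₀ q₀ : ℝ≥0∞) (hp₀ : 1 ≤ p₀) (hpq : p₀ < q₀)
    (ν : ℝ) (C η : ℝ≥0) (hC : 0 < C) (hη : 0 < η) (hη1 : η ≤ 1) :
    ∃ c : ℝ≥0, 0 < c ∧
      ∀ (μ : Measure (EuclideanSpace ℝ (Fin n))),
        SparseDual.IsDoubling μ → SparseDual.doublingDimension μ = ν →
      ∀ (𝒟 : Submodule 𝕜 (EuclideanSpace ℝ (Fin n) → 𝕜)), SparseDual.IsTestSpace μ 𝒟 →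
      ∀ (T : 𝒟 →ₗ[𝕜] (EuclideanSpace ℝ (Fin n) →ₘ[μ] 𝕜)),
        SparseDual.SparselyDominated μ p₀ q₀ C η 𝒟 T →
      (∃! S : Lp 𝕜 q₀.conjExponent μ →ₗ[𝕜] (EuclideanSpace ℝ (Fin n) →ₘ[μ] 𝕜),
        SparseDual.IsDual μ p₀ q₀ 𝒟 T S) ∧
      ∀ (S : Lp 𝕜 q₀.conjExponent μ →ₗ[𝕜] (EuclideanSpace ℝ (Fin n) →ₘ[μ] 𝕜)),
        SparseDual.IsDual μ p₀ q₀ 𝒟 T S →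
      ∀ (w : EuclideanSpace ℝ (Fin n) → ℝ), SparseDual.IsA1 μ w →
      ∀ f : Lp 𝕜 q₀.conjExponent μ,
        SparseDual.weakNorm
            (fun x => S f x / ((w x ^ (1 / q₀.conjExponent.toReal) : ℝ) : 𝕜))
            q₀.conjExponent (SparseDual.weightMeasure μ w) ≤
          c * (SparseDual.AInftyConst μ w *
              ENNReal.ofReal (Real.log (Real.exp 1 + (SparseDual.A1Const μ w).toReal))) ^
                (1 / q₀.conjExponent.toReal) *
            eLpNorm f q₀.conjExponent μ := by
  obtain ⟨s, r, hs, hr, hs1, hr1, hsr, -⟩ := SparseDual.exists_real_exponents hp₀ hpq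
  have hr0 : 0 < r := by linarith
  -- The measure enters the constant only through the doubling bound 2^ν + 1, so the constant can be
  -- fixed before μ.
  set A := SparseDual.weakTypeConst n (Real.toNNReal (2 ^ ν) + 1) C η s r ^ (1 / r) with hA
  have hAt : A ≠ ∞ := ENNReal.rpow_ne_top_of_nonneg (by positivity)
    (SparseDual.weakTypeConst_ne_top hr0.le hη)
  have hA0 : A ≠ 0 := by
    simp [A, ENNReal.rpow_eq_zero_iff, SparseDual.weakTypeConst_ne_zero,
      SparseDual.weakTypeConst_ne_top hr0.le hη]
  refine ⟨A.toNNReal, ENNReal.toNNReal_pos hA0 hAt, fun μ hμ hν 𝒟 h𝒟 T hT => ⟨?_, ?_⟩⟩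
  · obtain ⟨S, hS⟩ := hT.exists_isDual hn hμ h𝒟 hp₀ hpq hη hη1
    exact ⟨S, hS, fun S' hS' => hS'.eq hn hμ h𝒟 hp₀ hpq hS⟩
  · intro S hS w hw f
    rw [ENNReal.coe_toNNReal hAt]
    exact hS.weakNorm_le hn hμ (hν ▸ hμ.doublingWith) (by simp) h𝒟 hs hpq hr hr1 hs1 hsr hη hη1 hT
      hw f
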